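/- Let $\hbar,c,m>0$ and $Q\in\mathbb{R}\setminus\{0\}$. Let $H^1$ be the usual Sobolev space of functions $\psi:\mathbb{R}^3\to\mathbb{C}^2$, and let $D^1$ be the space of locally integrable $\mathbf A:\mathbb{R}^3\to\mathbb{R}^3$ whose distributional first order derivatives lie in $L^2$ and for which $\{\mathbf x : |\mathbf A(\mathbf x)|>t\}$ has finite Lebesgue measure for every $t>0$. For $\lambda>0$ put $$\mathcal S_\lambda=\{(\psi,\mathbf A)\in H^1\times D^1 : \|\psi\|_{L^2}^2=\lambda,\ \operatorname{div}\mathbf A=0\}.$$ Write $\nabla_{\mathrm S,\mathbf A}=i\hbar\nabla+\frac Qc\mathbf A$ and $\nabla_{\mathrm P,\mathbf A}=\boldsymbol\sigma\cdot\nabla_{\mathrm S,\mathbf A}$, where $\boldsymbol\sigma=(\sigma^1,\sigma^2,\sigma^3)$ are the Pauli matrices. For $j\in\{\mathrm S,\mathrm P\}$, $\mathbf v\in\mathbb{R}^3$ and $(\psi,\mathbf A)\in\mathcal S_\lambda$ set $$\mathscr E_j^{\mathbf v}(\psi,\mathbf A)=\frac1{2m}\|\nabla_{j,\mathbf A}\psi\|_{L^2}^2+\frac1{8\pi}\Bigl(\|\nabla\otimes\mathbf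 A\|_{L^2}^2-\bigl\|\bigl(\tfrac{\mathbf v}{c}\cdot\nabla\bigr)\mathbf A\bigr\|_{L^2}^2\Bigr)+(\psi,i\hbar\,\mathbf v\cdot\nabla\psi)_{L^2},$$ $$E_j(\mathbf v,\psi,\mathbf A)=\frac1{2m}\|\nabla_{j,\mathbf A}\psi\|_{L^2}^2+\frac{\lambda}{8\pi}\int_{\mathbb{R}^3}\Bigl(|\nabla\times\mathbf A|^2+\bigl|\bigl(\tfrac{\mathbf v}{c}\cdot\nabla\bigr)\mathbf A\bigr|^2\Bigr)\,d\mathbf x ,$$ where $\nabla\otimes\mathbf A$ denotes the $9$-vector of all first derivatives $\partial_kA^l$. Theorem. Let $j\in\{\mathrm S,\mathrm P\}$ and $\lambda>0$. Then there exist $\theta_j,\kappa_j>0$, depending only on $j,\lambda,\hbar,c,Q,m$, such that $$\Bigl|E_j(\mathbf v,\psi,\mathbf A)-\frac{m|\mathbf v|^2}{2}\lambda\Bigr|\le\kappa_j|\mathbf v|^3$$ for every $\mathbf v\in\mathbb{R}^3$ with $0<|\mathbf v|<\theta_j$ and every minimizer $(\psi,\mathbf A)$ of $\mathscr E_j^{\mathbf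 v}$ on $\mathcal S_\lambda$. -/

import Mathlib

open MeasureTheory
open scoped ContDiff

noncomputable section

namespace TravellingWave

/-- Physical space `ℝ³` with its Euclidean norm. -/
abbrev R3 : Type := EuclideanSpace ℝ (Fin 3)

/-- The spinor space `ℂ²` with its Hermitian inner product. -/
abbrev C2 : Type := EuclideanSpace ℂ (Fin 2)

/-- The two models: Maxwell-Schrödinger (`S`) and Maxwell-Pauli (`P`). -/
inductive Model : Type
  | S
  | P

section Weak

variable {F : Type*} [NormedAddCommGroup F] [NormedSpace ℝ F]

/-- `g` is the distributional `k`-th partial derivative of `f` on `ℝ³`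
(both being locally integrable functions). -/
structure HasWeakPartial (k : Fin 3) (f g : R3 → F) : Prop where
  locallyIntegrable : LocallyIntegrable f volume
  locallyIntegrable_deriv : LocallyIntegrable g volume
  integral_eq : ∀ φ : R3 → ℝ, ContDiff ℝ ∞ φ → HasCompactSupport φ →
    ∫ x, (fderiv ℝ φ x (EuclideanSpace.single k 1)) • f x = -∫ x, φ x • g x

/-- The weak partial derivative is unique up to null sets. -/
theorem HasWeakPartial.ae_eq [CompleteSpace F] {k : Fin 3} {f g h : R3 → F}
    (hg : HasWeakPartial k f g) (hh : HasWeakPartial k f h) : g =ᵐ[volume] h := by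
  refine ae_eq_of_integral_contDiff_smul_eq hg.locallyIntegrable_deriv
    hh.locallyIntegrable_deriv fun φ hφ hc => ?_
  have h1 := hg.integral_eq φ hφ hc
  have h2 := hh.integral_eq φ hφ hc
  exact neg_injective (h1.symm.trans h2)

open Classical in
/-- The `k`-th distributional partial derivative of `f`, as a function (determined up to null
sets; it is `0` by convention if the distributional derivative is not a function). -/
def weakPartial (k : Fin 3) (f : R3 → F) : R3 → F :=
  if h : ∃ g, HasWeakPartial k f g then h.choose else 0

theorem HasWeakPartial.weakPartial {k : Fin 3} {f g : R3 → F} (h : HasWeakPartial k f g) :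
    HasWeakPartial k f (weakPartial k f) := by
  have h' : ∃ g, HasWeakPartial k f g := ⟨g, h⟩
  rw [TravellingWave.weakPartial, dif_pos h']
  exact h'.choose_spec

/-- The Sobolev space `H¹(ℝ³; F)`. -/
structure MemH1 (f : R3 → F) : Prop where
  memLp : MemLp f 2 volume
  memLp_deriv : ∀ k, ∃ g, HasWeakPartial k f g ∧ MemLp g 2 volume

/-- The space `D¹(ℝ³; F)` of locally integrable functions with distributional first order
derivatives in `L²` that vanish at infinity in the measure sense. -/
structure MemD1 (f : R3 → F) : Prop where
  locallyIntegrable : LocallyIntegrable f volume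
  memLp_deriv : ∀ k, ∃ g, HasWeakPartial k f g ∧ MemLp g 2 volume
  vanish : ∀ t : ℝ, 0 < t → volume {x | t < ‖f x‖} < ⊤

/-- The squared `L²`-norm. -/
def normSqL2 (f : R3 → F) : ℝ := ∫ x, ‖f x‖ ^ 2

/-- The directional derivative `(v · ∇) f`. -/
def dirDeriv (v : R3) (f : R3 → F) (x : R3) : F := ∑ k, v k • weakPartial k f x

end Weak

/-- The divergence of a vector field. -/
def div (A : R3 → R3) (x : R3) : ℝ := ∑ k, weakPartial k A x k

/-- The curl of a vector field. -/
def curl (A : R3 → R3) (x : R3) : R3 :=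
  !₂[weakPartial 1 A x 2 - weakPartial 2 A x 1,
     weakPartial 2 A x 0 - weakPartial 0 A x 2,
     weakPartial 0 A x 1 - weakPartial 1 A x 0]

/-- The Pauli matrices `σ¹, σ², σ³`. -/
def pauli : Fin 3 → Matrix (Fin 2) (Fin 2) ℂ :=
  ![!![0, 1; 1, 0], !![0, -Complex.I; Complex.I, 0], !![1, 0; 0, -1]]

/-- The `k`-th component of the covariant derivative `∇_{S,A} ψ = iħ∇ψ + (Q/c) A ψ`. -/
def covDeriv (ħ c Q : ℝ) (A : R3 → R3) (ψ : R3 → C2) (k : Fin 3) (x : R3) : C2 :=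
  (Complex.I * (ħ : ℂ)) • weakPartial k ψ x + ((Q / c * A x k : ℝ) : ℂ) • ψ x

/-- `∇_{P,A} ψ = σ · ∇_{S,A} ψ`. -/
def pauliDeriv (ħ c Q : ℝ) (A : R3 → R3) (ψ : R3 → C2) (x : R3) : C2 :=
  ∑ k, Matrix.toEuclideanLin (pauli k) (covDeriv ħ c Q A ψ k x)

/-- `‖∇_{j,A} ψ‖²` in `L²`. -/
def kineticNormSq (ħ c Q : ℝ) (j : Model) (A : R3 → R3) (ψ : R3 → C2) : ℝ :=
  match j with
  | .S => ∑ k, normSqL2 (covDeriv ħ c Q A ψ k)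
  | .P => normSqL2 (pauliDeriv ħ c Q A ψ)

/-- The functional `ℰ_j^v(ψ, A)`. The last term `(ψ, iħ v·∇ψ)` is a real number for `ψ ∈ H¹`. -/
def functional (ħ c m Q : ℝ) (j : Model) (v : R3) (ψ : R3 → C2) (A : R3 → R3) : ℝ :=
  1 / (2 * m) * kineticNormSq ħ c Q j A ψ
    + 1 / (8 * Real.pi) *
      ((∑ k, normSqL2 (weakPartial k A)) - normSqL2 (dirDeriv (c⁻¹ • v) A))
    + (∫ x, inner ℂ (ψ x) ((Complex.I * (ħ : ℂ)) • dirDeriv v ψ x)).re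

/-- The constraint set `𝒮_λ`. -/
def constraintSet (lam : ℝ) : Set ((R3 → C2) × (R3 → R3)) :=
  {p | MemH1 p.1 ∧ MemD1 p.2 ∧ normSqL2 p.1 = lam ∧ div p.2 =ᵐ[volume] 0}

/-- `(ψ, A)` minimizes `ℰ_j^v` on `𝒮_λ`. -/
def IsMinimizer (ħ c m Q : ℝ) (j : Model) (lam : ℝ) (v : R3) (ψ : R3 → C2) (A : R3 → R3) :
    Prop :=
  (ψ, A) ∈ constraintSet lam ∧
    IsMinOn (fun p => functional ħ c m Q j v p.1 p.2) (constraintSet lam) (ψ, A)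

/-- The energy `E_j(v, ψ, A)` of the travelling wave with profile `(ψ, A)` and velocity `v`. The
field energy is multiplied by `‖ψ‖²`, which equals `λ` on `𝒮_λ`. -/
def energy (ħ c m Q : ℝ) (j : Model) (v : R3) (ψ : R3 → C2) (A : R3 → R3) : ℝ :=
  1 / (2 * m) * kineticNormSq ħ c Q j A ψ
    + 1 / (8 * Real.pi) * (∫ x, (‖curl A x‖ ^ 2 + ‖dirDeriv (c⁻¹ • v) A x‖ ^ 2)) * normSqL2 ψ

end TravellingWave

end

noncomputable section

namespace TravellingWave

open Filter Topology
open scoped ENNReal NNReal Convolution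

section Mollification

variable {F : Type*} [NormedAddCommGroup F]

/-- Translation is continuous in `L²`. -/
theorem tendsto_eLpNorm_translate_sub {f : R3 → F} (hf : MemLp f 2 volume) :
    Tendsto (fun y : R3 => eLpNorm (fun x => f (x - y) - f x) 2 volume) (𝓝 0) (𝓝 0) := by
  have hmp : ∀ y : R3, MeasurePreserving (fun x : R3 => x - y) volume volume :=
    fun y => measurePreserving_sub_right volume y
  let g : R3 → C(R3, R3) :=
    (ContinuousMap.mk (fun a : R3 × R3 ↦ a.2 - a.1) (by fun_prop)).curry
  have hg : Continuous g := ContinuousMap.continuous _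
  have hgm : ∀ y, MeasurePreserving (g y) volume volume := hmp
  have hcont : Continuous fun y => Lp.compMeasurePreserving (g y) (hgm y) (hf.toLp f) :=
    continuous_const.compMeasurePreservingLp hg hgm (by simp)
  have h1 := hcont.tendsto 0
  rw [tendsto_iff_edist_tendsto_0] at h1
  refine h1.congr fun y => ?_
  rw [Lp.toLp_compMeasurePreserving, Lp.toLp_compMeasurePreserving, Lp.edist_toLp_toLp]
  congr 1
  funext x
  simp [g, Function.comp]

theorem eLpNorm_two_sq (f : R3 → F) : eLpNorm f 2 volume ^ 2 = ∫⁻ x, ‖f x‖ₑ ^ 2 := by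
  rw [eLpNorm_eq_lintegral_rpow_enorm_toReal (by simp) (by simp), ← ENNReal.rpow_natCast,
    ← ENNReal.rpow_mul]
  simp

variable [NormedSpace ℝ F]

/-- The mollification of `f` by a normalised bump function. -/
def mollify (φ : ContDiffBump (0 : R3)) (f : R3 → F) : R3 → F :=
  (φ.normed volume) ⋆[ContinuousLinearMap.lsmul ℝ ℝ, volume] f

theorem contDiff_mollify [CompleteSpace F] (φ : ContDiffBump (0 : R3)) {f : R3 → F}
    (hf : LocallyIntegrable f volume) : ContDiff ℝ ∞ (mollify φ f) :=
  φ.hasCompactSupport_normed.contDiff_convolution_left _ φ.contDiff_normed hf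

theorem integrable_mollify_integrand (φ : ContDiffBump (0 : R3)) {f : R3 → F}
    (hf : LocallyIntegrable f volume) (x : R3) :
    Integrable (fun y => φ.normed volume y • f (x - y)) volume :=
  φ.hasCompactSupport_normed.convolutionExists_left (ContinuousLinearMap.lsmul ℝ ℝ)
    φ.continuous_normed hf x

theorem fderiv_mollify [CompleteSpace F] (φ : ContDiffBump (0 : R3)) {k : Fin 3} {f g : R3 → F}
    (h : HasWeakPartial k f g) (x : R3) :
    fderiv ℝ (mollify φ f) x (EuclideanSpace.single k 1) = mollify φ g x := by
  have hρ : ContDiff ℝ ∞ (φ.normed (volume : Measure R3)) := φ.contDiff_normed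
  have hρc := φ.hasCompactSupport_normed (μ := (volume : Measure R3))
  have hd := hρc.hasFDerivAt_convolution_left (ContinuousLinearMap.lsmul ℝ ℝ)
    (hρ.of_le (by simp)) h.locallyIntegrable x
  have hex : Integrable (fun t => ((ContinuousLinearMap.lsmul ℝ ℝ : ℝ →L[ℝ] F →L[ℝ] F).precompL R3)
      (fderiv ℝ (φ.normed volume) t) (f (x - t))) volume :=
    (hρc.fderiv ℝ).convolutionExists_left _ (hρ.continuous_fderiv (by simp))
      h.locallyIntegrable x
  rw [mollify, hd.fderiv, convolution_def, ContinuousLinearMap.integral_apply hex]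
  simp only [ContinuousLinearMap.precompL_apply, ContinuousLinearMap.lsmul_apply]
  have hψ : ContDiff ℝ ∞ (fun s => φ.normed (volume : Measure R3) (x - s)) :=
    hρ.comp (contDiff_const.sub contDiff_id)
  have hψc : HasCompactSupport (fun s => φ.normed (volume : Measure R3) (x - s)) :=
    hρc.comp_homeomorph (Homeomorph.subLeft x)
  have hibp := h.integral_eq _ hψ hψc
  have hder : ∀ s, fderiv ℝ (fun s => φ.normed (volume : Measure R3) (x - s)) s
      (EuclideanSpace.single k 1) =
      - fderiv ℝ (φ.normed volume) (x - s) (EuclideanSpace.single k 1) := by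
    intro s
    have h1 : HasFDerivAt (φ.normed (volume : Measure R3))
        (fderiv ℝ (φ.normed volume) (x - s)) (x - s) :=
      (hρ.differentiable (by simp) _).hasFDerivAt
    have h2 : HasFDerivAt (fun s : R3 => x - s) (-ContinuousLinearMap.id ℝ R3) s := by
      simpa using (hasFDerivAt_id s).const_sub x
    have h3 := h1.comp s h2
    have h4 : HasFDerivAt (fun s => φ.normed (volume : Measure R3) (x - s)) _ s := h3
    rw [h4.fderiv]
    simp
  simp only [hder, neg_smul, integral_neg, neg_inj] at hibp
  rw [mollify, convolution_eq_swap]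
  simp only [ContinuousLinearMap.lsmul_apply]
  rw [← hibp, ← integral_sub_left_eq_self _ volume x]
  simp

theorem lintegral_enorm_normed (φ : ContDiffBump (0 : R3)) :
    ∫⁻ y, ‖φ.normed (volume : Measure R3) y‖ₑ = 1 := by
  have := integral_eq_lintegral_of_nonneg_ae (ae_of_all _ (φ.nonneg_normed (μ := volume)))
    φ.integrable_normed.aestronglyMeasurable
  rw [φ.integral_normed] at this
  have h2 : ∫⁻ y, ‖φ.normed (volume : Measure R3) y‖ₑ
      = ∫⁻ y, ENNReal.ofReal (φ.normed (volume : Measure R3) y) :=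
    lintegral_congr fun y => Real.enorm_of_nonneg (φ.nonneg_normed y)
  rw [h2]
  exact (ENNReal.toReal_eq_one_iff _).1 this.symm

theorem enorm_mollify_sub_sq_le [CompleteSpace F] (φ : ContDiffBump (0 : R3)) {f : R3 → F}
    (hf : LocallyIntegrable f volume) (x : R3) :
    ‖mollify φ f x - f x‖ₑ ^ 2 ≤
      ∫⁻ y, ‖φ.normed volume y‖ₑ * ‖f (x - y) - f x‖ₑ ^ 2 := by
  have hinteg := integrable_mollify_integrand φ hf x
  have hρi : Integrable (φ.normed (volume : Measure R3)) volume := φ.integrable_normed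
  have heq : mollify φ f x - f x = ∫ y, φ.normed volume y • (f (x - y) - f x) := by
    simp only [smul_sub]
    rw [integral_sub hinteg (hρi.smul_const _), integral_smul_const, φ.integral_normed, one_smul]
    rfl
  have hmeas : AEMeasurable (fun y => ‖f (x - y) - f x‖ₑ) volume := by
    have : AEStronglyMeasurable (fun y => f (x - y)) volume :=
      hf.aestronglyMeasurable.comp_quasiMeasurePreserving
        (Measure.measurePreserving_sub_left volume x).quasiMeasurePreserving
    exact (this.sub aestronglyMeasurable_const).enorm
  have hρm : AEMeasurable (fun y => ‖φ.normed (volume : Measure R3) y‖ₑ) volume :=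
    hρi.aestronglyMeasurable.enorm
  have h1 : ‖mollify φ f x - f x‖ₑ ≤
      ∫⁻ y, ‖φ.normed volume y‖ₑ * ‖f (x - y) - f x‖ₑ := by
    rw [heq]
    refine (enorm_integral_le_lintegral_enorm _).trans (lintegral_mono fun y => ?_)
    rw [enorm_smul]
  have h2 := ENNReal.lintegral_mul_norm_pow_le hρm (hρm.mul (hmeas.pow_const 2))
    (p := 1 / 2) (q := 1 / 2) (by norm_num) (by norm_num) (by norm_num)
  rw [lintegral_enorm_normed, ENNReal.one_rpow, one_mul] at h2
  have h3 : ∀ y, ‖φ.normed (volume : Measure R3) y‖ₑ ^ (1 / 2 : ℝ) *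
      (((fun y => ‖φ.normed (volume : Measure R3) y‖ₑ) *
        fun y => ‖f (x - y) - f x‖ₑ ^ 2) y) ^ (1 / 2 : ℝ)
      = ‖φ.normed volume y‖ₑ * ‖f (x - y) - f x‖ₑ := by
    intro y
    rw [Pi.mul_apply, ENNReal.mul_rpow_of_nonneg _ _ (by norm_num), ← mul_assoc,
      ← ENNReal.rpow_add_of_nonneg _ _ (by norm_num) (by norm_num), ← ENNReal.rpow_natCast,
      ← ENNReal.rpow_mul]
    norm_num
  rw [lintegral_congr h3] at h2
  calc _ ≤ ((∫⁻ y, ‖φ.normed volume y‖ₑ * ‖f (x - y) - f x‖ₑ ^ 2) ^ (1 / 2 : ℝ)) ^ 2 := by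
        gcongr
        exact h1.trans h2
    _ = _ := by
        rw [← ENNReal.rpow_natCast, ← ENNReal.rpow_mul]
        norm_num

theorem eLpNorm_mollify_sub_le [CompleteSpace F] (φ : ContDiffBump (0 : R3)) {f : R3 → F}
    (hf : MemLp f 2 volume) {δ : ℝ≥0∞}
    (hδ : ∀ y, ‖y‖ < φ.rOut → eLpNorm (fun x => f (x - y) - f x) 2 volume ≤ δ) :
    eLpNorm (mollify φ f - f) 2 volume ≤ δ := by
  have hloc : LocallyIntegrable f volume := hf.locallyIntegrable (by norm_num)
  have hρi : Integrable (φ.normed (volume : Measure R3)) volume := φ.integrable_normed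
  have hm : AEMeasurable (Function.uncurry fun x y : R3 =>
      ‖φ.normed volume y‖ₑ * ‖f (x - y) - f x‖ₑ ^ 2) (volume.prod volume) := by
    have h1 : AEStronglyMeasurable (fun p : R3 × R3 => f (p.1 - p.2)) (volume.prod volume) :=
      hf.aestronglyMeasurable.comp_quasiMeasurePreserving
        (quasiMeasurePreserving_sub_of_right_invariant volume volume)
    have h2 : AEStronglyMeasurable (fun p : R3 × R3 => f p.1) (volume.prod volume) :=
      hf.aestronglyMeasurable.comp_fst
    have h3 : AEStronglyMeasurable (fun p : R3 × R3 => φ.normed (volume : Measure R3) p.2)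
      (volume.prod volume) := hρi.aestronglyMeasurable.comp_snd
    exact h3.enorm.mul ((h1.sub h2).enorm.pow_const 2)
  have key : eLpNorm (mollify φ f - f) 2 volume ^ 2 ≤ δ ^ 2 := by
    rw [eLpNorm_two_sq]
    calc ∫⁻ x, ‖(mollify φ f - f) x‖ₑ ^ 2
        ≤ ∫⁻ x, ∫⁻ y, ‖φ.normed volume y‖ₑ * ‖f (x - y) - f x‖ₑ ^ 2 :=
          lintegral_mono fun x => enorm_mollify_sub_sq_le φ hloc x
      _ = ∫⁻ y, ∫⁻ x, ‖φ.normed volume y‖ₑ * ‖f (x - y) - f x‖ₑ ^ 2 :=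
          lintegral_lintegral_swap hm
      _ = ∫⁻ y, ‖φ.normed volume y‖ₑ * ∫⁻ x, ‖f (x - y) - f x‖ₑ ^ 2 := by
          refine lintegral_congr fun y => lintegral_const_mul' _ _ (by simp)
      _ ≤ ∫⁻ y, ‖φ.normed (volume : Measure R3) y‖ₑ * δ ^ 2 := by
          refine lintegral_mono fun y => ?_
          by_cases hy : ‖y‖ < φ.rOut
          · have := hδ y hy
            rw [← eLpNorm_two_sq]
            gcongr
          · have : φ.normed (volume : Measure R3) y = 0 := by
              have h0 : y ∉ Function.support (φ.normed (volume : Measure R3)) := by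
                rw [φ.support_normed_eq]
                simpa using hy
              simpa using h0
            simp [this]
      _ = δ ^ 2 := by
          rw [lintegral_mul_const'' _ hρi.aestronglyMeasurable.enorm, lintegral_enorm_normed, one_mul]
  exact (ENNReal.pow_le_pow_left_iff (by norm_num)).1 key

/-- A sequence of bump functions shrinking to the origin. -/
def bump (n : ℕ) : ContDiffBump (0 : R3) where
  rIn := 1 / (n + 1)
  rOut := 2 / (n + 1)
  rIn_pos := by positivity
  rIn_lt_rOut := by gcongr; norm_num

theorem tendsto_bump_rOut : Tendsto (fun n => (bump n).rOut) atTop (𝓝 0) := by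
  have := (tendsto_one_div_add_atTop_nhds_zero_nat (𝕜 := ℝ)).const_mul 2
  simpa [bump, div_eq_mul_inv] using this

/-- Mollifications of an `L²` function converge to it in `L²`. -/
theorem tendsto_eLpNorm_mollify_sub [CompleteSpace F] {f : R3 → F} (hf : MemLp f 2 volume) :
    Tendsto (fun n => eLpNorm (mollify (bump n) f - f) 2 volume) atTop (𝓝 0) := by
  rw [ENNReal.tendsto_nhds_zero]
  intro δ hδ
  have h1 := (ENNReal.tendsto_nhds_zero.1 (tendsto_eLpNorm_translate_sub hf)) δ hδ
  obtain ⟨r, hr, hball⟩ := Metric.eventually_nhds_iff.1 h1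
  have h2 : ∀ᶠ n in atTop, (bump n).rOut < r := tendsto_bump_rOut.eventually_lt_const hr
  filter_upwards [h2] with n hn
  exact eLpNorm_mollify_sub_le (bump n) hf fun y hy => hball (by simpa using hy.trans hn)

theorem ae_tendsto_mollify [CompleteSpace F] {f : R3 → F} (hf : LocallyIntegrable f volume) :
    ∀ᵐ x, Tendsto (fun n => mollify (bump n) f x) atTop (𝓝 (f x)) := by
  refine ContDiffBump.ae_convolution_tendsto_right_of_locallyIntegrable (K := 2)
    tendsto_bump_rOut (Eventually.of_forall fun n => ?_) hf
  simp [bump, div_eq_mul_inv]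

end Mollification

section L2Limits

variable {F : Type*} [NormedAddCommGroup F]

theorem tendsto_eLpNorm_of_tendsto_lintegral_sq {u : ℕ → R3 → F}
    (h : Tendsto (fun n => ∫⁻ x, ‖u n x‖ₑ ^ 2) atTop (𝓝 0)) :
    Tendsto (fun n => eLpNorm (u n) 2 volume) atTop (𝓝 0) := by
  have h1 := (ENNReal.continuous_rpow_const (y := (1 / 2 : ℝ))).tendsto 0 |>.comp h
  rw [ENNReal.zero_rpow_of_pos (by norm_num)] at h1
  refine h1.congr fun n => ?_
  rw [Function.comp_apply, ← eLpNorm_two_sq, ← ENNReal.rpow_natCast, ← ENNReal.rpow_mul]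
  norm_num

variable [NormedSpace ℝ F]

/-- Multiplying an `L²` function by bounded factors tending to zero a.e. gives an `L²`-null
sequence. -/
theorem tendsto_eLpNorm_smul_of_ae {a : ℕ → R3 → ℝ} {g : R3 → F} {M : ℝ}
    (ha : ∀ n, AEStronglyMeasurable (a n) volume) (hM : ∀ n x, |a n x| ≤ M)
    (hlim : ∀ᵐ x, Tendsto (fun n => a n x) atTop (𝓝 0)) (hg : MemLp g 2 volume) :
    Tendsto (fun n => eLpNorm (fun x => a n x • g x) 2 volume) atTop (𝓝 0) := by
  refine tendsto_eLpNorm_of_tendsto_lintegral_sq ?_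
  rw [← lintegral_zero (μ := (volume : Measure R3))]
  have hgfin : ∫⁻ x, ‖g x‖ₑ ^ 2 ≠ ⊤ := by
    rw [← eLpNorm_two_sq]
    exact ENNReal.pow_ne_top hg.2.ne
  refine tendsto_lintegral_of_dominated_convergence' (fun x => ENNReal.ofReal M ^ 2 * ‖g x‖ₑ ^ 2)
    (fun n => ((ha n).smul hg.1).enorm.pow_const 2) (fun n => ae_of_all _ fun x => ?_) ?_ ?_
  · simp only [enorm_smul, mul_pow]
    gcongr
    rw [← ofReal_norm]
    exact ENNReal.ofReal_le_ofReal (hM n x)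
  · rw [lintegral_const_mul' _ _ (by simp)]
    exact ENNReal.mul_ne_top (by simp) hgfin
  · filter_upwards [hlim] with x hx
    have h1 : Tendsto (fun n => a n x • g x) atTop (𝓝 0) := by
      simpa using hx.smul_const (g x)
    have h2 := (continuous_enorm.tendsto (0 : F)).comp h1
    have h3 := ENNReal.Tendsto.pow (n := 2) h2
    simpa using h3

theorem eLpNorm_smul_le_of_abs_le {a : R3 → ℝ} {M : ℝ≥0} (g : R3 → F) (h : ∀ x, |a x| ≤ M) :
    eLpNorm (fun x => a x • g x) 2 volume ≤ M * eLpNorm g 2 volume := by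
  have := eLpNorm_le_nnreal_smul_eLpNorm_of_ae_le_mul (μ := (volume : Measure R3))
    (f := fun x => a x • g x) (g := g) (c := M) (ae_of_all _ fun x => ?_) 2
  · simpa [ENNReal.smul_def] using this
  · rw [nnnorm_smul]
    gcongr
    exact_mod_cast h x

theorem tendsto_integral_smul_of_eLpNorm [CompleteSpace F] {φ : R3 → ℝ} (hφ : MemLp φ 2 volume)
    {u : ℕ → R3 → F} {f : R3 → F} (hu : ∀ n, MemLp (u n) 2 volume) (hf : MemLp f 2 volume)
    (h : Tendsto (fun n => eLpNorm (u n - f) 2 volume) atTop (𝓝 0)) :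
    Tendsto (fun n => ∫ x, φ x • u n x) atTop (𝓝 (∫ x, φ x • f x)) := by
  have hi : ∀ {w : R3 → F}, MemLp w 2 volume → Integrable (fun x => φ x • w x) volume := by
    intro w hw
    exact memLp_one_iff_integrable.1 (hw.smul hφ)
  refine tendsto_integral_of_L1' _ (hi hf).1 (Eventually.of_forall fun n => hi (hu n)) ?_
  have hb : Tendsto (fun n => eLpNorm φ 2 volume * eLpNorm (u n - f) 2 volume) atTop (𝓝 0) := by
    simpa using ENNReal.Tendsto.const_mul h (Or.inr hφ.2.ne)
  refine tendsto_of_tendsto_of_tendsto_of_le_of_le tendsto_const_nhds hb (fun _ => zero_le)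
    fun n => ?_
  have h1 := eLpNorm_smul_le_mul_eLpNorm (p := 2) (q := 2) (r := 1) ((hu n).1.sub hf.1) hφ.1
  refine le_trans (le_of_eq ?_) h1
  congr 1
  funext x
  simp [smul_sub]

end L2Limits

section WeakPartial

variable {F G : Type*} [NormedAddCommGroup F] [NormedSpace ℝ F]
  [NormedAddCommGroup G] [NormedSpace ℝ G]

/-- The classical `k`-th partial derivative. -/
def pd (k : Fin 3) (f : R3 → F) (x : R3) : F := fderiv ℝ f x (EuclideanSpace.single k 1)

theorem continuous_pd {k : Fin 3} {f : R3 → F} (hf : ContDiff ℝ 1 f) : Continuous (pd k f) :=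
  (hf.continuous_fderiv (by simp)).clm_apply continuous_const

theorem contDiff_pd {k : Fin 3} {f : R3 → F} (hf : ContDiff ℝ ∞ f) : ContDiff ℝ ∞ (pd k f) :=
  (hf.fderiv_right (m := ∞) (by simp)).clm_apply contDiff_const

theorem hasCompactSupport_pd {k : Fin 3} {f : R3 → F} (hf : HasCompactSupport f) :
    HasCompactSupport (pd k f) :=
  hf.fderiv_apply ℝ _

theorem HasWeakPartial.of_contDiff {k : Fin 3} {f : R3 → F} (hf : ContDiff ℝ 1 f) :
    HasWeakPartial k f (pd k f) where
  locallyIntegrable := hf.continuous.locallyIntegrable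
  locallyIntegrable_deriv := (continuous_pd hf).locallyIntegrable
  integral_eq φ hφ hc := by
    have hφ1 : ContDiff ℝ 1 φ := hφ.of_le (by simp)
    have hl := hf.continuous.locallyIntegrable (μ := (volume : Measure R3))
    have := integral_smul_fderiv_eq_neg_fderiv_smul_of_integrable (μ := (volume : Measure R3))
      (f := φ) (g := f) (v := EuclideanSpace.single k 1)
      (hl.integrable_smul_left_of_hasCompactSupport (continuous_pd (k := k) hφ1)
        (hasCompactSupport_pd hc))
      ((continuous_pd (k := k) hf).locallyIntegrable.integrable_smul_left_of_hasCompactSupport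
        hφ.continuous hc)
      (hl.integrable_smul_left_of_hasCompactSupport hφ.continuous hc)
      (fun x _ => hφ1.differentiable (by simp) x) (fun x _ => hf.differentiable (by simp) x)
    simp only [pd]
    rw [this, neg_neg]

theorem HasWeakPartial.clm_comp [CompleteSpace F] [CompleteSpace G] {k : Fin 3} {f g : R3 → F}
    (h : HasWeakPartial k f g) (L : F →L[ℝ] G) :
    HasWeakPartial k (fun x => L (f x)) (fun x => L (g x)) where
  locallyIntegrable := fun x => by
    obtain ⟨s, hs, hi⟩ := h.locallyIntegrable x
    exact ⟨s, hs, L.integrable_comp hi⟩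
  locallyIntegrable_deriv := fun x => by
    obtain ⟨s, hs, hi⟩ := h.locallyIntegrable_deriv x
    exact ⟨s, hs, L.integrable_comp hi⟩
  integral_eq φ hφ hc := by
    have hφ1 : ContDiff ℝ 1 φ := hφ.of_le (by simp)
    have h1 := h.locallyIntegrable.integrable_smul_left_of_hasCompactSupport
      (continuous_pd (k := k) hφ1) (hasCompactSupport_pd hc)
    have h2 := h.locallyIntegrable_deriv.integrable_smul_left_of_hasCompactSupport
      hφ.continuous hc
    have h3 := congrArg L (h.integral_eq φ hφ hc)
    have e1 := L.integral_comp_comm h1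
    have e2 := L.integral_comp_comm h2
    simp only [map_smul, map_neg] at e1 e2 h3
    rw [e2, ← h3]
    exact e1

theorem HasWeakPartial.sub {k : Fin 3} {f g f' g' : R3 → F}
    (h : HasWeakPartial k f g) (h' : HasWeakPartial k f' g') :
    HasWeakPartial k (f - f') (g - g') where
  locallyIntegrable := h.locallyIntegrable.sub h'.locallyIntegrable
  locallyIntegrable_deriv := h.locallyIntegrable_deriv.sub h'.locallyIntegrable_deriv
  integral_eq φ hφ hc := by
    have hφ1 : ContDiff ℝ 1 φ := hφ.of_le (by simp)
    have h1 := fun {w : R3 → F} (hw : LocallyIntegrable w volume) =>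
      hw.integrable_smul_left_of_hasCompactSupport (continuous_pd (k := k) hφ1)
        (hasCompactSupport_pd hc)
    have h2 := fun {w : R3 → F} (hw : LocallyIntegrable w volume) =>
      hw.integrable_smul_left_of_hasCompactSupport hφ.continuous hc
    simp only [Pi.sub_apply, smul_sub]
    have e1 := integral_sub (h1 h.locallyIntegrable) (h1 h'.locallyIntegrable)
    have e2 := integral_sub (h2 h.locallyIntegrable_deriv) (h2 h'.locallyIntegrable_deriv)
    have e3 := h.integral_eq φ hφ hc
    have e4 := h'.integral_eq φ hφ hc
    simp only [pd] at e1
    rw [e1, e2, e3, e4]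
    abel

theorem weakPartial_ae_eq_pd [CompleteSpace F] {k : Fin 3} {f : R3 → F} (hf : ContDiff ℝ 1 f) :
    weakPartial k f =ᵐ[volume] pd k f :=
  (HasWeakPartial.of_contDiff hf).weakPartial.ae_eq (HasWeakPartial.of_contDiff hf)

end WeakPartial

section Density

variable {F : Type*} [NormedAddCommGroup F] [NormedSpace ℝ F]

/-- A fixed smooth cutoff on `ℝ³`. -/
def cutoffBump : ContDiffBump (0 : R3) where
  rIn := 1
  rOut := 2
  rIn_pos := one_pos
  rIn_lt_rOut := one_lt_two

/-- Smooth cutoffs exhausting `ℝ³`. -/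
def cutoff (n : ℕ) (x : R3) : ℝ := cutoffBump ((n + 1 : ℝ)⁻¹ • x)

theorem contDiff_cutoff (n : ℕ) : ContDiff ℝ ∞ (cutoff n) :=
  cutoffBump.contDiff.comp (contDiff_const_smul _)

theorem hasCompactSupport_cutoff (n : ℕ) : HasCompactSupport (cutoff n) :=
  cutoffBump.hasCompactSupport.comp_smul (by positivity)

theorem cutoff_nonneg (n : ℕ) (x : R3) : 0 ≤ cutoff n x := cutoffBump.nonneg

theorem cutoff_le_one (n : ℕ) (x : R3) : cutoff n x ≤ 1 := cutoffBump.le_one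

theorem tendsto_cutoff (x : R3) : Tendsto (fun n => cutoff n x) atTop (𝓝 1) := by
  refine tendsto_const_nhds.congr' ?_
  filter_upwards [eventually_ge_atTop ⌈‖x‖⌉₊] with n hn
  refine (cutoffBump.one_of_mem_closedBall ?_).symm
  have h1 : ‖x‖ ≤ n := Nat.ceil_le.1 hn
  rw [mem_closedBall_zero_iff, norm_smul, norm_inv, Real.norm_of_nonneg (by positivity)]
  change _ ≤ (1 : ℝ)
  rw [inv_mul_le_iff₀ (by positivity)]
  linarith

theorem pd_cutoff (n : ℕ) (k : Fin 3) (x : R3) :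
    pd k (cutoff n) x = (n + 1 : ℝ)⁻¹ * pd k cutoffBump ((n + 1 : ℝ)⁻¹ • x) := by
  have h1 : HasFDerivAt cutoffBump (fderiv ℝ cutoffBump ((n + 1 : ℝ)⁻¹ • x))
      ((n + 1 : ℝ)⁻¹ • x) :=
    ((cutoffBump.contDiff (n := 1)).differentiable (by simp) _).hasFDerivAt
  have h2 : HasFDerivAt (fun x : R3 => (n + 1 : ℝ)⁻¹ • x)
      ((n + 1 : ℝ)⁻¹ • ContinuousLinearMap.id ℝ R3) x :=
    ((n + 1 : ℝ)⁻¹ • ContinuousLinearMap.id ℝ R3).hasFDerivAt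
  have h3 : HasFDerivAt (cutoff n) _ x := h1.comp x h2
  rw [pd, h3.fderiv]
  simp [pd]

theorem exists_abs_pd_cutoff_le : ∃ K : ℝ≥0, ∀ (n : ℕ) (k : Fin 3) (x : R3),
    |pd k (cutoff n) x| ≤ (n + 1 : ℝ)⁻¹ * K := by
  have hb : ∀ k : Fin 3, ∃ K : ℝ, ∀ x, ‖pd k cutoffBump x‖ ≤ K := fun k =>
    (continuous_pd (cutoffBump.contDiff (n := 1))).bounded_above_of_compact_support
      (hasCompactSupport_pd cutoffBump.hasCompactSupport)
  choose K hK using hb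
  refine ⟨∑ k, (K k).toNNReal, fun n k x => ?_⟩
  rw [pd_cutoff, abs_mul, abs_of_nonneg (by positivity : (0 : ℝ) ≤ (n + 1 : ℝ)⁻¹)]
  gcongr
  refine (hK k _).trans ((Real.le_coe_toNNReal _).trans ?_)
  exact_mod_cast Finset.single_le_sum (f := fun k => (K k).toNNReal) (fun i _ => zero_le)
    (Finset.mem_univ k)

theorem pd_smul {k : Fin 3} {a : R3 → ℝ} {f : R3 → F} (ha : ContDiff ℝ 1 a) (hf : ContDiff ℝ 1 f)
    (x : R3) : pd k (fun y => a y • f y) x = a x • pd k f x + pd k a x • f x := by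
  have := fderiv_fun_smul (ha.differentiable (by simp) x) (hf.differentiable (by simp) x)
  simp [pd, this]

/-- Test functions are dense in `H¹`. -/
theorem exists_smooth_approx [CompleteSpace F] {f : R3 → F} {g : Fin 3 → R3 → F}
    (hf : MemLp f 2 volume) (hg : ∀ k, HasWeakPartial k f (g k)) (hgL : ∀ k, MemLp (g k) 2 volume) :
    ∃ u : ℕ → R3 → F, (∀ n, ContDiff ℝ ∞ (u n)) ∧ (∀ n, HasCompactSupport (u n)) ∧
      Tendsto (fun n => eLpNorm (u n - f) 2 volume) atTop (𝓝 0) ∧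
      ∀ k, Tendsto (fun n => eLpNorm (pd k (u n) - g k) 2 volume) atTop (𝓝 0) := by
  have hloc : LocallyIntegrable f volume := hf.locallyIntegrable (by norm_num)
  have hm : ∀ n, ContDiff ℝ ∞ (mollify (bump n) f) := fun n => contDiff_mollify _ hloc
  have hcm : ∀ n, AEStronglyMeasurable (cutoff n) volume :=
    fun n => (contDiff_cutoff n).continuous.aestronglyMeasurable
  have habs : ∀ n x, |cutoff n x| ≤ (1 : ℝ≥0) := fun n x => by
    rw [abs_of_nonneg (cutoff_nonneg n x)]
    exact cutoff_le_one n x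
  have hcut : ∀ {w : R3 → F}, MemLp w 2 volume →
      Tendsto (fun n => eLpNorm (fun x => (cutoff n x - 1) • w x) 2 volume) atTop (𝓝 0) := by
    intro w hw
    refine tendsto_eLpNorm_smul_of_ae (M := 1) (fun n => (hcm n).sub aestronglyMeasurable_const)
      (fun n x => ?_) (ae_of_all _ fun x => ?_) hw
    · rw [abs_le]
      constructor <;> linarith [cutoff_nonneg n x, cutoff_le_one n x]
    · simpa using (tendsto_cutoff x).sub_const 1
  have hmain : ∀ {w : R3 → F}, MemLp w 2 volume →
      Tendsto (fun n => eLpNorm (fun x => cutoff n x • mollify (bump n) w x - w x) 2 volume)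
        atTop (𝓝 0) := by
    intro w hw
    have hwl : LocallyIntegrable w volume := hw.locallyIntegrable (by norm_num)
    refine tendsto_of_tendsto_of_tendsto_of_le_of_le tendsto_const_nhds
      (by simpa using (tendsto_eLpNorm_mollify_sub hw).add (hcut hw)) (fun _ => zero_le)
      fun n => ?_
    have hms : AEStronglyMeasurable (mollify (bump n) w - w) volume :=
      (contDiff_mollify _ hwl).continuous.aestronglyMeasurable.sub hw.1
    have e : (fun x => cutoff n x • mollify (bump n) w x - w x) =
        (fun x => cutoff n x • (mollify (bump n) w - w) x) +
          fun x => (cutoff n x - 1) • w x := by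
      funext x
      simp [smul_sub, sub_smul]
    rw [e]
    refine (eLpNorm_add_le ((hcm n).smul hms)
      (((hcm n).sub aestronglyMeasurable_const).smul hw.1) (by norm_num)).trans ?_
    gcongr
    · exact (eLpNorm_smul_le_of_abs_le (mollify (bump n) w - w) (habs n)).trans_eq (by simp)
    · exact le_rfl
  obtain ⟨K, hK⟩ := exists_abs_pd_cutoff_le
  refine ⟨fun n x => cutoff n x • mollify (bump n) f x,
    fun n => (contDiff_cutoff n).smul (hm n),
    fun n => (hasCompactSupport_cutoff n).smul_right, hmain hf, fun k => ?_⟩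
  have hK1 : ∀ n x, |pd k (cutoff n) x| ≤ K := fun n x => (hK n k x).trans <| by
    refine mul_le_of_le_one_left K.2 (inv_le_one_of_one_le₀ ?_)
    have : (0 : ℝ) ≤ n := by positivity
    linarith
  have hpm : ∀ n, AEStronglyMeasurable (pd k (cutoff n)) volume := fun n =>
    (continuous_pd ((contDiff_cutoff n).of_le (by simp))).aestronglyMeasurable
  have hlim0 : Tendsto (fun n => eLpNorm (fun x => pd k (cutoff n) x • f x) 2 volume)
      atTop (𝓝 0) := by
    refine tendsto_eLpNorm_smul_of_ae hpm hK1 (ae_of_all _ fun x => ?_) hf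
    refine squeeze_zero_norm (fun n => hK n k x) ?_
    have := (tendsto_one_div_add_atTop_nhds_zero_nat (𝕜 := ℝ)).mul_const (K : ℝ)
    simpa using this
  have hlim1 : Tendsto (fun n => (K : ℝ≥0∞) * eLpNorm (mollify (bump n) f - f) 2 volume)
      atTop (𝓝 0) := by
    simpa using ENNReal.Tendsto.const_mul (tendsto_eLpNorm_mollify_sub hf)
      (Or.inr ENNReal.coe_ne_top)
  refine tendsto_of_tendsto_of_tendsto_of_le_of_le tendsto_const_nhds
    (by simpa using ((hmain (hgL k)).add (hlim1.add hlim0))) (fun _ => zero_le) fun n => ?_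
  have hms : AEStronglyMeasurable (mollify (bump n) f - f) volume :=
    (hm n).continuous.aestronglyMeasurable.sub hf.1
  have e : pd k (fun x => cutoff n x • mollify (bump n) f x) - g k =
      (fun x => cutoff n x • mollify (bump n) (g k) x - g k x) +
        ((fun x => pd k (cutoff n) x • (mollify (bump n) f - f) x) +
          fun x => pd k (cutoff n) x • f x) := by
    funext x
    have h1 : pd k (mollify (bump n) f) x = mollify (bump n) (g k) x :=
      fderiv_mollify _ (hg k) x
    simp only [Pi.sub_apply, Pi.add_apply]
    rw [pd_smul ((contDiff_cutoff n).of_le (by simp)) ((hm n).of_le (by simp)), h1, smul_sub]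
    abel
  have hmg : AEStronglyMeasurable (fun x => cutoff n x • mollify (bump n) (g k) x - g k x)
      volume := ((hcm n).smul (contDiff_mollify _
        (hg k).locallyIntegrable_deriv).continuous.aestronglyMeasurable).sub (hgL k).1
  change eLpNorm (pd k (fun x => cutoff n x • mollify (bump n) f x) - g k) 2 volume ≤ _
  rw [e]
  refine (eLpNorm_add_le hmg (((hpm n).smul hms).add ((hpm n).smul hf.1)) (by norm_num)).trans ?_
  gcongr
  refine (eLpNorm_add_le ((hpm n).smul hms) ((hpm n).smul hf.1) (by norm_num)).trans ?_
  gcongr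
  · exact eLpNorm_smul_le_of_abs_le _ (hK1 n)
  · exact le_rfl

end Density

/-- Chain rule for weak derivatives. -/
theorem HasWeakPartial.comp_contDiff {k : Fin 3} {f g : R3 → ℝ} (h : HasWeakPartial k f g)
    (hg : MemLp g 2 volume) {Φ : ℝ → ℝ} (hΦ : ContDiff ℝ 1 Φ) {M K : ℝ≥0}
    (hM : ∀ s, |Φ s| ≤ M) (hK : ∀ s, |deriv Φ s| ≤ K) :
    HasWeakPartial k (fun x => Φ (f x)) (fun x => deriv Φ (f x) • g x) := by
  have hΦ' : Continuous (deriv Φ) := hΦ.continuous_deriv (by simp)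
  have hfm : AEStronglyMeasurable f volume := h.locallyIntegrable.aestronglyMeasurable
  have hL1 : ∀ {w : R3 → ℝ}, AEStronglyMeasurable w volume →
      AEStronglyMeasurable (fun x => Φ (w x)) volume := fun hw =>
    hΦ.continuous.comp_aestronglyMeasurable hw
  have hL2 : ∀ {w z : R3 → ℝ}, AEStronglyMeasurable w volume → MemLp z 2 volume →
      MemLp (fun x => deriv Φ (w x) • z x) 2 volume := fun {w z} hw hz =>
    ⟨(hΦ'.comp_aestronglyMeasurable hw).smul hz.1,
      (eLpNorm_smul_le_of_abs_le z fun x => hK (w x)).trans_lt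
        (ENNReal.mul_lt_top ENNReal.coe_lt_top hz.2)⟩
  have hd := hL2 hfm hg
  refine ⟨?_, hd.locallyIntegrable (by norm_num), fun φ hφ hc => ?_⟩
  · exact (memLp_top_of_bound (hL1 hfm) M (ae_of_all _ fun x => hM _)).locallyIntegrable
      (by simp)
  set u : ℕ → R3 → ℝ := fun n => mollify (bump n) f
  have hu : ∀ n, ContDiff ℝ ∞ (u n) := fun n => contDiff_mollify _ h.locallyIntegrable
  have hum : ∀ n, AEStronglyMeasurable (u n) volume :=
    fun n => (hu n).continuous.aestronglyMeasurable
  have hae : ∀ᵐ x, Tendsto (fun n => u n x) atTop (𝓝 (f x)) :=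
    ae_tendsto_mollify h.locallyIntegrable
  have hmolg := tendsto_eLpNorm_mollify_sub hg
  have hmgm : ∀ n, AEStronglyMeasurable (mollify (bump n) g) volume := fun n =>
    (contDiff_mollify _ h.locallyIntegrable_deriv).continuous.aestronglyMeasurable
  have hφ1 : ContDiff ℝ 1 φ := hφ.of_le (by simp)
  have hleft : Tendsto (fun n => ∫ x, pd k φ x • Φ (u n x)) atTop
      (𝓝 (∫ x, pd k φ x • Φ (f x))) := by
    have hpi : Integrable (pd k φ) volume :=
      (continuous_pd hφ1).integrable_of_hasCompactSupport (hasCompactSupport_pd hc)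
    refine tendsto_integral_of_dominated_convergence (fun x => ‖pd k φ x‖ * M)
      (fun n => hpi.1.smul (hL1 (hum n))) (hpi.norm.mul_const _)
      (fun n => ae_of_all _ fun x => ?_) ?_
    · rw [norm_smul]
      gcongr
      exact hM _
    · filter_upwards [hae] with x hx
      exact ((hΦ.continuous.tendsto _).comp hx).const_smul _
  have hfin : ∀ᶠ n in atTop, MemLp (mollify (bump n) g) 2 volume := by
    filter_upwards [hmolg.eventually_lt_const (zero_lt_one)] with n hn
    have h1 : MemLp (mollify (bump n) g - g) 2 volume :=
      ⟨(hmgm n).sub hg.1, hn.trans ENNReal.one_lt_top⟩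
    simpa using h1.add hg
  obtain ⟨N, hN⟩ := eventually_atTop.1 hfin
  have hright : Tendsto (fun n => ∫ x, φ x • (deriv Φ (u (n + N) x) • mollify (bump (n + N)) g x))
      atTop (𝓝 (∫ x, φ x • (deriv Φ (f x) • g x))) := by
    refine tendsto_integral_smul_of_eLpNorm
      (hφ.continuous.memLp_of_hasCompactSupport hc)
      (fun n => hL2 (hum _) (hN _ (Nat.le_add_left _ _))) hd ?_
    have hlim : Tendsto (fun n => eLpNorm (fun x => deriv Φ (u n x) • mollify (bump n) g x
        - deriv Φ (f x) • g x) 2 volume) atTop (𝓝 0) := by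
      have h1 : Tendsto (fun n => (K : ℝ≥0∞) * eLpNorm (mollify (bump n) g - g) 2 volume)
          atTop (𝓝 0) := by
        simpa using ENNReal.Tendsto.const_mul hmolg (Or.inr ENNReal.coe_ne_top)
      have h2 : Tendsto (fun n => eLpNorm (fun x => (deriv Φ (u n x) - deriv Φ (f x)) • g x) 2
          volume) atTop (𝓝 0) := by
        refine tendsto_eLpNorm_smul_of_ae (M := K + K)
          (fun n => (hΦ'.comp_aestronglyMeasurable (hum n)).sub
            (hΦ'.comp_aestronglyMeasurable hfm))
          (fun n x => (abs_sub _ _).trans (add_le_add (hK _) (hK _))) ?_ hg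
        filter_upwards [hae] with x hx
        simpa using ((hΦ'.tendsto _).comp hx).sub_const (deriv Φ (f x))
      refine tendsto_of_tendsto_of_tendsto_of_le_of_le tendsto_const_nhds
        (by simpa using h1.add h2) (fun _ => zero_le) fun n => ?_
      have e : (fun x => deriv Φ (u n x) • mollify (bump n) g x - deriv Φ (f x) • g x) =
          (fun x => deriv Φ (u n x) • (mollify (bump n) g - g) x) +
            fun x => (deriv Φ (u n x) - deriv Φ (f x)) • g x := by
        funext x
        simp only [Pi.add_apply, Pi.sub_apply, smul_eq_mul]
        ring
      rw [e]
      refine (eLpNorm_add_le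
        ((hΦ'.comp_aestronglyMeasurable (hum n)).smul ((hmgm n).sub hg.1))
        (((hΦ'.comp_aestronglyMeasurable (hum n)).sub
            (hΦ'.comp_aestronglyMeasurable hfm)).smul hg.1) (by norm_num)).trans ?_
      gcongr
      · exact eLpNorm_smul_le_of_abs_le _ fun x => hK _
      · exact le_rfl
    exact hlim.comp (tendsto_add_atTop_nat N)
  have hstep : ∀ n, ∫ x, pd k φ x • Φ (u n x) =
      -∫ x, φ x • (deriv Φ (u n x) • mollify (bump n) g x) := by
    intro n
    have hc1 : ContDiff ℝ 1 (fun x => Φ (u n x)) := hΦ.comp ((hu n).of_le (by simp))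
    have h1 := (HasWeakPartial.of_contDiff (k := k) hc1).integral_eq φ hφ hc
    refine h1.trans ?_
    congr 2
    funext x
    congr 1
    have h2 : HasFDerivAt (u n) (fderiv ℝ (u n) x) x :=
      ((hu n).differentiable (by simp) x).hasFDerivAt
    have h3 := ((hΦ.differentiable (by simp) (u n x)).hasDerivAt).comp_hasFDerivAt x h2
    have h4 : HasFDerivAt (fun x => Φ (u n x)) _ x := h3
    rw [pd, h4.fderiv, ← fderiv_mollify _ h]
    rfl
  have hl2 := hleft.comp (tendsto_add_atTop_nat N)
  have : Tendsto (fun n => ∫ x, pd k φ x • Φ (u (n + N) x)) atTop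
      (𝓝 (-∫ x, φ x • (deriv Φ (f x) • g x))) := by
    simp only [hstep]
    exact hright.neg
  exact tendsto_nhds_unique hl2 this

section Limits

variable {F : Type*} [NormedAddCommGroup F]

theorem tendsto_eLpNorm_of_sub {u : ℕ → R3 → F} {f : R3 → F}
    (hu : ∀ n, AEStronglyMeasurable (u n) volume) (hf : MemLp f 2 volume)
    (h : Tendsto (fun n => eLpNorm (u n - f) 2 volume) atTop (𝓝 0)) :
    Tendsto (fun n => eLpNorm (u n) 2 volume) atTop (𝓝 (eLpNorm f 2 volume)) := by
  have h1 : Tendsto (fun n => eLpNorm f 2 volume - eLpNorm (u n - f) 2 volume) atTop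
      (𝓝 (eLpNorm f 2 volume)) := by
    simpa using ENNReal.Tendsto.sub (tendsto_const_nhds (x := eLpNorm f 2 volume)) h
      (Or.inl hf.2.ne)
  have h2 : Tendsto (fun n => eLpNorm f 2 volume + eLpNorm (u n - f) 2 volume) atTop
      (𝓝 (eLpNorm f 2 volume)) := by
    simpa using tendsto_const_nhds.add h
  refine tendsto_of_tendsto_of_tendsto_of_le_of_le h1 h2 (fun n => ?_) fun n => ?_
  · rw [tsub_le_iff_right]
    have := eLpNorm_sub_le (hu n) ((hu n).sub hf.1) (p := 2) (by norm_num)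
    simpa using this
  · have := eLpNorm_add_le hf.1 ((hu n).sub hf.1) (p := 2) (by norm_num)
    simpa using this

theorem tendsto_lintegral_sq_of_sub {u : ℕ → R3 → F} {f : R3 → F}
    (hu : ∀ n, AEStronglyMeasurable (u n) volume) (hf : MemLp f 2 volume)
    (h : Tendsto (fun n => eLpNorm (u n - f) 2 volume) atTop (𝓝 0)) :
    Tendsto (fun n => ∫⁻ x, ‖u n x‖ₑ ^ 2) atTop (𝓝 (∫⁻ x, ‖f x‖ₑ ^ 2)) := by
  simp only [← eLpNorm_two_sq]
  exact ENNReal.Tendsto.pow (tendsto_eLpNorm_of_sub hu hf h)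

theorem lintegral_le_of_tendsto_ae {φ : ℕ → R3 → ℝ≥0∞} {f : R3 → ℝ≥0∞} {B : ℕ → ℝ≥0∞} {b : ℝ≥0∞}
    (hm : ∀ n, AEMeasurable (φ n) volume)
    (hlim : ∀ᵐ x, Tendsto (fun n => φ n x) atTop (𝓝 (f x)))
    (hB : ∀ n, ∫⁻ x, φ n x ≤ B n) (hb : Tendsto B atTop (𝓝 b)) : ∫⁻ x, f x ≤ b := by
  calc ∫⁻ x, f x = ∫⁻ x, liminf (fun n => φ n x) atTop :=
        lintegral_congr_ae (hlim.mono fun x hx => hx.liminf_eq.symm)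
    _ ≤ liminf (fun n => ∫⁻ x, φ n x) atTop := lintegral_liminf_le' hm
    _ ≤ liminf B atTop := liminf_le_liminf (Eventually.of_forall hB)
    _ = b := hb.liminf_eq

theorem lintegral_pow_six_le_of_approx {u : ℕ → R3 → F} {f : R3 → F} {B : ℕ → ℝ≥0∞} {b : ℝ≥0∞}
    (hu : ∀ n, AEStronglyMeasurable (u n) volume) (hf : AEStronglyMeasurable f volume)
    (h : Tendsto (fun n => eLpNorm (u n - f) 2 volume) atTop (𝓝 0))
    (hB : ∀ n, ∫⁻ x, ‖u n x‖ₑ ^ 6 ≤ B n) (hb : Tendsto B atTop (𝓝 b)) :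
    ∫⁻ x, ‖f x‖ₑ ^ 6 ≤ b := by
  obtain ⟨ns, hns, hae⟩ :=
    (tendstoInMeasure_of_tendsto_eLpNorm (p := 2) (by norm_num) hu hf h).exists_seq_tendsto_ae
  refine lintegral_le_of_tendsto_ae (φ := fun n x => ‖u (ns n) x‖ₑ ^ 6)
    (fun n => (hu _).enorm.pow_const 6) ?_ (fun n => hB (ns n)) (hb.comp hns.tendsto_atTop)
  filter_upwards [hae] with x hx
  exact ENNReal.Tendsto.pow ((continuous_enorm.tendsto _).comp hx)

end Limits

section Sobolev

theorem norm_fderiv_le_sum_pd {u : R3 → ℝ} (x : R3) :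
    ‖fderiv ℝ u x‖ ≤ ∑ k, |pd k u x| := by
  refine ContinuousLinearMap.opNorm_le_bound _ (by positivity) fun v => ?_
  have hv : v = ∑ k, v k • EuclideanSpace.single k (1 : ℝ) := by
    ext i
    fin_cases i <;> simp [Fin.sum_univ_three]
  conv_lhs => rw [hv]
  rw [map_sum, Finset.sum_mul]
  refine (norm_sum_le _ _).trans (Finset.sum_le_sum fun k _ => ?_)
  rw [map_smul, norm_smul, mul_comm]
  gcongr
  · exact le_rfl
  · exact PiLp.norm_apply_le v k

theorem lintegral_pow_six_eq {F : Type*} [NormedAddCommGroup F] (u : R3 → F) :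
    eLpNorm u 6 volume ^ 6 = ∫⁻ x, ‖u x‖ₑ ^ 6 := by
  rw [eLpNorm_eq_lintegral_rpow_enorm_toReal (by simp) (by simp), ← ENNReal.rpow_natCast,
    ← ENNReal.rpow_mul]
  simp only [ENNReal.toReal_ofNat, ENNReal.rpow_ofNat]
  norm_num

/-- The Sobolev inequality for smooth compactly supported real functions, in terms of bounds for
the partial derivatives. -/
theorem exists_sobolev_const : ∃ C : ℝ≥0, ∀ (u : R3 → ℝ) (h : Fin 3 → R3 → ℝ),
    ContDiff ℝ 1 u → HasCompactSupport u → (∀ k, AEStronglyMeasurable (h k) volume) →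
    (∀ k x, |pd k u x| ≤ h k x) →
    ∫⁻ x, ‖u x‖ₑ ^ 6 ≤ C * (∑ k, ∫⁻ x, ‖h k x‖ₑ ^ 2) ^ 3 := by
  refine ⟨(eLpNormLESNormFDerivOfEqInnerConst (volume : Measure R3) (2 : ℝ≥0)) ^ 6 * 27,
    fun u h hu hc hm hh => ?_⟩
  have h1 := eLpNorm_le_eLpNorm_fderiv_of_eq_inner (volume : Measure R3) hu hc (p := 2) (p' := 6)
    (by norm_num) (by simp) (by simp; norm_num)
  simp only [ENNReal.coe_ofNat] at h1
  have h2 : ∫⁻ x, ‖fderiv ℝ u x‖ₑ ^ 2 ≤ 3 * ∑ k, ∫⁻ x, ‖h k x‖ₑ ^ 2 := by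
    rw [← lintegral_finsetSum' _ fun k _ => (hm k).enorm.pow_const 2,
      ← lintegral_const_mul' _ _ (by simp)]
    refine lintegral_mono fun x => ?_
    have h0 : ∀ k, 0 ≤ h k x := fun k => (abs_nonneg _).trans (hh k x)
    have h3 : ‖fderiv ℝ u x‖ ≤ ∑ k, h k x :=
      (norm_fderiv_le_sum_pd x).trans (Finset.sum_le_sum fun k _ => hh k x)
    have h4 : ‖fderiv ℝ u x‖ ^ 2 ≤ 3 * ∑ k, ‖h k x‖ ^ 2 := by
      refine (pow_le_pow_left₀ (norm_nonneg _) h3 2).trans ?_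
      simp only [Fin.sum_univ_three, Real.norm_eq_abs, sq_abs]
      nlinarith [sq_nonneg (h 0 x - h 1 x), sq_nonneg (h 0 x - h 2 x), sq_nonneg (h 1 x - h 2 x)]
    have h5 := ENNReal.ofReal_le_ofReal h4
    rw [ENNReal.ofReal_mul (by norm_num), ENNReal.ofReal_sum_of_nonneg (fun _ _ => by positivity),
      ENNReal.ofReal_pow (norm_nonneg _), ofReal_norm] at h5
    simpa only [ENNReal.ofReal_pow (norm_nonneg _), ofReal_norm, ENNReal.ofReal_ofNat] using h5
  rw [← lintegral_pow_six_eq]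
  calc eLpNorm u 6 volume ^ 6
      ≤ (eLpNormLESNormFDerivOfEqInnerConst (volume : Measure R3) (2 : ℝ≥0) *
          eLpNorm (fderiv ℝ u) 2 volume) ^ 6 := by gcongr
    _ = (eLpNormLESNormFDerivOfEqInnerConst (volume : Measure R3) (2 : ℝ≥0) : ℝ≥0∞) ^ 6 *
          (∫⁻ x, ‖fderiv ℝ u x‖ₑ ^ 2) ^ 3 := by
        rw [← eLpNorm_two_sq, ← pow_mul, mul_pow]
    _ ≤ (eLpNormLESNormFDerivOfEqInnerConst (volume : Measure R3) (2 : ℝ≥0) : ℝ≥0∞) ^ 6 *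
          (3 * ∑ k, ∫⁻ x, ‖h k x‖ₑ ^ 2) ^ 3 := by gcongr
    _ = _ := by
        rw [mul_pow]
        push_cast
        ring

/-- Sobolev inequality for `√n`, where `n ≥ 0` is smooth with `|∂ₖ n| ≤ 2 √n hₖ`. -/
theorem exists_sobolev_sqrt_const : ∃ C : ℝ≥0, ∀ (n : R3 → ℝ) (h : Fin 3 → R3 → ℝ),
    ContDiff ℝ 1 n → HasCompactSupport n → (∀ x, 0 ≤ n x) →
    (∀ k, AEStronglyMeasurable (h k) volume) → (∀ k x, 0 ≤ h k x) →
    (∀ k x, |pd k n x| ≤ 2 * √(n x) * h k x) →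
    ∫⁻ x, ‖√(n x)‖ₑ ^ 6 ≤ C * (∑ k, ∫⁻ x, ‖h k x‖ₑ ^ 2) ^ 3 := by
  obtain ⟨C, hC⟩ := exists_sobolev_const
  refine ⟨C, fun n h hn hc hpos hm h0 hh => ?_⟩
  let ε : ℕ → ℝ := fun m => 1 / ((m : ℝ) + 1)
  have hε : ∀ m, 0 < ε m := fun m => by positivity
  have hεlim : Tendsto ε atTop (𝓝 0) := tendsto_one_div_add_atTop_nhds_zero_nat
  let u : ℕ → R3 → ℝ := fun m x => √(n x + ε m ^ 2) - ε m
  have hp : ∀ m x, 0 < n x + ε m ^ 2 := fun m x => by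
    have := hpos x
    have := hε m
    positivity
  have hu : ∀ m, ContDiff ℝ 1 (u m) := fun m =>
    ((hn.add contDiff_const).sqrt fun x => (hp m x).ne').sub contDiff_const
  have huc : ∀ m, HasCompactSupport (u m) := fun m => by
    refine hc.mono fun x hx => ?_
    contrapose! hx
    have : n x = 0 := by simpa using hx
    simp [u, this, Real.sqrt_sq (hε m).le]
  have hder : ∀ m k x, |pd k (u m) x| ≤ h k x := fun m k x => by
    have h1 : HasFDerivAt n (fderiv ℝ n x) x := (hn.differentiable (by simp) x).hasFDerivAt
    have h2 : HasFDerivAt (u m) _ x := ((h1.add_const (ε m ^ 2)).sqrt (hp m x).ne').sub_const (ε m)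
    have h3 : pd k (u m) x = 1 / (2 * √(n x + ε m ^ 2)) * pd k n x := by
      rw [pd, h2.fderiv]
      simp [pd]
    have hs : 0 < √(n x + ε m ^ 2) := Real.sqrt_pos.2 (hp m x)
    rw [h3, abs_mul, abs_of_pos (by positivity), one_div, inv_mul_le_iff₀ (by positivity)]
    refine (hh k x).trans ?_
    have : √(n x) ≤ √(n x + ε m ^ 2) := Real.sqrt_le_sqrt (by nlinarith [hε m])
    have := h0 k x
    gcongr
  refine lintegral_le_of_tendsto_ae (φ := fun m x => ‖u m x‖ₑ ^ 6)
    (fun m => (hu m).continuous.aestronglyMeasurable.enorm.pow_const 6) (ae_of_all _ fun x => ?_)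
    (fun m => hC (u m) h (hu m) (huc m) hm (hder m)) tendsto_const_nhds
  have h1 : Tendsto (fun m => u m x) atTop (𝓝 (√(n x))) := by
    have h2 : Tendsto (fun m => n x + ε m ^ 2) atTop (𝓝 (n x)) := by
      simpa using tendsto_const_nhds.add (hεlim.pow 2)
    simpa using ((Real.continuous_sqrt.tendsto _).comp h2).sub hεlim
  exact ENNReal.Tendsto.pow ((continuous_enorm.tendsto _).comp h1)

/-- The diamagnetic Sobolev inequality for test functions. -/
theorem exists_diamagnetic_const : ∃ C : ℝ≥0, ∀ (ħ : ℝ), 0 < ħ → ∀ (a : Fin 3 → R3 → ℝ)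
    (ψ : R3 → C2), (∀ k, AEStronglyMeasurable (a k) volume) → ContDiff ℝ 1 ψ →
    HasCompactSupport ψ →
    ∫⁻ x, ‖ψ x‖ₑ ^ 6 ≤ C * (∑ k, ∫⁻ x,
      ‖ħ⁻¹ • ((Complex.I * (ħ : ℂ)) • pd k ψ x + (a k x : ℂ) • ψ x)‖ₑ ^ 2) ^ 3 := by
  obtain ⟨C, hC⟩ := exists_sobolev_sqrt_const
  refine ⟨C, fun ħ hħ a ψ ha hψ hc => ?_⟩
  have hD : ∀ k, AEStronglyMeasurable (fun x =>
      ħ⁻¹ • ((Complex.I * (ħ : ℂ)) • pd k ψ x + (a k x : ℂ) • ψ x)) volume := fun k =>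
    (((continuous_pd hψ).aestronglyMeasurable.const_smul (Complex.I * (ħ : ℂ))).add
      ((Complex.continuous_ofReal.comp_aestronglyMeasurable (ha k)).smul
        hψ.continuous.aestronglyMeasurable)).const_smul ħ⁻¹
  have := hC (fun x => ‖ψ x‖ ^ 2) (fun k x => ‖ħ⁻¹ • ((Complex.I * (ħ : ℂ)) • pd k ψ x +
    (a k x : ℂ) • ψ x)‖) (hψ.norm_sq ℂ) ?_ (fun x => by positivity) (fun k => (hD k).norm)
    (fun k x => norm_nonneg _) ?_
  · simpa only [Real.sqrt_sq (norm_nonneg _), enorm_norm] using this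
  · refine hc.mono fun x hx => ?_
    contrapose! hx
    have : ψ x = 0 := by simpa using hx
    simp [this]
  · intro k x
    rw [Real.sqrt_sq (norm_nonneg _)]
    have hd : DifferentiableAt ℝ ψ x := hψ.differentiable (by simp) x
    have h1 : pd k (fun x => ‖ψ x‖ ^ 2) x = 2 * (inner ℂ (ψ x) (pd k ψ x)).re := by
      have h2 : ∀ y, ‖ψ y‖ ^ 2 = Complex.reCLM (inner ℂ (ψ y) (ψ y)) := fun y => by
        rw [Complex.reCLM_apply, ← RCLike.re_eq_complex_re, inner_self_eq_norm_sq]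
      simp only [h2, pd]
      have h3 : HasFDerivAt (fun y => inner ℂ (ψ y) (ψ y)) _ x :=
        hd.hasFDerivAt.inner ℂ hd.hasFDerivAt
      have h4 : HasFDerivAt (fun y => Complex.reCLM (inner ℂ (ψ y) (ψ y))) _ x :=
        Complex.reCLM.hasFDerivAt.comp x h3
      rw [h4.fderiv]
      simp only [ContinuousLinearMap.comp_apply, ContinuousLinearMap.prod_apply,
        fderivInnerCLM_apply, Complex.reCLM_apply, Complex.add_re]
      rw [← inner_conj_symm (fderiv ℝ ψ x (EuclideanSpace.single k 1)) (ψ x), Complex.conj_re]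
      ring
    set D := ħ⁻¹ • ((Complex.I * (ħ : ℂ)) • pd k ψ x + (a k x : ℂ) • ψ x) with hDdef
    have h5 : pd k ψ x = (-Complex.I) • D + (Complex.I * (ħ⁻¹ * a k x : ℝ)) • ψ x := by
      have hne : (ħ : ℂ) ≠ 0 := by exact_mod_cast hħ.ne'
      ext i
      simp only [hDdef, PiLp.add_apply, PiLp.smul_apply, smul_eq_mul, Complex.real_smul]
      push_cast
      field_simp
      linear_combination (pd k ψ x).ofLp i * ħ * Complex.I_sq
    have h6 : (inner ℂ (ψ x) (pd k ψ x)).re = (inner ℂ (ψ x) ((-Complex.I) • D)).re := by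
      conv_lhs => rw [h5]
      rw [inner_add_right, Complex.add_re, inner_smul_right _ _ (Complex.I * _),
        inner_self_eq_norm_sq_to_K]
      simp [← Complex.ofReal_pow]
    rw [h1, abs_mul, h6, abs_two, mul_assoc]
    gcongr
    refine (Complex.abs_re_le_norm _).trans ((norm_inner_le_norm _ _).trans_eq ?_)
    simp [norm_smul]

/-- The Sobolev inequality on `H¹(ℝ³; ℂ²)`. -/
theorem exists_sobolev_H1_const : ∃ C : ℝ≥0, ∀ (ψ : R3 → C2) (g : Fin 3 → R3 → C2),
    MemLp ψ 2 volume → (∀ k, HasWeakPartial k ψ (g k)) → (∀ k, MemLp (g k) 2 volume) →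
    ∫⁻ x, ‖ψ x‖ₑ ^ 6 ≤ C * (∑ k, ∫⁻ x, ‖g k x‖ₑ ^ 2) ^ 3 := by
  obtain ⟨C, hC⟩ := exists_diamagnetic_const
  refine ⟨C, fun ψ g hψ hg hgL => ?_⟩
  obtain ⟨u, hu, huc, hlim, hlimd⟩ := exists_smooth_approx hψ hg hgL
  have hu1 : ∀ n, ContDiff ℝ 1 (u n) := fun n => (hu n).of_le (by simp)
  refine lintegral_pow_six_le_of_approx (fun n => (hu n).continuous.aestronglyMeasurable) hψ.1 hlim
    (B := fun n => C * (∑ k, ∫⁻ x, ‖pd k (u n) x‖ₑ ^ 2) ^ 3) (fun n => ?_) ?_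
  · have := hC 1 one_pos (fun _ _ => 0) (u n) (fun _ => aestronglyMeasurable_const) (hu1 n) (huc n)
    have hI : ‖Complex.I‖ₑ = 1 := by simp [← ofReal_norm]
    simpa [enorm_smul, hI] using this
  · refine ENNReal.Tendsto.const_mul (ENNReal.Tendsto.pow (tendsto_finsetSum _ fun k _ => ?_))
      (Or.inr ENNReal.coe_ne_top)
    exact tendsto_lintegral_sq_of_sub (fun n => (continuous_pd (hu1 n)).aestronglyMeasurable)
      (hgL k) (hlimd k)

/-- A smooth cutoff on the real line. -/
def lineBump : ContDiffBump (0 : ℝ) where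
  rIn := 1
  rOut := 2
  rIn_pos := one_pos
  rIn_lt_rOut := one_lt_two

/-- Smooth bounded truncations of the identity that vanish near `0`. -/
def truncation (n : ℕ) (s : ℝ) : ℝ :=
  s * ((1 - lineBump ((n + 1) * s)) * lineBump ((n + 1 : ℝ)⁻¹ * s))

theorem contDiff_truncation (n : ℕ) : ContDiff ℝ 1 (truncation n) := by
  have h : ContDiff ℝ 1 lineBump := lineBump.contDiff
  unfold truncation
  exact contDiff_id.mul ((contDiff_const.sub (h.comp (contDiff_const.mul contDiff_id))).mul
    (h.comp (contDiff_const.mul contDiff_id)))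

theorem truncation_eq_zero {n : ℕ} {s : ℝ} (hs : (n + 1) * |s| ≤ 1) : truncation n s = 0 := by
  have : lineBump ((n + 1 : ℝ) * s) = 1 := by
    refine lineBump.one_of_mem_closedBall ?_
    rw [mem_closedBall_zero_iff, norm_mul, Real.norm_of_nonneg (by positivity)]
    exact hs
  simp [truncation, this]

theorem exists_abs_truncation_le (n : ℕ) : ∃ M : ℝ≥0, ∀ s, |truncation n s| ≤ M := by
  have hc : HasCompactSupport (truncation n) := by
    have h1 : HasCompactSupport fun s : ℝ => lineBump ((n + 1 : ℝ)⁻¹ • s) :=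
      lineBump.hasCompactSupport.comp_smul (by positivity)
    refine h1.mono fun s hs => ?_
    contrapose! hs
    have : lineBump ((n + 1 : ℝ)⁻¹ * s) = 0 := by simpa using hs
    simp [truncation, this]
  obtain ⟨M, hM⟩ := (contDiff_truncation n).continuous.bounded_above_of_compact_support hc
  exact ⟨M.toNNReal, fun s => (hM s).trans (Real.le_coe_toNNReal M)⟩

theorem exists_abs_deriv_truncation_le : ∃ K : ℝ≥0, ∀ n s, |deriv (truncation n) s| ≤ K := by
  have hβ : ContDiff ℝ 1 lineBump := lineBump.contDiff
  have hβ' : Continuous (deriv lineBump) := hβ.continuous_deriv (by simp)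
  obtain ⟨B, hB⟩ : ∃ B : ℝ, ∀ t, ‖t * deriv lineBump t‖ ≤ B :=
    (continuous_id.mul hβ').bounded_above_of_compact_support
      lineBump.hasCompactSupport.deriv.mul_left
  refine ⟨(1 + B + B).toNNReal, fun n s => le_trans ?_ (Real.le_coe_toNNReal _)⟩
  have hd : ∀ t, HasDerivAt lineBump (deriv lineBump t) t := fun t =>
    (hβ.differentiable (by simp) t).hasDerivAt
  set N : ℝ := n + 1
  have hN : 0 < N := by positivity
  have h1 : HasDerivAt (fun s => lineBump (N * s)) (deriv lineBump (N * s) * (N * 1)) s :=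
    (hd (N * s)).comp s ((hasDerivAt_id s).const_mul N)
  have h2 : HasDerivAt (fun s => lineBump (N⁻¹ * s)) (deriv lineBump (N⁻¹ * s) * (N⁻¹ * 1)) s :=
    (hd (N⁻¹ * s)).comp s ((hasDerivAt_id s).const_mul N⁻¹)
  have h3 : HasDerivAt (truncation n) _ s := (hasDerivAt_id s).mul ((h1.const_sub 1).mul h2)
  have e : deriv (truncation n) s = (1 - lineBump (N * s)) * lineBump (N⁻¹ * s)
      - (N * s * deriv lineBump (N * s)) * lineBump (N⁻¹ * s)
      + (1 - lineBump (N * s)) * (N⁻¹ * s * deriv lineBump (N⁻¹ * s)) := by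
    rw [h3.deriv]
    simp only [id]
    ring
  have hb : ∀ t, 0 ≤ lineBump t ∧ lineBump t ≤ 1 := fun t => ⟨lineBump.nonneg, lineBump.le_one⟩
  have b1 : |(1 - lineBump (N * s)) * lineBump (N⁻¹ * s)| ≤ 1 := by
    rw [abs_of_nonneg (mul_nonneg (by linarith [(hb (N * s)).2]) (hb _).1)]
    exact mul_le_one₀ (by linarith [(hb (N * s)).1]) (hb _).1 (hb _).2
  have hB0 : 0 ≤ B := (norm_nonneg _).trans (hB 0)
  have b2 : |(N * s * deriv lineBump (N * s)) * lineBump (N⁻¹ * s)| ≤ B := by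
    rw [abs_mul, abs_of_nonneg (hb _).1]
    exact (mul_le_mul (hB _) (hb _).2 (hb _).1 hB0).trans_eq (mul_one B)
  have b3 : |(1 - lineBump (N * s)) * (N⁻¹ * s * deriv lineBump (N⁻¹ * s))| ≤ B := by
    rw [abs_mul, abs_of_nonneg (by linarith [(hb (N * s)).2])]
    exact (mul_le_mul (by linarith [(hb (N * s)).1]) (hB _) (abs_nonneg _) zero_le_one).trans_eq
      (one_mul B)
  rw [e]
  exact (abs_add_le _ _).trans (add_le_add ((abs_sub _ _).trans (add_le_add b1 b2)) b3)

theorem tendsto_truncation (s : ℝ) : Tendsto (fun n => truncation n s) atTop (𝓝 s) := by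
  by_cases hs : s = 0
  · simp [hs, truncation]
  refine tendsto_const_nhds.congr' ?_
  have hs' : 0 < |s| := abs_pos.2 hs
  filter_upwards [eventually_ge_atTop ⌈|s|⌉₊, eventually_ge_atTop ⌈2 / |s|⌉₊] with n h1 h2
  have h1' : |s| ≤ n := Nat.ceil_le.1 h1
  have h2' : 2 / |s| ≤ n := Nat.ceil_le.1 h2
  have e1 : lineBump ((n + 1 : ℝ) * s) = 0 := by
    refine lineBump.zero_of_le_dist ?_
    rw [dist_zero_right, norm_mul, Real.norm_of_nonneg (by positivity)]
    change (2 : ℝ) ≤ _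
    rw [div_le_iff₀ hs'] at h2'
    rw [Real.norm_eq_abs]
    nlinarith
  have e2 : lineBump ((n + 1 : ℝ)⁻¹ * s) = 1 := by
    refine lineBump.one_of_mem_closedBall ?_
    rw [mem_closedBall_zero_iff, norm_mul, norm_inv, Real.norm_of_nonneg (by positivity)]
    change _ ≤ (1 : ℝ)
    rw [inv_mul_le_iff₀ (by positivity), Real.norm_eq_abs]
    linarith
  simp [truncation, e1, e2]

/-- The Sobolev inequality for real functions vanishing at infinity with gradient in `L²`. -/
theorem exists_sobolev_D1_const : ∃ C : ℝ≥0, ∀ (f : R3 → ℝ) (g : Fin 3 → R3 → ℝ),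
    (∀ k, HasWeakPartial k f (g k)) → (∀ k, MemLp (g k) 2 volume) →
    (∀ t : ℝ, 0 < t → volume {x | t < ‖f x‖} < ⊤) →
    ∫⁻ x, ‖f x‖ₑ ^ 6 ≤ C * (∑ k, ∫⁻ x, ‖g k x‖ₑ ^ 2) ^ 3 := by
  obtain ⟨C, hC⟩ := exists_sobolev_H1_const
  obtain ⟨K, hK⟩ := exists_abs_deriv_truncation_le
  refine ⟨C * K ^ 6, fun f g hg hgL hv => ?_⟩
  have hfm : AEStronglyMeasurable f volume := (hg 0).locallyIntegrable.aestronglyMeasurable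
  let L : ℝ →L[ℝ] C2 := ContinuousLinearMap.toSpanSingleton ℝ (EuclideanSpace.single 0 (1 : ℂ))
  have hL : ∀ s, ‖L s‖ₑ = ‖s‖ₑ := fun s => by
    have : ‖L s‖ = ‖s‖ := by simp [L, norm_smul]
    rw [← ofReal_norm, this, ofReal_norm]
  have hwm : ∀ n, AEStronglyMeasurable (fun x => truncation n (f x)) volume := fun n =>
    (contDiff_truncation n).continuous.comp_aestronglyMeasurable hfm
  have hw : ∀ n, MemLp (fun x => truncation n (f x)) 2 volume := fun n => by
    obtain ⟨M, hM⟩ := exists_abs_truncation_le n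
    refine ⟨hwm n, ?_⟩
    have hfin : volume {x | (2 * (n + 1 : ℝ))⁻¹ < ‖f x‖} < ⊤ := hv _ (by positivity)
    set S := toMeasurable volume {x | (2 * (n + 1 : ℝ))⁻¹ < ‖f x‖} with hS
    have h1 : ∫⁻ x, ‖truncation n (f x)‖ₑ ^ 2 ≤ ∫⁻ x, S.indicator (fun _ => (M : ℝ≥0∞) ^ 2) x := by
      refine lintegral_mono fun x => ?_
      by_cases hx : x ∈ S
      · rw [Set.indicator_of_mem hx]
        gcongr
        rw [← ofReal_norm, ← ENNReal.ofReal_coe_nnreal]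
        exact ENNReal.ofReal_le_ofReal (hM _)
      · have hx' : ‖f x‖ ≤ (2 * (n + 1 : ℝ))⁻¹ := by
          by_contra h
          exact hx (subset_toMeasurable _ _ (not_le.1 h))
        have h0 : truncation n (f x) = 0 := truncation_eq_zero <| by
          rw [← Real.norm_eq_abs]
          calc (n + 1 : ℝ) * ‖f x‖ ≤ (n + 1) * (2 * (n + 1 : ℝ))⁻¹ := by gcongr
            _ = 1 / 2 := by field_simp
            _ ≤ 1 := by norm_num
        simp [h0]
    rw [lintegral_indicator (measurableSet_toMeasurable _ _), setLIntegral_const,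
      measure_toMeasurable, ← eLpNorm_two_sq] at h1
    by_contra htop
    rw [not_lt_top_iff] at htop
    have h2 := h1.trans_lt (ENNReal.mul_lt_top (by simp) hfin)
    exact absurd (htop ▸ h2) (by simp)
  refine lintegral_le_of_tendsto_ae (φ := fun n x => ‖truncation n (f x)‖ₑ ^ 6)
    (B := fun _ => (C * K ^ 6 : ℝ≥0) * (∑ k, ∫⁻ x, ‖g k x‖ₑ ^ 2) ^ 3)
    (fun n => (hwm n).enorm.pow_const 6) (ae_of_all _ fun x => ?_) (fun n => ?_)
    tendsto_const_nhds
  · exact ENNReal.Tendsto.pow ((continuous_enorm.tendsto _).comp (tendsto_truncation (f x)))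
  obtain ⟨M, hM⟩ := exists_abs_truncation_le n
  have hb : ∀ k, eLpNorm (fun x => deriv (truncation n) (f x) • g k x) 2 volume ≤
      K * eLpNorm (g k) 2 volume := fun k => eLpNorm_smul_le_of_abs_le (g k) fun x => hK n _
  have hd : ∀ k, MemLp (fun x => deriv (truncation n) (f x) • g k x) 2 volume := fun k =>
    ⟨(((contDiff_truncation n).continuous_deriv (by simp)).comp_aestronglyMeasurable hfm).smul
      (hgL k).1, (hb k).trans_lt (ENNReal.mul_lt_top ENNReal.coe_lt_top (hgL k).2)⟩
  have h1 := hC (fun x => L (truncation n (f x)))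
    (fun k x => L (deriv (truncation n) (f x) • g k x)) (L.comp_memLp' (hw n))
    (fun k => ((hg k).comp_contDiff (hgL k) (contDiff_truncation n) hM (hK n)).clm_comp L)
    fun k => L.comp_memLp' (hd k)
  simp only [hL] at h1
  refine h1.trans ?_
  calc (C : ℝ≥0∞) * (∑ k, ∫⁻ x, ‖deriv (truncation n) (f x) • g k x‖ₑ ^ 2) ^ 3
      ≤ C * (∑ k, K ^ 2 * ∫⁻ x, ‖g k x‖ₑ ^ 2) ^ 3 := by
        gcongr with k
        rw [← eLpNorm_two_sq, ← eLpNorm_two_sq, ← mul_pow]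
        gcongr
        exact hb k
    _ = _ := by
        rw [← Finset.mul_sum, mul_pow]
        push_cast
        ring

end Sobolev

section Hoelder

theorem lintegral_mul_three_le {f u w : R3 → ℝ≥0∞} (hf : AEMeasurable f volume)
    (hu : AEMeasurable u volume) (hw : AEMeasurable w volume) {p q r : ℝ} (hp : 0 ≤ p) (hq : 0 ≤ q)
    (hr : 0 ≤ r) (h : p + q + r = 1) :
    ∫⁻ x, f x ^ p * u x ^ q * w x ^ r ≤
      (∫⁻ x, f x) ^ p * (∫⁻ x, u x) ^ q * (∫⁻ x, w x) ^ r := by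
  have := ENNReal.lintegral_prod_norm_pow_le (μ := (volume : Measure R3)) Finset.univ
    (f := ![f, u, w]) (p := ![p, q, r]) (fun i _ => by fin_cases i <;> assumption)
    (by simpa [Fin.sum_univ_three] using h) (fun i _ => by fin_cases i <;> assumption)
  simpa [Fin.prod_univ_three] using this

variable {F G : Type*} [NormedAddCommGroup F] [NormedAddCommGroup G] {f : R3 → G} {u : R3 → F}

theorem rpow_pow_mul {n : ℕ} {p : ℝ} (z : ℝ≥0∞) (s : ℝ) (h : n * p = s) :
    (z ^ n) ^ p = z ^ s := by
  rw [← ENNReal.rpow_natCast, ← ENNReal.rpow_mul, h]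

theorem lintegral_sq_mul_sq_le (hf : AEStronglyMeasurable f volume)
    (hu : AEStronglyMeasurable u volume) :
    ∫⁻ x, ‖f x‖ₑ ^ 2 * ‖u x‖ₑ ^ 2 ≤ (∫⁻ x, ‖f x‖ₑ ^ 6) ^ (1 / 3 : ℝ) *
      (∫⁻ x, ‖u x‖ₑ ^ 6) ^ (1 / 6 : ℝ) * (∫⁻ x, ‖u x‖ₑ ^ 2) ^ (1 / 2 : ℝ) := by
  refine le_trans (le_of_eq (lintegral_congr fun x => ?_)) (lintegral_mul_three_le
    (hf.enorm.pow_const 6) (hu.enorm.pow_const 6) (hu.enorm.pow_const 2) (by norm_num)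
    (by norm_num) (by norm_num) (by norm_num))
  rw [rpow_pow_mul _ 2 (by norm_num), rpow_pow_mul _ 1 (by norm_num),
    rpow_pow_mul _ 1 (by norm_num), mul_assoc, ← ENNReal.rpow_add_of_nonneg _ _ (by norm_num)
    (by norm_num)]
  norm_num

theorem lintegral_mul_sq_le_six (hf : AEStronglyMeasurable f volume)
    (hu : AEStronglyMeasurable u volume) :
    ∫⁻ x, ‖f x‖ₑ * ‖u x‖ₑ ^ 2 ≤ (∫⁻ x, ‖f x‖ₑ ^ 6) ^ (1 / 6 : ℝ) *
      (∫⁻ x, ‖u x‖ₑ ^ 6) ^ (1 / 12 : ℝ) * (∫⁻ x, ‖u x‖ₑ ^ 2) ^ (3 / 4 : ℝ) := by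
  refine le_trans (le_of_eq (lintegral_congr fun x => ?_)) (lintegral_mul_three_le
    (hf.enorm.pow_const 6) (hu.enorm.pow_const 6) (hu.enorm.pow_const 2) (by norm_num)
    (by norm_num) (by norm_num) (by norm_num))
  rw [rpow_pow_mul _ 1 (by norm_num), rpow_pow_mul _ (1 / 2) (by norm_num),
    rpow_pow_mul _ (3 / 2) (by norm_num), mul_assoc,
    ← ENNReal.rpow_add_of_nonneg _ _ (by norm_num) (by norm_num)]
  norm_num

theorem lintegral_mul_sq_le_two (hf : AEStronglyMeasurable f volume)
    (hu : AEStronglyMeasurable u volume) :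
    ∫⁻ x, ‖f x‖ₑ * ‖u x‖ₑ ^ 2 ≤ (∫⁻ x, ‖f x‖ₑ ^ 2) ^ (1 / 2 : ℝ) *
      (∫⁻ x, ‖u x‖ₑ ^ 6) ^ (1 / 4 : ℝ) * (∫⁻ x, ‖u x‖ₑ ^ 2) ^ (1 / 4 : ℝ) := by
  refine le_trans (le_of_eq (lintegral_congr fun x => ?_)) (lintegral_mul_three_le
    (hf.enorm.pow_const 2) (hu.enorm.pow_const 6) (hu.enorm.pow_const 2) (by norm_num)
    (by norm_num) (by norm_num) (by norm_num))
  rw [rpow_pow_mul _ 1 (by norm_num), rpow_pow_mul _ (3 / 2) (by norm_num),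
    rpow_pow_mul _ (1 / 2) (by norm_num), mul_assoc,
    ← ENNReal.rpow_add_of_nonneg _ _ (by norm_num) (by norm_num)]
  norm_num

theorem integral_norm_mul_sq (hf : AEStronglyMeasurable f volume)
    (hu : AEStronglyMeasurable u volume) :
    ∫ x, ‖f x‖ * ‖u x‖ ^ 2 = (∫⁻ x, ‖f x‖ₑ * ‖u x‖ₑ ^ 2).toReal := by
  rw [integral_eq_lintegral_of_nonneg_ae (f := fun x => ‖f x‖ * ‖u x‖ ^ 2)
    (ae_of_all _ fun x => by positivity) (hf.norm.mul (hu.norm.pow 2))]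
  congr 1
  refine lintegral_congr fun x => ?_
  rw [ENNReal.ofReal_mul (norm_nonneg _), ENNReal.ofReal_pow (norm_nonneg _), ofReal_norm,
    ofReal_norm]

theorem normSqL2_eq [NormedSpace ℝ F] (hu : AEStronglyMeasurable u volume) :
    normSqL2 u = (∫⁻ x, ‖u x‖ₑ ^ 2).toReal := by
  rw [normSqL2, integral_eq_lintegral_of_nonneg_ae (f := fun x => ‖u x‖ ^ 2)
    (ae_of_all _ fun x => by positivity) (hu.norm.pow 2)]
  congr 1
  refine lintegral_congr fun x => ?_
  rw [ENNReal.ofReal_pow (norm_nonneg _), ofReal_norm]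

theorem normSqL2_nonneg [NormedSpace ℝ F] (u : R3 → F) : 0 ≤ normSqL2 u :=
  integral_nonneg fun _ => by positivity

theorem lintegral_sq_ne_top (hu : MemLp u 2 volume) : ∫⁻ x, ‖u x‖ₑ ^ 2 ≠ ⊤ := by
  rw [← eLpNorm_two_sq]
  exact ENNReal.pow_ne_top hu.2.ne

theorem ofReal_normSqL2 [NormedSpace ℝ F] (hu : MemLp u 2 volume) :
    ENNReal.ofReal (normSqL2 u) = ∫⁻ x, ‖u x‖ₑ ^ 2 := by
  rw [normSqL2_eq hu.1, ENNReal.ofReal_toReal (lintegral_sq_ne_top hu)]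

theorem integrable_norm_sq (hu : MemLp u 2 volume) : Integrable (fun x => ‖u x‖ ^ 2) volume :=
  (memLp_two_iff_integrable_sq_norm hu.1).1 hu

theorem memLp_two_of_lintegral (hu : AEStronglyMeasurable u volume)
    (h : ∫⁻ x, ‖u x‖ₑ ^ 2 ≠ ⊤) : MemLp u 2 volume := by
  refine ⟨hu, lt_top_iff_ne_top.2 fun h' => h ?_⟩
  rw [← eLpNorm_two_sq, h']
  simp

theorem tendsto_normSqL2 [NormedSpace ℝ F] {w : ℕ → R3 → F}
    (hw : ∀ n, AEStronglyMeasurable (w n) volume) (hu : MemLp u 2 volume)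
    (h : Tendsto (fun n => eLpNorm (w n - u) 2 volume) atTop (𝓝 0)) :
    Tendsto (fun n => normSqL2 (w n)) atTop (𝓝 (normSqL2 u)) := by
  rw [normSqL2_eq hu.1]
  simp only [normSqL2_eq (hw _)]
  exact (ENNReal.tendsto_toReal (lintegral_sq_ne_top hu)).comp (tendsto_lintegral_sq_of_sub hw hu h)

end Hoelder

section Covariant

/-- The covariant derivative `iħ gₖ + aₖ ψ` with a prescribed gradient `g` and real potential
`a`. -/
def cov (ħ : ℝ) (a : Fin 3 → R3 → ℝ) (g : Fin 3 → R3 → C2) (ψ : R3 → C2) (k : Fin 3) (x : R3) :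
    C2 :=
  (Complex.I * (ħ : ℂ)) • g k x + (a k x : ℂ) • ψ x

/-- `σ · D` for a triple `D` of spinors. -/
def pauliSum (D : Fin 3 → C2) : C2 := ∑ k, Matrix.toEuclideanLin (pauli k) (D k)

/-- The kinetic energy with prescribed gradient and potential. -/
def kin (ħ : ℝ) (j : Model) (a : Fin 3 → R3 → ℝ) (g : Fin 3 → R3 → C2) (ψ : R3 → C2) : ℝ :=
  match j with
  | .S => ∑ k, normSqL2 (cov ħ a g ψ k)
  | .P => normSqL2 fun x => pauliSum fun k => cov ħ a g ψ k x

theorem kineticNormSq_eq_kin (ħ c Q : ℝ) (j : Model) (A : R3 → R3) (ψ : R3 → C2) :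
    kineticNormSq ħ c Q j A ψ =
      kin ħ j (fun k x => Q / c * A x k) (fun k => weakPartial k ψ) ψ := by
  cases j <;> rfl

theorem kin_nonneg (ħ : ℝ) (j : Model) (a : Fin 3 → R3 → ℝ) (g : Fin 3 → R3 → C2) (ψ : R3 → C2) :
    0 ≤ kin ħ j a g ψ := by
  cases j
  · exact Finset.sum_nonneg fun k _ => normSqL2_nonneg _
  · exact normSqL2_nonneg _

theorem pauliSum_apply_zero (D : Fin 3 → C2) :
    pauliSum D 0 = D 0 1 - Complex.I * D 1 1 + D 2 0 := by
  simp [pauliSum, pauli, Fin.sum_univ_three, Matrix.toEuclideanLin, Matrix.toLpLin_apply]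
  ring

theorem pauliSum_apply_one (D : Fin 3 → C2) :
    pauliSum D 1 = D 0 0 + Complex.I * D 1 0 - D 2 1 := by
  simp [pauliSum, pauli, Fin.sum_univ_three, Matrix.toEuclideanLin, Matrix.toLpLin_apply]
  ring

theorem norm_sq_C2 (z : C2) :
    ‖z‖ ^ 2 = (z 0).re ^ 2 + (z 0).im ^ 2 + ((z 1).re ^ 2 + (z 1).im ^ 2) := by
  rw [EuclideanSpace.norm_sq_eq, Fin.sum_univ_two, ← Complex.normSq_eq_norm_sq,
    ← Complex.normSq_eq_norm_sq, Complex.normSq_apply, Complex.normSq_apply]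
  ring

theorem norm_pauliSum_sq_le (D : Fin 3 → C2) : ‖pauliSum D‖ ^ 2 ≤ 3 * ∑ k, ‖D k‖ ^ 2 := by
  simp only [norm_sq_C2, Fin.sum_univ_three, pauliSum_apply_zero, pauliSum_apply_one,
    Complex.add_re, Complex.sub_re, Complex.add_im, Complex.sub_im, Complex.mul_re, Complex.mul_im,
    Complex.I_re, Complex.I_im]
  generalize (D 0 0).re = a1, (D 0 0).im = a2, (D 0 1).re = a3, (D 0 1).im = a4,
    (D 1 0).re = b1, (D 1 0).im = b2, (D 1 1).re = b3, (D 1 1).im = b4,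
    (D 2 0).re = c1, (D 2 0).im = c2, (D 2 1).re = c3, (D 2 1).im = c4
  have key : ∀ x y z : ℝ, (x + y + z) ^ 2 ≤ 3 * (x ^ 2 + y ^ 2 + z ^ 2) := fun x y z => by
    nlinarith [sq_nonneg (x - y), sq_nonneg (x - z), sq_nonneg (y - z)]
  have h1 := key a3 b4 c1
  have h2 := key a4 (-b3) c2
  have h3 := key a1 (-b2) (-c3)
  have h4 := key a2 b1 (-c4)
  ring_nf at h1 h2 h3 h4 ⊢
  linarith

theorem norm_pauliSum_smul_sq (v : R3) (z : C2) :
    ‖pauliSum fun k => ((v k : ℝ) : ℂ) • z‖ ^ 2 = ‖v‖ ^ 2 * ‖z‖ ^ 2 := by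
  rw [EuclideanSpace.norm_sq_eq v]
  simp only [norm_sq_C2, Fin.sum_univ_three, pauliSum_apply_zero, pauliSum_apply_one,
    Complex.add_re, Complex.sub_re, Complex.add_im, Complex.sub_im, Complex.mul_re, Complex.mul_im,
    Complex.I_re, Complex.I_im, PiLp.smul_apply, smul_eq_mul, Complex.ofReal_re, Complex.ofReal_im,
    Real.norm_eq_abs, sq_abs]
  ring

theorem pauliSum_sub (D E : Fin 3 → C2) :
    pauliSum (fun k => D k - E k) = pauliSum D - pauliSum E := by
  simp [pauliSum, Finset.sum_sub_distrib]

theorem continuous_pauliSum : Continuous pauliSum :=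
  continuous_finsetSum _ fun k _ =>
    (LinearMap.continuous_of_finiteDimensional (Matrix.toEuclideanLin (pauli k))).comp
      (continuous_apply k)

theorem aestronglyMeasurable_pauliSum {D : Fin 3 → R3 → C2}
    (hD : ∀ k, AEStronglyMeasurable (D k) volume) :
    AEStronglyMeasurable (fun x => pauliSum fun k => D k x) volume :=
  (continuous_pauliSum.measurable.comp_aemeasurable
    (aemeasurable_pi_lambda _ fun k => (hD k).aemeasurable)).aestronglyMeasurable

theorem lintegral_pauliSum_sq_le {D : Fin 3 → R3 → C2}
    (hD : ∀ k, AEStronglyMeasurable (D k) volume) :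
    ∫⁻ x, ‖pauliSum fun k => D k x‖ₑ ^ 2 ≤ 3 * ∑ k, ∫⁻ x, ‖D k x‖ₑ ^ 2 := by
  rw [← lintegral_finsetSum' _ fun k _ => (hD k).enorm.pow_const 2,
    ← lintegral_const_mul' _ _ (by simp)]
  refine lintegral_mono fun x => ?_
  have h5 := ENNReal.ofReal_le_ofReal (norm_pauliSum_sq_le fun k => D k x)
  rw [ENNReal.ofReal_mul (by norm_num), ENNReal.ofReal_sum_of_nonneg (fun _ _ => by positivity),
    ENNReal.ofReal_pow (norm_nonneg _), ofReal_norm] at h5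
  simpa only [ENNReal.ofReal_pow (norm_nonneg _), ofReal_norm, ENNReal.ofReal_ofNat] using h5

theorem memLp_pauliSum {D : Fin 3 → R3 → C2} (hD : ∀ k, MemLp (D k) 2 volume) :
    MemLp (fun x => pauliSum fun k => D k x) 2 volume := by
  refine memLp_two_of_lintegral (aestronglyMeasurable_pauliSum fun k => (hD k).1) ?_
  refine ((lintegral_pauliSum_sq_le fun k => (hD k).1).trans_lt ?_).ne
  refine ENNReal.mul_lt_top (by simp) ?_
  exact ENNReal.sum_lt_top.2 fun k _ => (lintegral_sq_ne_top (hD k)).lt_top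

end Covariant

section Approximation

theorem lintegral_potential_smul_sq_le {b : R3 → ℝ} (hb : AEStronglyMeasurable b volume) (w : ℝ)
    {u : R3 → C2} (hu : AEStronglyMeasurable u volume) :
    ∫⁻ x, ‖((b x + w : ℝ) : ℂ) • u x‖ₑ ^ 2 ≤
      2 * ((∫⁻ x, ‖b x‖ₑ ^ 6) ^ (1 / 3 : ℝ) * (∫⁻ x, ‖u x‖ₑ ^ 6) ^ (1 / 6 : ℝ) *
        (∫⁻ x, ‖u x‖ₑ ^ 2) ^ (1 / 2 : ℝ)) + 2 * ‖w‖ₑ ^ 2 * ∫⁻ x, ‖u x‖ₑ ^ 2 := by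
  calc ∫⁻ x, ‖((b x + w : ℝ) : ℂ) • u x‖ₑ ^ 2
      ≤ ∫⁻ x, (2 * (‖b x‖ₑ ^ 2 * ‖u x‖ₑ ^ 2) + 2 * ‖w‖ₑ ^ 2 * ‖u x‖ₑ ^ 2) := by
        refine lintegral_mono fun x => ?_
        have h1 : ‖((b x + w : ℝ) : ℂ) • u x‖ ^ 2 ≤
            2 * (‖b x‖ ^ 2 * ‖u x‖ ^ 2) + 2 * ‖w‖ ^ 2 * ‖u x‖ ^ 2 := by
          rw [norm_smul, Complex.norm_real, mul_pow, ← mul_assoc, ← add_mul]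
          gcongr
          simp only [Real.norm_eq_abs, sq_abs]
          nlinarith [sq_nonneg (b x - w)]
        have h2 := ENNReal.ofReal_le_ofReal h1
        rw [ENNReal.ofReal_add (by positivity) (by positivity)] at h2
        simpa only [ENNReal.ofReal_mul (norm_nonneg _), ENNReal.ofReal_mul (pow_nonneg
          (norm_nonneg _) 2), ENNReal.ofReal_mul (zero_le_two (α := ℝ)),
          ENNReal.ofReal_mul (mul_nonneg (zero_le_two (α := ℝ)) (pow_nonneg (norm_nonneg w) 2)),
          ENNReal.ofReal_pow (norm_nonneg _), ofReal_norm, ENNReal.ofReal_ofNat] using h2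
    _ = 2 * (∫⁻ x, ‖b x‖ₑ ^ 2 * ‖u x‖ₑ ^ 2) + 2 * ‖w‖ₑ ^ 2 * ∫⁻ x, ‖u x‖ₑ ^ 2 := by
        rw [lintegral_add_right' _ ((hu.enorm.pow_const 2).const_mul (2 * ‖w‖ₑ ^ 2)),
          lintegral_const_mul' _ _ (by simp), lintegral_const_mul' _ _
            (ENNReal.mul_ne_top (by simp) (by simp))]
    _ ≤ _ := by
        gcongr
        exact lintegral_sq_mul_sq_le hb hu

theorem lintegral_pow_six_ne_top {F : Type*} [NormedAddCommGroup F] {u : R3 → F}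
    (hu : MemLp u 6 volume) : ∫⁻ x, ‖u x‖ₑ ^ 6 ≠ ⊤ := by
  rw [← lintegral_pow_six_eq]
  exact ENNReal.pow_ne_top hu.2.ne

theorem memLp_six_of_lintegral {F : Type*} [NormedAddCommGroup F] {u : R3 → F}
    (hu : AEStronglyMeasurable u volume) (h : ∫⁻ x, ‖u x‖ₑ ^ 6 ≠ ⊤) : MemLp u 6 volume := by
  refine ⟨hu, lt_top_iff_ne_top.2 fun h' => h ?_⟩
  rw [← lintegral_pow_six_eq, h']
  simp

theorem memLp_six_of_H1 {ψ : R3 → C2} {g : Fin 3 → R3 → C2} (hψ : MemLp ψ 2 volume)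
    (hg : ∀ k, HasWeakPartial k ψ (g k)) (hgL : ∀ k, MemLp (g k) 2 volume) :
    MemLp ψ 6 volume := by
  obtain ⟨C, hC⟩ := exists_sobolev_H1_const
  refine memLp_six_of_lintegral hψ.1 ((hC ψ g hψ hg hgL).trans_lt ?_).ne
  refine ENNReal.mul_lt_top ENNReal.coe_lt_top (ENNReal.pow_lt_top ?_)
  exact ENNReal.sum_lt_top.2 fun k _ => (lintegral_sq_ne_top (hgL k)).lt_top

theorem aestronglyMeasurable_potential_smul {b : R3 → ℝ} (hb : AEStronglyMeasurable b volume)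
    (w : ℝ) {u : R3 → C2} (hu : AEStronglyMeasurable u volume) :
    AEStronglyMeasurable (fun x => ((b x + w : ℝ) : ℂ) • u x) volume :=
  (Complex.continuous_ofReal.comp_aestronglyMeasurable (hb.add aestronglyMeasurable_const)).smul hu

theorem memLp_potential_smul {b : R3 → ℝ} (hb : MemLp b 6 volume) (w : ℝ) {u : R3 → C2}
    (hu : MemLp u 2 volume) (hu6 : MemLp u 6 volume) :
    MemLp (fun x => ((b x + w : ℝ) : ℂ) • u x) 2 volume := by
  refine memLp_two_of_lintegral (aestronglyMeasurable_potential_smul hb.1 w hu.1)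
    ((lintegral_potential_smul_sq_le hb.1 w hu.1).trans_lt ?_).ne
  have h1 := lintegral_pow_six_ne_top hb
  have h2 := lintegral_pow_six_ne_top hu6
  have h3 := lintegral_sq_ne_top hu
  exact ENNReal.add_lt_top.2 ⟨ENNReal.mul_lt_top (by simp) (ENNReal.mul_lt_top (ENNReal.mul_lt_top
    (ENNReal.rpow_lt_top_of_nonneg (by norm_num) h1)
    (ENNReal.rpow_lt_top_of_nonneg (by norm_num) h2))
    (ENNReal.rpow_lt_top_of_nonneg (by norm_num) h3)),
    ENNReal.mul_lt_top (ENNReal.mul_lt_top (by simp) (by simp)) h3.lt_top⟩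

theorem memLp_cov {ħ : ℝ} {b : Fin 3 → R3 → ℝ} (hb : ∀ k, MemLp (b k) 6 volume) (w : Fin 3 → ℝ)
    {ψ : R3 → C2} {g : Fin 3 → R3 → C2} (hψ : MemLp ψ 2 volume)
    (hg : ∀ k, HasWeakPartial k ψ (g k)) (hgL : ∀ k, MemLp (g k) 2 volume) (k : Fin 3) :
    MemLp (cov ħ (fun k x => b k x + w k) g ψ k) 2 volume :=
  ((hgL k).const_smul (Complex.I * (ħ : ℂ))).add
    (memLp_potential_smul (hb k) (w k) hψ (memLp_six_of_H1 hψ hg hgL))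

theorem cov_sub (ħ : ℝ) (a : Fin 3 → R3 → ℝ) (g g' : Fin 3 → R3 → C2) (ψ ψ' : R3 → C2)
    (k : Fin 3) :
    cov ħ a g ψ k - cov ħ a g' ψ' k = cov ħ a (fun k => g k - g' k) (ψ - ψ') k := by
  funext x
  simp only [cov, Pi.sub_apply, smul_sub]
  abel

theorem tendsto_lintegral_sq_zero {F : Type*} [NormedAddCommGroup F] {v : ℕ → R3 → F}
    (h : Tendsto (fun n => eLpNorm (v n) 2 volume) atTop (𝓝 0)) :
    Tendsto (fun n => ∫⁻ x, ‖v n x‖ₑ ^ 2) atTop (𝓝 0) := by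
  simpa [eLpNorm_two_sq] using ENNReal.Tendsto.pow (n := 2) h

theorem tendsto_rpow_zero {v : ℕ → ℝ≥0∞} {p : ℝ} (hp : 0 < p) (h : Tendsto v atTop (𝓝 0)) :
    Tendsto (fun n => v n ^ p) atTop (𝓝 0) := by
  have := (ENNReal.continuous_rpow_const (y := p)).tendsto 0 |>.comp h
  rw [ENNReal.zero_rpow_of_pos hp] at this
  exact this

theorem tendsto_eLpNorm_potential_smul {b : R3 → ℝ} (hb : MemLp b 6 volume) (w : ℝ)
    {v : ℕ → R3 → C2} (hv : ∀ n, AEStronglyMeasurable (v n) volume)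
    (hlim : Tendsto (fun n => eLpNorm (v n) 2 volume) atTop (𝓝 0))
    (hsix : Tendsto (fun n => ∫⁻ x, ‖v n x‖ₑ ^ 6) atTop (𝓝 0)) :
    Tendsto (fun n => eLpNorm (fun x => ((b x + w : ℝ) : ℂ) • v n x) 2 volume) atTop (𝓝 0) := by
  refine tendsto_eLpNorm_of_tendsto_lintegral_sq ?_
  have t1 := tendsto_rpow_zero (p := 1 / 6) (by norm_num) hsix
  have t2 := tendsto_rpow_zero (p := 1 / 2) (by norm_num) (tendsto_lintegral_sq_zero hlim)
  have hbt : (∫⁻ x, ‖b x‖ₑ ^ 6) ^ (1 / 3 : ℝ) ≠ ⊤ :=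
    (ENNReal.rpow_lt_top_of_nonneg (by norm_num) (lintegral_pow_six_ne_top hb)).ne
  have t3 := ENNReal.Tendsto.mul (ENNReal.Tendsto.const_mul t1 (Or.inr hbt)) (Or.inr (by simp))
    t2 (Or.inr (by simp))
  have t4 := ENNReal.Tendsto.const_mul (a := 2) t3 (Or.inr (by simp))
  have t5 := ENNReal.Tendsto.const_mul (a := 2 * ‖w‖ₑ ^ 2) (tendsto_lintegral_sq_zero hlim)
    (Or.inr (ENNReal.mul_ne_top (by simp) (by simp)))
  have t6 := t4.add t5
  simp only [mul_zero, add_zero] at t6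
  exact tendsto_of_tendsto_of_tendsto_of_le_of_le tendsto_const_nhds t6 (fun _ => zero_le)
    fun n => lintegral_potential_smul_sq_le hb.1 (w) (hv n)

/-- The covariant derivative of an `H¹`-null sequence is an `L²`-null sequence. -/
theorem tendsto_eLpNorm_cov_zero (ħ : ℝ) {b : Fin 3 → R3 → ℝ} (hb : ∀ k, MemLp (b k) 6 volume)
    (w : Fin 3 → ℝ) {v : ℕ → R3 → C2} {d : ℕ → Fin 3 → R3 → C2} (hv : ∀ n, MemLp (v n) 2 volume)
    (hd : ∀ n k, HasWeakPartial k (v n) (d n k)) (hdL : ∀ n k, MemLp (d n k) 2 volume)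
    (hlim : Tendsto (fun n => eLpNorm (v n) 2 volume) atTop (𝓝 0))
    (hlimd : ∀ k, Tendsto (fun n => eLpNorm (d n k) 2 volume) atTop (𝓝 0)) (k : Fin 3) :
    Tendsto (fun n => eLpNorm (cov ħ (fun k x => b k x + w k) (d n) (v n) k) 2 volume)
      atTop (𝓝 0) := by
  obtain ⟨C, hC⟩ := exists_sobolev_H1_const
  have hsix : Tendsto (fun n => ∫⁻ x, ‖v n x‖ₑ ^ 6) atTop (𝓝 0) := by
    have h1 : Tendsto (fun n => (C : ℝ≥0∞) * (∑ k, ∫⁻ x, ‖d n k x‖ₑ ^ 2) ^ 3) atTop (𝓝 0) := by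
      have h2 : Tendsto (fun n => ∑ k, ∫⁻ x, ‖d n k x‖ₑ ^ 2) atTop (𝓝 0) := by
        simpa using tendsto_finsetSum Finset.univ fun k _ => tendsto_lintegral_sq_zero (hlimd k)
      simpa using ENNReal.Tendsto.const_mul (ENNReal.Tendsto.pow (n := 3) h2)
        (Or.inr ENNReal.coe_ne_top)
    exact tendsto_of_tendsto_of_tendsto_of_le_of_le tendsto_const_nhds h1 (fun _ => zero_le)
      fun n => hC _ (d n) (hv n) (hd n) (hdL n)
  have h1 : Tendsto (fun n => eLpNorm ((Complex.I * (ħ : ℂ)) • d n k) 2 volume)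
      atTop (𝓝 0) := by
    simp only [eLpNorm_const_smul]
    simpa using ENNReal.Tendsto.const_mul (a := ‖Complex.I * (ħ : ℂ)‖ₑ) (hlimd k)
      (Or.inr enorm_ne_top)
  have h2 := tendsto_eLpNorm_potential_smul (hb k) (w k) (fun n => (hv n).1) hlim hsix
  have h3 := h1.add h2
  rw [add_zero] at h3
  refine tendsto_of_tendsto_of_tendsto_of_le_of_le tendsto_const_nhds
    h3 (fun _ => zero_le) fun n => ?_
  exact eLpNorm_add_le ((hdL n k).1.const_smul (Complex.I * (ħ : ℂ)))
    (aestronglyMeasurable_potential_smul (hb k).1 (w k) (hv n).1) (by norm_num)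

/-- `L²`-convergence of the covariant derivatives implies convergence of the kinetic energies. -/
theorem tendsto_kin {ħ : ℝ} {a : Fin 3 → R3 → ℝ} {u : ℕ → R3 → C2} {d : ℕ → Fin 3 → R3 → C2}
    {ψ : R3 → C2} {g : Fin 3 → R3 → C2}
    (hDn : ∀ n k, MemLp (cov ħ a (d n) (u n) k) 2 volume)
    (hD : ∀ k, MemLp (cov ħ a g ψ k) 2 volume)
    (hcov : ∀ k, Tendsto (fun n => eLpNorm (cov ħ a (d n) (u n) k - cov ħ a g ψ k) 2 volume)
      atTop (𝓝 0)) (j : Model) :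
    Tendsto (fun n => kin ħ j a (d n) (u n)) atTop (𝓝 (kin ħ j a g ψ)) := by
  cases j with
  | S => exact tendsto_finsetSum _ fun k _ => tendsto_normSqL2 (fun n => (hDn n k).1) (hD k) (hcov k)
  | P =>
    refine tendsto_normSqL2 (fun n => aestronglyMeasurable_pauliSum fun k => (hDn n k).1)
      (memLp_pauliSum hD) (tendsto_eLpNorm_of_tendsto_lintegral_sq ?_)
    have h1 : Tendsto (fun n => 3 * ∑ k, ∫⁻ x, ‖(cov ħ a (d n) (u n) k - cov ħ a g ψ k) x‖ₑ ^ 2)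
        atTop (𝓝 0) := by
      have := ENNReal.Tendsto.const_mul (a := 3) (tendsto_finsetSum Finset.univ
        fun k _ => tendsto_lintegral_sq_zero (hcov k)) (Or.inr (by simp))
      simpa using this
    refine tendsto_of_tendsto_of_tendsto_of_le_of_le tendsto_const_nhds h1 (fun _ => zero_le)
      fun n => ?_
    refine le_trans (le_of_eq (lintegral_congr fun x => ?_))
      (lintegral_pauliSum_sq_le fun k => (hDn n k).1.sub (hD k).1)
    simp only [Pi.sub_apply, pauliSum_sub]

/-- Test functions are dense in `H¹`, and the kinetic energies converge along the
approximation. -/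
theorem exists_kin_approx (ħ : ℝ) {b : Fin 3 → R3 → ℝ} (hb : ∀ k, MemLp (b k) 6 volume)
    {ψ : R3 → C2} {g : Fin 3 → R3 → C2} (hψ : MemLp ψ 2 volume)
    (hg : ∀ k, HasWeakPartial k ψ (g k)) (hgL : ∀ k, MemLp (g k) 2 volume) :
    ∃ u : ℕ → R3 → C2, (∀ n, ContDiff ℝ ∞ (u n)) ∧ (∀ n, HasCompactSupport (u n)) ∧
      Tendsto (fun n => eLpNorm (u n - ψ) 2 volume) atTop (𝓝 0) ∧
      Tendsto (fun n => normSqL2 (u n)) atTop (𝓝 (normSqL2 ψ)) ∧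
      ∀ (w : Fin 3 → ℝ) (j : Model), Tendsto
        (fun n => kin ħ j (fun k x => b k x + w k) (fun k => pd k (u n)) (u n)) atTop
        (𝓝 (kin ħ j (fun k x => b k x + w k) g ψ)) := by
  obtain ⟨u, hu, huc, hlim, hlimd⟩ := exists_smooth_approx hψ hg hgL
  have hu1 : ∀ n, ContDiff ℝ 1 (u n) := fun n => (hu n).of_le (by simp)
  have huL : ∀ n, MemLp (u n) 2 volume := fun n =>
    (hu n).continuous.memLp_of_hasCompactSupport (huc n)
  have hpL : ∀ n k, MemLp (pd k (u n)) 2 volume := fun n k =>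
    (continuous_pd (hu1 n)).memLp_of_hasCompactSupport (hasCompactSupport_pd (huc n))
  have hpw : ∀ n k, HasWeakPartial k (u n) (pd k (u n)) := fun n k =>
    HasWeakPartial.of_contDiff (hu1 n)
  refine ⟨u, hu, huc, hlim, tendsto_normSqL2 (fun n => (huL n).1) hψ hlim, fun w j => ?_⟩
  refine tendsto_kin (d := fun n k => pd k (u n)) (fun n => memLp_cov hb w (huL n) (hpw n) (hpL n))
    (memLp_cov hb w hψ hg hgL) (fun k => ?_) j
  simp only [cov_sub]
  exact tendsto_eLpNorm_cov_zero ħ hb w (fun n => (huL n).sub hψ)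
    (fun n k => (hpw n k).sub (hg k)) (fun n k => (hpL n k).sub (hgL k)) hlim hlimd k

/-- The diamagnetic Sobolev inequality on `H¹`. -/
theorem exists_diamagnetic_H1_const : ∃ C : ℝ≥0, ∀ (ħ : ℝ), 0 < ħ → ∀ (b : Fin 3 → R3 → ℝ)
    (w : Fin 3 → ℝ) (ψ : R3 → C2) (g : Fin 3 → R3 → C2), (∀ k, MemLp (b k) 6 volume) →
    MemLp ψ 2 volume → (∀ k, HasWeakPartial k ψ (g k)) → (∀ k, MemLp (g k) 2 volume) →
    ∫⁻ x, ‖ψ x‖ₑ ^ 6 ≤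
      ENNReal.ofReal (C * ((ħ⁻¹) ^ 2 * kin ħ .S (fun k x => b k x + w k) g ψ) ^ 3) := by
  obtain ⟨C, hC⟩ := exists_diamagnetic_const
  refine ⟨C, fun ħ hħ b w ψ g hb hψ hg hgL => ?_⟩
  obtain ⟨u, hu, huc, hlim, -, hkin⟩ := exists_kin_approx ħ hb hψ hg hgL
  have hu1 : ∀ n, ContDiff ℝ 1 (u n) := fun n => (hu n).of_le (by simp)
  refine lintegral_pow_six_le_of_approx (fun n => (hu n).continuous.aestronglyMeasurable) hψ.1 hlim
    (B := fun n => ENNReal.ofReal (C * ((ħ⁻¹) ^ 2 *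
      kin ħ .S (fun k x => b k x + w k) (fun k => pd k (u n)) (u n)) ^ 3)) (fun n => ?_) ?_
  · refine (hC ħ hħ (fun k x => b k x + w k) (u n)
      (fun k => (hb k).1.add aestronglyMeasurable_const) (hu1 n) (huc n)).trans_eq ?_
    have hL : ∀ k, MemLp (cov ħ (fun k x => b k x + w k) (fun k => pd k (u n)) (u n) k) 2 volume :=
      memLp_cov hb w ((hu n).continuous.memLp_of_hasCompactSupport (huc n))
        (fun k => HasWeakPartial.of_contDiff (hu1 n)) fun k =>
          (continuous_pd (hu1 n)).memLp_of_hasCompactSupport (hasCompactSupport_pd (huc n))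
    have e : ∀ k, ∫⁻ x, ‖ħ⁻¹ • ((Complex.I * (ħ : ℂ)) • pd k (u n) x +
        ((b k x + w k : ℝ) : ℂ) • u n x)‖ₑ ^ 2 = ENNReal.ofReal ((ħ⁻¹) ^ 2 *
          normSqL2 (cov ħ (fun k x => b k x + w k) (fun k => pd k (u n)) (u n) k)) := fun k => by
      rw [ENNReal.ofReal_mul (by positivity), ofReal_normSqL2 (hL k),
        ← lintegral_const_mul' _ _ (by simp)]
      refine lintegral_congr fun x => ?_
      rw [enorm_smul, mul_pow, ENNReal.ofReal_pow (by positivity),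
        Real.enorm_of_nonneg (by positivity)]
      rfl
    simp only [e]
    rw [← ENNReal.ofReal_sum_of_nonneg fun k _ => mul_nonneg (by positivity) (normSqL2_nonneg _),
      ← Finset.mul_sum, ENNReal.ofReal_mul NNReal.zero_le_coe, ENNReal.ofReal_pow
        (mul_nonneg (by positivity) (kin_nonneg ħ .S _ _ _)), ENNReal.ofReal_coe_nnreal]
    rfl
  · exact ENNReal.tendsto_ofReal ((((hkin w .S).const_mul _).pow 3).const_mul _)

end Approximation

section Lichnerowicz

/-- `f` is integrable with integral `r`. -/
def HasInt (f : R3 → ℝ) (r : ℝ) : Prop := Integrable f volume ∧ ∫ x, f x = r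

theorem HasInt.add {f g : R3 → ℝ} {r s : ℝ} (hf : HasInt f r) (hg : HasInt g s) :
    HasInt (fun x => f x + g x) (r + s) :=
  ⟨hf.1.add hg.1, by rw [integral_add hf.1 hg.1, hf.2, hg.2]⟩

theorem HasInt.sub {f g : R3 → ℝ} {r s : ℝ} (hf : HasInt f r) (hg : HasInt g s) :
    HasInt (fun x => f x - g x) (r - s) :=
  ⟨hf.1.sub hg.1, by rw [integral_sub hf.1 hg.1, hf.2, hg.2]⟩

theorem HasInt.const_mul {f : R3 → ℝ} {r : ℝ} (hf : HasInt f r) (t : ℝ) :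
    HasInt (fun x => t * f x) (t * r) :=
  ⟨hf.1.const_mul t, by rw [integral_const_mul, hf.2]⟩

theorem pd_comm {k l : Fin 3} {f : R3 → ℝ} (hf : ContDiff ℝ ∞ f) (x : R3) :
    pd k (pd l f) x = pd l (pd k f) x := by
  have h : ∀ i j : Fin 3, pd i (pd j f) x = fderiv ℝ (fderiv ℝ f) x (EuclideanSpace.single i 1)
      (EuclideanSpace.single j 1) := fun i j => by
    have hd : DifferentiableAt ℝ (fderiv ℝ f) x :=
      (hf.fderiv_right (m := ∞) (by simp)).differentiable (by simp) x
    have h1 : HasFDerivAt (pd j f) _ x := hd.hasFDerivAt.clm_apply (hasFDerivAt_const _ x)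
    rw [pd, h1.fderiv]
    simp
  rw [h, h]
  have hs : IsSymmSndFDerivAt ℝ f x :=
    (contDiff_infty.1 hf 2).contDiffAt.isSymmSndFDerivAt (by simp)
  exact hs.eq _ _

theorem hasInt_jacobian (k l : Fin 3) {f g : R3 → ℝ} (hf : ContDiff ℝ ∞ f)
    (hfc : HasCompactSupport f) (hg : ContDiff ℝ ∞ g) :
    HasInt (fun x => pd k f x * pd l g x - pd l f x * pd k g x) 0 := by
  have hg' : ∀ i, ContDiff ℝ 1 (pd i g) := fun i => (contDiff_pd hg).of_le (by simp)
  have hf1 : ContDiff ℝ 1 f := hf.of_le (by simp)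
  have hi : ∀ i j, Integrable (fun x => pd i f x * pd j g x) volume := fun i j =>
    ((continuous_pd hf1).mul (hg' j).continuous).integrable_of_hasCompactSupport
      (hasCompactSupport_pd hfc).mul_right
  have h1 := (HasWeakPartial.of_contDiff (k := k) (hg' l)).integral_eq f hf hfc
  have h2 := (HasWeakPartial.of_contDiff (k := l) (hg' k)).integral_eq f hf hfc
  refine ⟨(hi k l).sub (hi l k), ?_⟩
  rw [integral_sub (hi k l) (hi l k), sub_eq_zero]
  refine h1.trans (Eq.trans ?_ h2.symm)
  congr 2
  funext x
  rw [pd_comm hg]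

theorem HasWeakPartial.hasInt {k : Fin 3} {a d s : R3 → ℝ} (h : HasWeakPartial k a d)
    (hs : ContDiff ℝ ∞ s) (hsc : HasCompactSupport s) :
    HasInt (fun x => a x * pd k s x) (-∫ x, d x * s x) := by
  have hs1 : ContDiff ℝ 1 s := hs.of_le (by simp)
  have h1 := h.integral_eq s hs hsc
  have h2 := h.locallyIntegrable.integrable_smul_left_of_hasCompactSupport
    (continuous_pd (k := k) hs1) (hasCompactSupport_pd hsc)
  refine ⟨by simpa only [smul_eq_mul, mul_comm] using h2, ?_⟩
  simpa only [smul_eq_mul, mul_comm, pd] using h1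

theorem pd_clm {F G : Type*} [NormedAddCommGroup F] [NormedSpace ℝ F] [NormedAddCommGroup G]
    [NormedSpace ℝ G] (L : F →L[ℝ] G) {k : Fin 3} {f : R3 → F} (hf : ContDiff ℝ 1 f) (x : R3) :
    pd k (fun y => L (f y)) x = L (pd k f x) := by
  have h1 : HasFDerivAt (fun y => L (f y)) _ x :=
    L.hasFDerivAt.comp x (hf.differentiable (by simp) x).hasFDerivAt
  rw [pd, h1.fderiv]
  rfl

/-- The real and imaginary parts of the components of a spinor. -/
def comp : Fin 4 → C2 →L[ℝ] ℝ :=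
  ![Complex.reCLM.comp ((EuclideanSpace.proj (0 : Fin 2) : C2 →L[ℂ] ℂ).restrictScalars ℝ),
    Complex.imCLM.comp ((EuclideanSpace.proj (0 : Fin 2) : C2 →L[ℂ] ℂ).restrictScalars ℝ),
    Complex.reCLM.comp ((EuclideanSpace.proj (1 : Fin 2) : C2 →L[ℂ] ℂ).restrictScalars ℝ),
    Complex.imCLM.comp ((EuclideanSpace.proj (1 : Fin 2) : C2 →L[ℂ] ℂ).restrictScalars ℝ)]

theorem comp_zero (z : C2) : comp 0 z = (z 0).re := rfl
theorem comp_one (z : C2) : comp 1 z = (z 0).im := rfl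
theorem comp_two (z : C2) : comp 2 z = (z 1).re := rfl
theorem comp_three (z : C2) : comp 3 z = (z 1).im := rfl

/-- The spin vector `⟨z, σ z⟩` of a spinor. -/
def spin (z : C2) : Fin 3 → ℝ :=
  ![2 * (comp 0 z * comp 2 z + comp 1 z * comp 3 z),
    2 * (comp 0 z * comp 3 z - comp 1 z * comp 2 z),
    comp 0 z * comp 0 z + comp 1 z * comp 1 z - comp 2 z * comp 2 z - comp 3 z * comp 3 z]

theorem abs_spin_le (m : Fin 3) (z : C2) : |spin z m| ≤ ‖z‖ ^ 2 := by
  rw [norm_sq_C2, ← comp_zero, ← comp_one, ← comp_two, ← comp_three]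
  have h1 : spin z 0 = 2 * (comp 0 z * comp 2 z + comp 1 z * comp 3 z) := rfl
  have h2 : spin z 1 = 2 * (comp 0 z * comp 3 z - comp 1 z * comp 2 z) := rfl
  have h3 : spin z 2 = comp 0 z * comp 0 z + comp 1 z * comp 1 z - comp 2 z * comp 2 z -
    comp 3 z * comp 3 z := rfl
  rw [abs_le]
  fin_cases m
  · change _ ≤ spin z 0 ∧ spin z 0 ≤ _
    rw [h1]
    constructor <;> nlinarith [sq_nonneg (comp 0 z - comp 2 z), sq_nonneg (comp 0 z + comp 2 z),
      sq_nonneg (comp 1 z - comp 3 z), sq_nonneg (comp 1 z + comp 3 z)]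
  · change _ ≤ spin z 1 ∧ spin z 1 ≤ _
    rw [h2]
    constructor <;> nlinarith [sq_nonneg (comp 0 z - comp 3 z), sq_nonneg (comp 0 z + comp 3 z),
      sq_nonneg (comp 1 z - comp 2 z), sq_nonneg (comp 1 z + comp 2 z)]
  · change _ ≤ spin z 2 ∧ spin z 2 ≤ _
    rw [h3]
    constructor <;> nlinarith [sq_nonneg (comp 0 z), sq_nonneg (comp 1 z), sq_nonneg (comp 2 z),
      sq_nonneg (comp 3 z)]

theorem contDiff_spin {ψ : R3 → C2} (hψ : ContDiff ℝ ∞ ψ) (m : Fin 3) :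
    ContDiff ℝ ∞ fun x => spin (ψ x) m := by
  have h : ∀ i, ContDiff ℝ ∞ fun x => comp i (ψ x) := fun i => (comp i).contDiff.comp hψ
  fin_cases m
  · exact contDiff_const.mul (((h 0).mul (h 2)).add ((h 1).mul (h 3)))
  · exact contDiff_const.mul (((h 0).mul (h 3)).sub ((h 1).mul (h 2)))
  · exact ((((h 0).mul (h 0)).add ((h 1).mul (h 1))).sub ((h 2).mul (h 2))).sub ((h 3).mul (h 3))

theorem hasCompactSupport_spin {ψ : R3 → C2} (hc : HasCompactSupport ψ) (m : Fin 3) :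
    HasCompactSupport fun x => spin (ψ x) m := by
  refine hc.mono fun x hx => ?_
  contrapose! hx
  have : ψ x = 0 := by simpa using hx
  have h := abs_spin_le m (ψ x)
  simpa [this] using h

theorem pd_spin {ψ : R3 → C2} (hψ : ContDiff ℝ ∞ ψ) (k m : Fin 3) (x : R3) :
    pd k (fun x => spin (ψ x) m) x =
      ![2 * (comp 0 (ψ x) * comp 2 (pd k ψ x) + comp 0 (pd k ψ x) * comp 2 (ψ x)
          + (comp 1 (ψ x) * comp 3 (pd k ψ x) + comp 1 (pd k ψ x) * comp 3 (ψ x))),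
        2 * (comp 0 (ψ x) * comp 3 (pd k ψ x) + comp 0 (pd k ψ x) * comp 3 (ψ x)
          - (comp 1 (ψ x) * comp 2 (pd k ψ x) + comp 1 (pd k ψ x) * comp 2 (ψ x))),
        2 * (comp 0 (ψ x) * comp 0 (pd k ψ x) + comp 1 (ψ x) * comp 1 (pd k ψ x)
          - comp 2 (ψ x) * comp 2 (pd k ψ x) - comp 3 (ψ x) * comp 3 (pd k ψ x))] m := by
  have hd : ∀ i, HasFDerivAt (fun x => comp i (ψ x)) ((comp i).comp (fderiv ℝ ψ x)) x := fun i =>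
    (comp i).hasFDerivAt.comp x (hψ.differentiable (by simp) x).hasFDerivAt
  fin_cases m
  · have h : HasFDerivAt (fun x => spin (ψ x) 0) _ x :=
      (((hd 0).mul (hd 2)).add ((hd 1).mul (hd 3))).const_mul 2
    simp [pd, h.fderiv]
    ring
  · have h : HasFDerivAt (fun x => spin (ψ x) 1) _ x :=
      (((hd 0).mul (hd 3)).sub ((hd 1).mul (hd 2))).const_mul 2
    simp [pd, h.fderiv]
    ring
  · have h : HasFDerivAt (fun x => spin (ψ x) 2) _ x :=
      ((((hd 0).mul (hd 0)).add ((hd 1).mul (hd 1))).sub ((hd 2).mul (hd 2))).sub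
        ((hd 3).mul (hd 3))
    simp [pd, h.fderiv]
    ring

/-- The pointwise difference of the Pauli and the Schrödinger energy densities, written as a
potential term plus a sum of Jacobians. -/
theorem norm_pauliSum_cov_sq_sub (ħ : ℝ) (a : Fin 3 → R3 → ℝ) {ψ : R3 → C2}
    (hψ : ContDiff ℝ ∞ ψ) (x : R3) :
    ‖pauliSum fun k => cov ħ a (fun k => pd k ψ) ψ k x‖ ^ 2 -
      ∑ k, ‖cov ħ a (fun k => pd k ψ) ψ k x‖ ^ 2 =
    -ħ * ((a 0 x * pd 1 (fun x => spin (ψ x) 2) x - a 0 x * pd 2 (fun x => spin (ψ x) 1) x)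
      + (a 1 x * pd 2 (fun x => spin (ψ x) 0) x - a 1 x * pd 0 (fun x => spin (ψ x) 2) x)
      + (a 2 x * pd 0 (fun x => spin (ψ x) 1) x - a 2 x * pd 1 (fun x => spin (ψ x) 0) x))
    + 2 * ħ ^ 2 * (
      ((pd 0 (fun x => comp 2 (ψ x)) x * pd 1 (fun x => comp 3 (ψ x)) x
        - pd 1 (fun x => comp 2 (ψ x)) x * pd 0 (fun x => comp 3 (ψ x)) x)
      - (pd 0 (fun x => comp 0 (ψ x)) x * pd 1 (fun x => comp 1 (ψ x)) x
        - pd 1 (fun x => comp 0 (ψ x)) x * pd 0 (fun x => comp 1 (ψ x)) x))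
      + ((pd 1 (fun x => comp 1 (ψ x)) x * pd 2 (fun x => comp 2 (ψ x)) x
        - pd 2 (fun x => comp 1 (ψ x)) x * pd 1 (fun x => comp 2 (ψ x)) x)
      - (pd 1 (fun x => comp 0 (ψ x)) x * pd 2 (fun x => comp 3 (ψ x)) x
        - pd 2 (fun x => comp 0 (ψ x)) x * pd 1 (fun x => comp 3 (ψ x)) x))
      + ((pd 2 (fun x => comp 0 (ψ x)) x * pd 0 (fun x => comp 2 (ψ x)) x
        - pd 0 (fun x => comp 0 (ψ x)) x * pd 2 (fun x => comp 2 (ψ x)) x)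
      + (pd 2 (fun x => comp 1 (ψ x)) x * pd 0 (fun x => comp 3 (ψ x)) x
        - pd 0 (fun x => comp 1 (ψ x)) x * pd 2 (fun x => comp 3 (ψ x)) x))) := by
  have hψ1 : ContDiff ℝ 1 ψ := hψ.of_le (by simp)
  simp only [pd_spin hψ, pd_clm _ hψ1]
  simp only [norm_sq_C2, Fin.sum_univ_three, pauliSum_apply_zero,
    pauliSum_apply_one, cov, comp_zero, comp_one, comp_two, comp_three, Complex.add_re,
    Complex.sub_re, Complex.add_im, Complex.sub_im, Complex.mul_re, Complex.mul_im,
    Complex.I_re, Complex.I_im, PiLp.smul_apply, PiLp.add_apply, smul_eq_mul, Complex.ofReal_re,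
    Complex.ofReal_im, Matrix.cons_val]
  ring

/-- For test functions the difference of the Pauli and the Schrödinger kinetic energies only
depends on the derivatives of the potential. -/
theorem kin_pauli_sub_schroedinger (ħ : ℝ) {a : Fin 3 → R3 → ℝ} {d : Fin 3 → Fin 3 → R3 → ℝ}
    (ha : ∀ k l, HasWeakPartial k (a l) (d k l)) {ψ : R3 → C2} (hψ : ContDiff ℝ ∞ ψ)
    (hc : HasCompactSupport ψ) (hL : ∀ k, MemLp (cov ħ a (fun k => pd k ψ) ψ k) 2 volume) :
    kin ħ .P a (fun k => pd k ψ) ψ - kin ħ .S a (fun k => pd k ψ) ψ =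
      ħ * (((∫ x, d 1 0 x * spin (ψ x) 2) - ∫ x, d 2 0 x * spin (ψ x) 1)
        + ((∫ x, d 2 1 x * spin (ψ x) 0) - ∫ x, d 0 1 x * spin (ψ x) 2)
        + ((∫ x, d 0 2 x * spin (ψ x) 1) - ∫ x, d 1 2 x * spin (ψ x) 0)) := by
  have hs := fun k l m => (ha k l).hasInt (contDiff_spin hψ m) (hasCompactSupport_spin hc m)
  have hcomp : ∀ i, ContDiff ℝ ∞ fun x => comp i (ψ x) := fun i => (comp i).contDiff.comp hψ
  have hcs : ∀ i, HasCompactSupport fun x => comp i (ψ x) := fun i =>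
    hc.comp_left (map_zero (comp i))
  have hJ := fun k l i i' => hasInt_jacobian k l (hcomp i) (hcs i) (hcomp i')
  have hI := ((((hs 1 0 2).sub (hs 2 0 1)).add ((hs 2 1 0).sub (hs 0 1 2))).add
    ((hs 0 2 1).sub (hs 1 2 0))).const_mul (-ħ)
  have hI' := ((((hJ 0 1 2 3).sub (hJ 0 1 0 1)).add ((hJ 1 2 1 2).sub (hJ 1 2 0 3))).add
    ((hJ 2 0 0 2).add (hJ 2 0 1 3))).const_mul (2 * ħ ^ 2)
  have h1 := (hI.add hI').2
  have h2 : kin ħ .P a (fun k => pd k ψ) ψ - kin ħ .S a (fun k => pd k ψ) ψ =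
      ∫ x, (‖pauliSum fun k => cov ħ a (fun k => pd k ψ) ψ k x‖ ^ 2 -
        ∑ k, ‖cov ħ a (fun k => pd k ψ) ψ k x‖ ^ 2) := by
    rw [integral_sub (integrable_norm_sq (memLp_pauliSum hL))
      (integrable_finsetSum _ fun k _ => integrable_norm_sq (hL k)),
      integral_finsetSum _ fun k _ => integrable_norm_sq (hL k)]
    rfl
  rw [h2]
  simp only [norm_pauliSum_cov_sq_sub ħ a hψ]
  rw [h1]
  ring

end Lichnerowicz

section Estimates

theorem integral_norm_mul_sq_le_two {F G : Type*} [NormedAddCommGroup F] [NormedAddCommGroup G]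
    {f : R3 → G} {u : R3 → F} (hf : AEStronglyMeasurable f volume)
    (hu : AEStronglyMeasurable u volume) {X Y Z : ℝ} (hX0 : 0 ≤ X) (hY0 : 0 ≤ Y) (hZ0 : 0 ≤ Z)
    (hY : ∫⁻ x, ‖f x‖ₑ ^ 2 ≤ ENNReal.ofReal Y) (hX : ∫⁻ x, ‖u x‖ₑ ^ 6 ≤ ENNReal.ofReal X)
    (hZ : ∫⁻ x, ‖u x‖ₑ ^ 2 ≤ ENNReal.ofReal Z) :
    ∫ x, ‖f x‖ * ‖u x‖ ^ 2 ≤ Y ^ (1 / 2 : ℝ) * X ^ (1 / 4 : ℝ) * Z ^ (1 / 4 : ℝ) := by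
  rw [integral_norm_mul_sq hf hu]
  refine ENNReal.toReal_le_of_le_ofReal (by positivity) ?_
  rw [ENNReal.ofReal_mul (by positivity), ENNReal.ofReal_mul (by positivity),
    ← ENNReal.ofReal_rpow_of_nonneg hY0 (by norm_num),
    ← ENNReal.ofReal_rpow_of_nonneg hX0 (by norm_num),
    ← ENNReal.ofReal_rpow_of_nonneg hZ0 (by norm_num)]
  exact (lintegral_mul_sq_le_two hf hu).trans (by gcongr)

theorem integral_norm_mul_sq_le_six {F G : Type*} [NormedAddCommGroup F] [NormedAddCommGroup G]
    {f : R3 → G} {u : R3 → F} (hf : AEStronglyMeasurable f volume)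
    (hu : AEStronglyMeasurable u volume) {X Y Z : ℝ} (hX0 : 0 ≤ X) (hY0 : 0 ≤ Y) (hZ0 : 0 ≤ Z)
    (hY : ∫⁻ x, ‖f x‖ₑ ^ 6 ≤ ENNReal.ofReal Y) (hX : ∫⁻ x, ‖u x‖ₑ ^ 6 ≤ ENNReal.ofReal X)
    (hZ : ∫⁻ x, ‖u x‖ₑ ^ 2 ≤ ENNReal.ofReal Z) :
    ∫ x, ‖f x‖ * ‖u x‖ ^ 2 ≤ Y ^ (1 / 6 : ℝ) * X ^ (1 / 12 : ℝ) * Z ^ (3 / 4 : ℝ) := by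
  rw [integral_norm_mul_sq hf hu]
  refine ENNReal.toReal_le_of_le_ofReal (by positivity) ?_
  rw [ENNReal.ofReal_mul (by positivity), ENNReal.ofReal_mul (by positivity),
    ← ENNReal.ofReal_rpow_of_nonneg hY0 (by norm_num),
    ← ENNReal.ofReal_rpow_of_nonneg hX0 (by norm_num),
    ← ENNReal.ofReal_rpow_of_nonneg hZ0 (by norm_num)]
  exact (lintegral_mul_sq_le_six hf hu).trans (by gcongr)

theorem integrable_norm_mul_sq {F G : Type*} [NormedAddCommGroup F] [NormedAddCommGroup G]
    {f : R3 → G} {u : R3 → F} (hf : MemLp f 6 volume) (hu : MemLp u 2 volume)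
    (hu6 : MemLp u 6 volume) : Integrable (fun x => ‖f x‖ * ‖u x‖ ^ 2) volume := by
  refine ⟨hf.1.norm.mul (hu.1.norm.pow 2), ?_⟩
  have e : ∀ x, ‖‖f x‖ * ‖u x‖ ^ 2‖ₑ = ‖f x‖ₑ * ‖u x‖ₑ ^ 2 := fun x => by
    rw [enorm_mul, enorm_pow, enorm_norm, enorm_norm]
  rw [HasFiniteIntegral, lintegral_congr e]
  refine (lintegral_mul_sq_le_six hf.1 hu.1).trans_lt ?_
  exact ENNReal.mul_lt_top (ENNReal.mul_lt_top
    (ENNReal.rpow_lt_top_of_nonneg (by norm_num) (lintegral_pow_six_ne_top hf))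
    (ENNReal.rpow_lt_top_of_nonneg (by norm_num) (lintegral_pow_six_ne_top hu6)))
    (ENNReal.rpow_lt_top_of_nonneg (by norm_num) (lintegral_sq_ne_top hu))

theorem abs_integral_mul_spin_le {d : R3 → ℝ} {u : R3 → C2} (hd : LocallyIntegrable d volume)
    (hu : ContDiff ℝ ∞ u) (hc : HasCompactSupport u) (m : Fin 3) :
    |∫ x, d x * spin (u x) m| ≤ ∫ x, ‖d x‖ * ‖u x‖ ^ 2 := by
  have hi : Integrable (fun x => ‖d x‖ * ‖u x‖ ^ 2) volume := by
    have hcs : HasCompactSupport fun x => ‖u x‖ ^ 2 := by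
      refine hc.mono fun x hx => ?_
      contrapose! hx
      have : u x = 0 := by simpa using hx
      simp [this]
    have := (hd.integrable_smul_left_of_hasCompactSupport (hu.continuous.norm.pow 2) hcs).norm
    refine this.congr (ae_of_all _ fun x => ?_)
    simp [mul_comm]
  rw [← Real.norm_eq_abs]
  refine norm_integral_le_of_norm_le hi (ae_of_all _ fun x => ?_)
  rw [norm_mul]
  gcongr
  exact abs_spin_le m (u x)

theorem HasWeakPartial.add_const {k : Fin 3} {f g : R3 → ℝ} (h : HasWeakPartial k f g) (w : ℝ) :
    HasWeakPartial k (fun x => f x + w) g := by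
  have h1 := h.sub (HasWeakPartial.of_contDiff (k := k) (f := fun _ : R3 => -w) contDiff_const)
  have e : pd k (fun _ : R3 => -w) = 0 := by
    funext x
    simp [pd]
  rw [e, sub_zero] at h1
  convert h1 using 1
  funext x
  simp

theorem rpow_const_mul_cube {K S : ℝ} (hK : 0 ≤ K) (hS : 0 ≤ S) (p : ℝ) :
    (K * S ^ 3) ^ p = K ^ p * S ^ (3 * p) := by
  rw [Real.mul_rpow hK (by positivity), ← Real.rpow_natCast, ← Real.rpow_mul hS]
  norm_num

variable {b : Fin 3 → R3 → ℝ} {ψ : R3 → C2} {g : Fin 3 → R3 → C2} {d : Fin 3 → Fin 3 → R3 → ℝ}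

/-- The difference of the Pauli and the Schrödinger kinetic energies is not changed by adding a
constant to the potential. -/
theorem kin_pauli_sub_schroedinger_congr (ħ : ℝ) (hb : ∀ k, MemLp (b k) 6 volume)
    (hd : ∀ k l, HasWeakPartial k (b l) (d k l)) (hψ : MemLp ψ 2 volume)
    (hg : ∀ k, HasWeakPartial k ψ (g k)) (hgL : ∀ k, MemLp (g k) 2 volume) (w w' : Fin 3 → ℝ) :
    kin ħ .P (fun k x => b k x + w k) g ψ - kin ħ .S (fun k x => b k x + w k) g ψ =
      kin ħ .P (fun k x => b k x + w' k) g ψ - kin ħ .S (fun k x => b k x + w' k) g ψ := by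
  obtain ⟨u, hu, huc, -, -, hkin⟩ := exists_kin_approx ħ hb hψ hg hgL
  have hu1 : ∀ n, ContDiff ℝ 1 (u n) := fun n => (hu n).of_le (by simp)
  have hL : ∀ n (w : Fin 3 → ℝ) k,
      MemLp (cov ħ (fun k x => b k x + w k) (fun k => pd k (u n)) (u n) k) 2
      volume := fun n w =>
    memLp_cov hb w ((hu n).continuous.memLp_of_hasCompactSupport (huc n))
      (fun k => HasWeakPartial.of_contDiff (hu1 n)) fun k =>
        (continuous_pd (hu1 n)).memLp_of_hasCompactSupport (hasCompactSupport_pd (huc n))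
  refine tendsto_nhds_unique ((hkin w .P).sub (hkin w .S)) ?_
  refine ((hkin w' .P).sub (hkin w' .S)).congr fun n => ?_
  rw [kin_pauli_sub_schroedinger ħ (a := fun k x => b k x + w' k)
      (fun k l => (hd k l).add_const (w' l)) (hu n) (huc n) (hL n w'),
    kin_pauli_sub_schroedinger ħ (a := fun k x => b k x + w k)
      (fun k l => (hd k l).add_const (w l)) (hu n) (huc n) (hL n w)]

/-- The Schrödinger kinetic energy is controlled by the Pauli kinetic energy and the magnetic
field. -/
theorem exists_kin_schroedinger_le {ħ : ℝ} (hħ : 0 < ħ) : ∃ C : ℝ, 0 ≤ C ∧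
    ∀ (b : Fin 3 → R3 → ℝ) (d : Fin 3 → Fin 3 → R3 → ℝ) (w : Fin 3 → ℝ) (ψ : R3 → C2)
    (g : Fin 3 → R3 → C2) (Y : ℝ), (∀ k, MemLp (b k) 6 volume) →
    (∀ k l, HasWeakPartial k (b l) (d k l)) → 0 ≤ Y →
    (∀ k l, ∫⁻ x, ‖d k l x‖ₑ ^ 2 ≤ ENNReal.ofReal Y) →
    MemLp ψ 2 volume → (∀ k, HasWeakPartial k ψ (g k)) → (∀ k, MemLp (g k) 2 volume) →
    kin ħ .S (fun k x => b k x + w k) g ψ ≤ kin ħ .P (fun k x => b k x + w k) g ψ +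
      C * Y ^ (1 / 2 : ℝ) * kin ħ .S (fun k x => b k x + w k) g ψ ^ (3 / 4 : ℝ) *
        normSqL2 ψ ^ (1 / 4 : ℝ) := by
  obtain ⟨C, hC⟩ := exists_diamagnetic_H1_const
  have hK : 0 ≤ (C : ℝ) * ((ħ⁻¹) ^ 2) ^ 3 := by positivity
  refine ⟨6 * ħ * ((C : ℝ) * ((ħ⁻¹) ^ 2) ^ 3) ^ (1 / 4 : ℝ), by positivity,
    fun b d w ψ g Y hb hd hY0 hY hψ hg hgL => ?_⟩
  obtain ⟨u, hu, huc, -, hnorm, hkin⟩ := exists_kin_approx ħ hb hψ hg hgL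
  have hlim := (hkin w .P).add (((((hkin w .S).rpow_const (p := 3 / 4)
    (Or.inr (by norm_num)))).const_mul (6 * ħ * ((C : ℝ) * ((ħ⁻¹) ^ 2) ^ 3) ^ (1 / 4 : ℝ) *
      Y ^ (1 / 2 : ℝ))).mul (hnorm.rpow_const (p := 1 / 4) (Or.inr (by norm_num))))
  refine le_of_tendsto_of_tendsto' (hkin w .S) hlim fun n => ?_
  have hu1 : ContDiff ℝ 1 (u n) := (hu n).of_le (by simp)
  have huL : MemLp (u n) 2 volume := (hu n).continuous.memLp_of_hasCompactSupport (huc n)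
  have hpL : ∀ k, MemLp (pd k (u n)) 2 volume := fun k =>
    (continuous_pd hu1).memLp_of_hasCompactSupport (hasCompactSupport_pd (huc n))
  have hpw : ∀ k, HasWeakPartial k (u n) (pd k (u n)) := fun k => HasWeakPartial.of_contDiff hu1
  have h6 := hC ħ hħ b w (u n) _ hb huL hpw hpL
  have hid := kin_pauli_sub_schroedinger ħ (a := fun k x => b k x + w k)
    (fun k l => (hd k l).add_const (w l)) (hu n) (huc n) (memLp_cov hb w huL hpw hpL)
  set S := kin ħ .S (fun k x => b k x + w k) (fun k => pd k (u n)) (u n)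
  set P := kin ħ .P (fun k x => b k x + w k) (fun k => pd k (u n)) (u n)
  have hS : 0 ≤ S := kin_nonneg _ _ _ _ _
  have hN : 0 ≤ normSqL2 (u n) := normSqL2_nonneg _
  rw [mul_pow, ← mul_assoc] at h6
  set K := (C : ℝ) * ((ħ⁻¹) ^ 2) ^ 3
  have hbd : ∀ k l m, |∫ x, d k l x * spin (u n x) m| ≤
      Y ^ (1 / 2 : ℝ) * (K ^ (1 / 4 : ℝ) * S ^ (3 / 4 : ℝ)) * normSqL2 (u n) ^ (1 / 4 : ℝ) := by
    intro k l m
    refine (abs_integral_mul_spin_le (hd k l).locallyIntegrable_deriv (hu n) (huc n) m).trans ?_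
    refine (integral_norm_mul_sq_le_two
      (hd k l).locallyIntegrable_deriv.aestronglyMeasurable huL.1 (by positivity) hY0 hN (hY k l) h6
      (ofReal_normSqL2 huL).ge).trans_eq ?_
    rw [rpow_const_mul_cube hK hS]
    norm_num
  have t := fun k l m => abs_le.1 (hbd k l m)
  have hfin : P - S ≥ -(ħ * (6 * (Y ^ (1 / 2 : ℝ) * (K ^ (1 / 4 : ℝ) * S ^ (3 / 4 : ℝ)) *
      normSqL2 (u n) ^ (1 / 4 : ℝ)))) := by
    rw [hid, ge_iff_le, ← mul_neg]
    gcongr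
    linarith [(t 1 0 2).1, (t 2 0 1).2, (t 2 1 0).1, (t 0 1 2).2, (t 0 2 1).1, (t 1 2 0).2]
  linarith [hfin]

end Estimates

section Spaces

theorem hasWeakPartial_and_memLp_of_exists {F : Type*} [NormedAddCommGroup F] [NormedSpace ℝ F]
    [CompleteSpace F] {k : Fin 3} {f : R3 → F} (h : ∃ g, HasWeakPartial k f g ∧ MemLp g 2 volume) :
    HasWeakPartial k f (weakPartial k f) ∧ MemLp (weakPartial k f) 2 volume := by
  obtain ⟨g, hg, hL⟩ := h
  exact ⟨hg.weakPartial, hL.ae_eq (hg.ae_eq hg.weakPartial)⟩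

theorem MemD1.hasWeakPartial_component {A : R3 → R3} (hA : MemD1 A) (k l : Fin 3) :
    HasWeakPartial k (fun x => A x l) (fun x => weakPartial k A x l) :=
  (hasWeakPartial_and_memLp_of_exists (hA.memLp_deriv k)).1.clm_comp
    (EuclideanSpace.proj l : R3 →L[ℝ] ℝ)

theorem MemD1.memLp_component {A : R3 → R3} (hA : MemD1 A) (k l : Fin 3) :
    MemLp (fun x => weakPartial k A x l) 2 volume :=
  (EuclideanSpace.proj l : R3 →L[ℝ] ℝ).comp_memLp'
    (hasWeakPartial_and_memLp_of_exists (hA.memLp_deriv k)).2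

/-- The squared `L²`-norm of `∇ ⊗ A`. -/
def gradNormSq (A : R3 → R3) : ℝ := ∑ k, normSqL2 (weakPartial k A)

theorem gradNormSq_nonneg (A : R3 → R3) : 0 ≤ gradNormSq A :=
  Finset.sum_nonneg fun _ _ => normSqL2_nonneg _

theorem MemD1.lintegral_component_le {A : R3 → R3} (hA : MemD1 A) (k l : Fin 3) :
    ∫⁻ x, ‖weakPartial k A x l‖ₑ ^ 2 ≤ ENNReal.ofReal (normSqL2 (weakPartial k A)) := by
  rw [ofReal_normSqL2 (hasWeakPartial_and_memLp_of_exists (hA.memLp_deriv k)).2]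
  refine lintegral_mono fun x => ?_
  gcongr
  rw [← ofReal_norm, ← ofReal_norm]
  exact ENNReal.ofReal_le_ofReal (PiLp.norm_apply_le _ l)

theorem MemD1.lintegral_component_le_grad {A : R3 → R3} (hA : MemD1 A) (k l : Fin 3) :
    ∫⁻ x, ‖weakPartial k A x l‖ₑ ^ 2 ≤ ENNReal.ofReal (gradNormSq A) :=
  (hA.lintegral_component_le k l).trans <| ENNReal.ofReal_le_ofReal <|
    Finset.single_le_sum (f := fun k => normSqL2 (weakPartial k A))
      (fun _ _ => normSqL2_nonneg _) (Finset.mem_univ k)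

/-- The Sobolev inequality for the components of a field in `D¹`. -/
theorem exists_sobolev_field_const : ∃ C : ℝ≥0, ∀ A : R3 → R3, MemD1 A → ∀ l : Fin 3,
    MemLp (fun x => A x l) 6 volume ∧
      ∫⁻ x, ‖A x l‖ₑ ^ 6 ≤ ENNReal.ofReal (C * gradNormSq A ^ 3) := by
  obtain ⟨C, hC⟩ := exists_sobolev_D1_const
  refine ⟨C, fun A hA l => ?_⟩
  have h1 : ∫⁻ x, ‖A x l‖ₑ ^ 6 ≤ ENNReal.ofReal (C * gradNormSq A ^ 3) := by
    refine (hC (fun x => A x l) (fun k x => weakPartial k A x l)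
      (fun k => hA.hasWeakPartial_component k l) (fun k => hA.memLp_component k l)
      fun t ht => ?_).trans ?_
    · refine (measure_mono fun x hx => ?_).trans_lt (hA.vanish t ht)
      exact lt_of_lt_of_le hx (PiLp.norm_apply_le (A x) l)
    · rw [ENNReal.ofReal_mul NNReal.zero_le_coe, ENNReal.ofReal_coe_nnreal,
        ENNReal.ofReal_pow (gradNormSq_nonneg A), gradNormSq,
        ENNReal.ofReal_sum_of_nonneg fun _ _ => normSqL2_nonneg _]
      gcongr with k
      exact hA.lintegral_component_le k l
  exact ⟨memLp_six_of_lintegral 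
    (hA.hasWeakPartial_component 0 l).locallyIntegrable.aestronglyMeasurable
    (h1.trans_lt ENNReal.ofReal_lt_top).ne, h1⟩

end Spaces

section Functional

theorem re_inner_cov (ħ : ℝ) (a : Fin 3 → R3 → ℝ) (g : Fin 3 → R3 → C2) (ψ : R3 → C2) (k : Fin 3)
    (x : R3) : (inner ℂ (ψ x) (cov ħ a g ψ k x)).re =
      (inner ℂ (ψ x) ((Complex.I * (ħ : ℂ)) • g k x)).re + a k x * ‖ψ x‖ ^ 2 := by
  rw [cov, inner_add_right, Complex.add_re, inner_smul_right _ _ ((a k x : ℝ) : ℂ),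
    inner_self_eq_norm_sq_to_K]
  congr 1
  simp [← Complex.ofReal_pow]

theorem norm_add_real_smul_sq (D z : C2) (r : ℝ) :
    ‖D + (r : ℂ) • z‖ ^ 2 = ‖D‖ ^ 2 + r ^ 2 * ‖z‖ ^ 2 + 2 * r * (inner ℂ z D).re := by
  rw [norm_add_sq (𝕜 := ℂ), inner_smul_right, norm_smul, Complex.norm_real, mul_pow,
    Real.norm_eq_abs, sq_abs, ← inner_conj_symm D z, RCLike.re_eq_complex_re, Complex.re_ofReal_mul,
    Complex.conj_re]
  ring

theorem integrable_inner_C2 {f g : R3 → C2} (hf : MemLp f 2 volume) (hg : MemLp g 2 volume) :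
    Integrable (fun x => inner ℂ (f x) (g x)) volume := by
  have h := L2.integrable_inner (𝕜 := ℂ) (hf.toLp f) (hg.toLp g)
  refine h.congr ?_
  filter_upwards [hf.coeFn_toLp, hg.coeFn_toLp] with x h1 h2
  rw [h1, h2]

/-- The effect of a constant shift of the potential on the Schrödinger kinetic energy. -/
theorem kin_schroedinger_shift {ħ m : ℝ} {b : Fin 3 → R3 → ℝ} (hb : ∀ k, MemLp (b k) 6 volume)
    (v : R3) {ψ : R3 → C2} {g : Fin 3 → R3 → C2} (hψ : MemLp ψ 2 volume)
    (hg : ∀ k, HasWeakPartial k ψ (g k)) (hgL : ∀ k, MemLp (g k) 2 volume) :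
    kin ħ .S (fun k x => b k x + m * v k) g ψ = kin ħ .S b g ψ + m ^ 2 * ‖v‖ ^ 2 * normSqL2 ψ +
      2 * m * ((∫ x, inner ℂ (ψ x) ((Complex.I * (ħ : ℂ)) • ∑ k, v k • g k x)).re +
        ∑ k, v k * ∫ x, b k x * ‖ψ x‖ ^ 2) := by
  have hψ6 := memLp_six_of_H1 hψ hg hgL
  have hcov : ∀ k, MemLp (cov ħ b g ψ k) 2 volume := fun k => by
    simpa using memLp_cov (ħ := ħ) hb 0 hψ hg hgL k
  have hI : ∀ k, Integrable (fun x => inner ℂ (ψ x) ((Complex.I * (ħ : ℂ)) • g k x)) volume :=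
    fun k => integrable_inner_C2 hψ ((hgL k).const_smul (Complex.I * (ħ : ℂ)))
  have h1 : ∀ k, HasInt (fun x => ‖cov ħ b g ψ k x‖ ^ 2) (normSqL2 (cov ħ b g ψ k)) := fun k =>
    ⟨integrable_norm_sq (hcov k), rfl⟩
  have h2 : HasInt (fun x => ‖ψ x‖ ^ 2) (normSqL2 ψ) := ⟨integrable_norm_sq hψ, rfl⟩
  have h3 : ∀ k, HasInt (fun x => (inner ℂ (ψ x) ((Complex.I * (ħ : ℂ)) • g k x)).re)
      (∫ x, inner ℂ (ψ x) ((Complex.I * (ħ : ℂ)) • g k x)).re := fun k =>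
    ⟨(hI k).re, (Complex.reCLM.integral_comp_comm (hI k))⟩
  have h4 : ∀ k, HasInt (fun x => b k x * ‖ψ x‖ ^ 2) (∫ x, b k x * ‖ψ x‖ ^ 2) := fun k => by
    refine ⟨?_, rfl⟩
    refine (integrable_norm_mul_sq (hb k) hψ hψ6).mono ((hb k).1.mul (hψ.1.norm.pow 2))
      (ae_of_all _ fun x => ?_)
    simp
  have h5 : ∀ k, normSqL2 (cov ħ (fun k x => b k x + m * v k) g ψ k) =
      normSqL2 (cov ħ b g ψ k) + (m * v k) ^ 2 * normSqL2 ψ + 2 * (m * v k) *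
        ((∫ x, inner ℂ (ψ x) ((Complex.I * (ħ : ℂ)) • g k x)).re + ∫ x, b k x * ‖ψ x‖ ^ 2) := by
    intro k
    have h := (((h1 k).add (h2.const_mul ((m * v k) ^ 2))).add
      (((h3 k).add (h4 k)).const_mul (2 * (m * v k)))).2
    rw [← h, normSqL2]
    refine integral_congr_ae (ae_of_all _ fun x => ?_)
    have e : cov ħ (fun k x => b k x + m * v k) g ψ k x =
        cov ħ b g ψ k x + ((m * v k : ℝ) : ℂ) • ψ x := by
      simp only [cov, Complex.ofReal_add, add_smul]
      abel
    simp only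
    rw [e, norm_add_real_smul_sq, re_inner_cov]
  have h6 : ∫ x, inner ℂ (ψ x) ((Complex.I * (ħ : ℂ)) • ∑ k, v k • g k x) =
      ∑ k, (v k : ℂ) * ∫ x, inner ℂ (ψ x) ((Complex.I * (ħ : ℂ)) • g k x) := by
    simp only [← integral_const_mul]
    rw [← integral_finsetSum _ fun k _ => (hI k).const_mul _]
    refine integral_congr_ae (ae_of_all _ fun x => ?_)
    simp only [Finset.smul_sum, inner_sum]
    refine Finset.sum_congr rfl fun k _ => ?_
    rw [← Complex.coe_smul, smul_comm, inner_smul_right _ _ ((v k : ℝ) : ℂ)]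
  have h7 : ‖v‖ ^ 2 = ∑ k, v k ^ 2 := by
    rw [EuclideanSpace.norm_sq_eq]
    simp
  rw [h6, h7]
  simp only [kin, h5, Fin.sum_univ_three, Complex.add_re, Complex.mul_re, Complex.ofReal_re,
    Complex.ofReal_im]
  ring

/-- The functional after completing the square. -/
theorem functional_eq {ħ c m Q : ℝ} (hm : 0 < m) (j : Model) (v : R3)
    {ψ : R3 → C2} {A : R3 → R3} (hψ : MemH1 ψ) (hA : MemD1 A) :
    functional ħ c m Q j v ψ A =
      1 / (2 * m) * kin ħ j (fun k x => Q / c * A x k + m * v k) (fun k => weakPartial k ψ) ψ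
      - m * ‖v‖ ^ 2 / 2 * normSqL2 ψ
      + 1 / (8 * Real.pi) * (gradNormSq A - normSqL2 (dirDeriv (c⁻¹ • v) A))
      - ∑ k, v k * ∫ x, Q / c * A x k * ‖ψ x‖ ^ 2 := by
  obtain ⟨C, hC⟩ := exists_sobolev_field_const
  have hb : ∀ k, MemLp (fun x => Q / c * A x k) 6 volume := fun k => (hC A hA k).1.const_mul _
  have hd : ∀ k l, HasWeakPartial k (fun x => Q / c * A x l) fun x => Q / c * weakPartial k A x l :=
    fun k l => (hasWeakPartial_and_memLp_of_exists (hA.memLp_deriv k)).1.clm_comp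
      ((Q / c) • (EuclideanSpace.proj l : R3 →L[ℝ] ℝ))
  have hg := fun k => (hasWeakPartial_and_memLp_of_exists (hψ.memLp_deriv k)).1
  have hgL := fun k => (hasWeakPartial_and_memLp_of_exists (hψ.memLp_deriv k)).2
  have hS := kin_schroedinger_shift (ħ := ħ) (m := m) hb v hψ.memLp hg hgL
  have hj : kin ħ j (fun k x => Q / c * A x k + m * v k) (fun k => weakPartial k ψ) ψ -
      kin ħ .S (fun k x => Q / c * A x k + m * v k) (fun k => weakPartial k ψ) ψ =
      kin ħ j (fun k x => Q / c * A x k) (fun k => weakPartial k ψ) ψ -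
      kin ħ .S (fun k x => Q / c * A x k) (fun k => weakPartial k ψ) ψ := by
    cases j with
    | S => simp
    | P =>
      have := kin_pauli_sub_schroedinger_congr ħ hb hd hψ.memLp hg hgL (fun k => m * v k) 0
      simpa using this
  rw [functional, kineticNormSq_eq_kin, ← gradNormSq]
  have e : (∫ x, inner ℂ (ψ x) ((Complex.I * (ħ : ℂ)) • dirDeriv v ψ x)) =
    ∫ x, inner ℂ (ψ x) ((Complex.I * (ħ : ℂ)) • ∑ k, v k • weakPartial k ψ x) := rfl
  rw [e]
  have hk : kin ħ j (fun k x => Q / c * A x k + m * v k) (fun k => weakPartial k ψ) ψ =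
      kin ħ j (fun k x => Q / c * A x k) (fun k => weakPartial k ψ) ψ +
      m ^ 2 * ‖v‖ ^ 2 * normSqL2 ψ + 2 * m *
      ((∫ x, inner ℂ (ψ x) ((Complex.I * (ħ : ℂ)) • ∑ k, v k • weakPartial k ψ x)).re +
        ∑ k, v k * ∫ x, Q / c * A x k * ‖ψ x‖ ^ 2) := by linarith
  rw [hk]
  field_simp
  ring

end Functional

section Trial

/-- The plane wave with momentum `p`, as a spinor field. -/
def planeWave (p : R3) (x : R3) : C2 :=
  Complex.exp (Complex.I * ((inner ℝ p x : ℝ) : ℂ)) • EuclideanSpace.single 0 (1 : ℂ)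

theorem norm_planeWave (p x : R3) : ‖planeWave p x‖ = 1 := by
  rw [planeWave, norm_smul, mul_comm Complex.I, Complex.norm_exp_ofReal_mul_I]
  simp

theorem contDiff_planeWave (p : R3) : ContDiff ℝ ∞ (planeWave p) := by
  have h1 : ContDiff ℝ ∞ fun x : R3 => ((inner ℝ p x : ℝ) : ℂ) :=
    Complex.ofRealCLM.contDiff.comp (contDiff_const.inner ℝ contDiff_id)
  exact ((contDiff_const.mul h1).cexp).smul contDiff_const

theorem pd_planeWave (p : R3) (k : Fin 3) (x : R3) :
    pd k (planeWave p) x = (Complex.I * (p k : ℂ)) • planeWave p x := by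
  have h0 : HasFDerivAt (fun x : R3 => inner ℝ p x) (innerSL ℝ p) x := (innerSL ℝ p).hasFDerivAt
  have h1 : HasFDerivAt (fun x : R3 => ((inner ℝ p x : ℝ) : ℂ))
      (Complex.ofRealCLM.comp (innerSL ℝ p)) x := Complex.ofRealCLM.hasFDerivAt.comp x h0
  have h2 : HasFDerivAt (planeWave p) _ x :=
    ((h1.const_mul Complex.I).cexp).smul_const (EuclideanSpace.single 0 (1 : ℂ))
  rw [pd, h2.fderiv]
  simp [planeWave, smul_smul, EuclideanSpace.inner_single_right]
  ring_nf

theorem integral_cutoff_scale (n : ℕ) (h : R3 → ℝ) :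
    ∫ x, h ((n + 1 : ℝ)⁻¹ • x) = (n + 1 : ℝ) ^ 3 * ∫ x, h x := by
  have := Measure.integral_comp_smul (volume : Measure R3) h (n + 1 : ℝ)⁻¹
  rw [this]
  have hp : (0 : ℝ) ≤ (n + 1 : ℝ) ^ 3 := by positivity
  simp [abs_of_nonneg hp]

theorem integral_cutoffBump_sq_pos : 0 < ∫ x, cutoffBump x ^ 2 := by
  refine Continuous.integral_pos_of_hasCompactSupport_nonneg_nonzero (x := 0)
    (cutoffBump.continuous.pow 2) ?_ (fun x => sq_nonneg _) ?_
  · refine cutoffBump.hasCompactSupport.mono fun x hx => ?_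
    contrapose! hx
    have : cutoffBump x = 0 := by simpa using hx
    simp [this]
  · have : cutoffBump (0 : R3) = 1 :=
      cutoffBump.one_of_mem_closedBall (by simp [cutoffBump])
    simp [this]

theorem normSqL2_congr {F : Type*} [NormedAddCommGroup F] [NormedSpace ℝ F] {f g : R3 → F}
    (h : f =ᵐ[volume] g) : normSqL2 f = normSqL2 g :=
  integral_congr_ae (h.mono fun x hx => by simp only [hx])

theorem kin_congr {ħ : ℝ} {j : Model} {a : Fin 3 → R3 → ℝ} {g g' : Fin 3 → R3 → C2} {ψ : R3 → C2}
    (h : ∀ k, g k =ᵐ[volume] g' k) : kin ħ j a g ψ = kin ħ j a g' ψ := by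
  have hcov : ∀ k, cov ħ a g ψ k =ᵐ[volume] cov ħ a g' ψ k := fun k =>
    (h k).mono fun x hx => by simp only [cov, hx]
  cases j with
  | S => exact Finset.sum_congr rfl fun k _ => normSqL2_congr (hcov k)
  | P =>
    refine normSqL2_congr ?_
    filter_upwards [ae_all_iff.2 hcov] with x hx
    simp only [hx]

theorem memH1_of_contDiff {f : R3 → C2} (hf : ContDiff ℝ ∞ f) (hc : HasCompactSupport f) :
    MemH1 f where
  memLp := hf.continuous.memLp_of_hasCompactSupport hc
  memLp_deriv k := ⟨pd k f, HasWeakPartial.of_contDiff (hf.of_le (by simp)),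
    (continuous_pd (hf.of_le (by simp))).memLp_of_hasCompactSupport (hasCompactSupport_pd hc)⟩

theorem weakPartial_zero (k : Fin 3) : weakPartial k (0 : R3 → R3) =ᵐ[volume] 0 := by
  have h := weakPartial_ae_eq_pd (k := k) (f := (0 : R3 → R3)) contDiff_const
  refine h.trans (ae_of_all _ fun x => ?_)
  simp [pd]

theorem memD1_zero : MemD1 (0 : R3 → R3) where
  locallyIntegrable := continuous_zero.locallyIntegrable
  memLp_deriv k := ⟨pd k 0, HasWeakPartial.of_contDiff contDiff_const, by
    have : pd k (0 : R3 → R3) = 0 := by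
      funext x
      simp [pd]
    rw [this]
    exact MemLp.zero⟩
  vanish t ht := by
    have : {x : R3 | t < ‖(0 : R3 → R3) x‖} = ∅ := by
      ext x
      simp [ht.le]
    rw [this]
    simp

theorem div_zero_field : div (0 : R3 → R3) =ᵐ[volume] 0 := by
  filter_upwards [ae_all_iff.2 fun k => weakPartial_zero k] with x hx
  simp [div, hx]

/-- There are states of arbitrarily small kinetic energy relative to a moving frame. -/
theorem exists_trial {ħ m lam : ℝ} (hħ : 0 < ħ) (hlam : 0 < lam) (v : R3) {ε : ℝ} (hε : 0 < ε) :
    ∃ φ : R3 → C2, MemH1 φ ∧ normSqL2 φ = lam ∧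
      ∀ j, kin ħ j (fun k _ => m * v k) (fun k => weakPartial k φ) φ ≤ ε := by
  set I₀ := ∫ x, cutoffBump x ^ 2
  have hI₀ : 0 < I₀ := integral_cutoffBump_sq_pos
  set I₁ := ∑ k : Fin 3, ∫ x, pd k cutoffBump x ^ 2
  have hlim : Tendsto (fun n : ℕ => ħ ^ 2 * (lam / I₀) * I₁ * (1 / ((n : ℝ) + 1)) ^ 2) atTop
      (𝓝 0) := by
    simpa using ((tendsto_one_div_add_atTop_nhds_zero_nat (𝕜 := ℝ)).pow 2).const_mul
      (ħ ^ 2 * (lam / I₀) * I₁)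
  obtain ⟨n, hn⟩ := (hlim.eventually_lt_const hε).exists
  set N : ℝ := (n : ℝ) + 1
  have hN : 0 < N := by positivity
  set η : ℝ := √(lam / (N ^ 3 * I₀))
  have hη : η ^ 2 = lam / (N ^ 3 * I₀) := Real.sq_sqrt (by positivity)
  set p : R3 := (m / ħ) • v
  let χ : R3 → ℝ := fun x => η * cutoff n x
  have hχ : ContDiff ℝ ∞ χ := contDiff_const.mul (contDiff_cutoff n)
  have hχ1 : ContDiff ℝ 1 χ := hχ.of_le (by simp)
  let φ : R3 → C2 := fun x => χ x • planeWave p x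
  have hφ : ContDiff ℝ ∞ φ := hχ.smul (contDiff_planeWave p)
  have hφ1 : ContDiff ℝ 1 φ := hφ.of_le (by simp)
  have hφc : HasCompactSupport φ := (hasCompactSupport_cutoff n).mul_left.smul_right
  have hH1 : MemH1 φ := memH1_of_contDiff hφ hφc
  have hpd : ∀ k x, pd k χ x = η * (N⁻¹ * pd k cutoffBump (N⁻¹ • x)) := fun k x => by
    have h := pd_clm (η • ContinuousLinearMap.id ℝ ℝ) (k := k)
      ((contDiff_cutoff n).of_le (by simp) : ContDiff ℝ 1 (cutoff n)) x
    rw [pd_cutoff] at h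
    exact h
  have hcov : ∀ k x, cov ħ (fun k _ => m * v k) (fun k => pd k φ) φ k x =
      (Complex.I * ((ħ * pd k χ x : ℝ) : ℂ)) • planeWave p x := fun k x => by
    have hp : (p k : ℂ) = m / ħ * v k := by simp [p]
    have hne : (ħ : ℂ) ≠ 0 := by exact_mod_cast hħ.ne'
    have h1 := pd_smul (k := k) hχ1 ((contDiff_planeWave p).of_le (by simp)) x
    rw [cov, h1, pd_planeWave, hp]
    simp only [φ, ← Complex.coe_smul, smul_smul, ← add_smul]
    congr 1
    push_cast
    field_simp
    linear_combination (χ x : ℂ) * m * v k * Complex.I_sq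
  have hkinS : kin ħ .S (fun k _ => m * v k) (fun k => pd k φ) φ =
      ħ ^ 2 * (lam / I₀) * I₁ * (1 / N) ^ 2 := by
    have h1 : ∀ k, normSqL2 (cov ħ (fun k _ => m * v k) (fun k => pd k φ) φ k) =
        ħ ^ 2 * η ^ 2 * N⁻¹ ^ 2 * (N ^ 3 * ∫ x, pd k cutoffBump x ^ 2) := fun k => by
      rw [← integral_cutoff_scale n fun x => pd k cutoffBump x ^ 2, ← integral_const_mul]
      refine integral_congr_ae (ae_of_all _ fun x => ?_)
      simp only [hcov, norm_smul, norm_planeWave, norm_mul, Complex.norm_I, Complex.norm_real,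
        Real.norm_eq_abs, hpd, one_mul, mul_one]
      simp only [mul_pow, sq_abs]
      ring
    simp only [kin, h1, hη, ← Finset.mul_sum]
    field_simp
    rfl
  have hkin : ∀ j, kin ħ j (fun k _ => m * v k) (fun k => pd k φ) φ =
      ħ ^ 2 * (lam / I₀) * I₁ * (1 / N) ^ 2 := fun j => by
    cases j with
    | S => exact hkinS
    | P =>
      have hL : ∀ k, MemLp (cov ħ (fun k _ => m * v k) (fun k => pd k φ) φ k) 2 volume := by
        have := memLp_cov (ħ := ħ) (b := fun _ _ => 0) (fun k => MemLp.zero') (fun k => m * v k)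
          hH1.memLp (fun k => HasWeakPartial.of_contDiff (k := k) hφ1) fun k =>
            (continuous_pd hφ1).memLp_of_hasCompactSupport (hasCompactSupport_pd hφc)
        simpa using this
      have h := kin_pauli_sub_schroedinger ħ (a := fun k _ => m * v k) (d := fun _ _ _ => 0)
        (fun k l => by
          have := HasWeakPartial.of_contDiff (k := k) (f := fun _ : R3 => m * v l) contDiff_const
          have e : pd k (fun _ : R3 => m * v l) = fun _ => 0 := by
            funext x
            simp [pd]
          rwa [e] at this) hφ hφc hL
      simp only [zero_mul, integral_zero, sub_zero, add_zero, mul_zero] at h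
      rw [← hkinS]
      linarith
  refine ⟨φ, hH1, ?_, fun j => ?_⟩
  · have h1 : normSqL2 φ = η ^ 2 * (N ^ 3 * I₀) := by
      rw [← integral_cutoff_scale n fun x => cutoffBump x ^ 2, ← integral_const_mul]
      refine integral_congr_ae (ae_of_all _ fun x => ?_)
      simp only [φ, χ, norm_smul, norm_planeWave, Real.norm_eq_abs, mul_one, sq_abs, mul_pow]
      rfl
    rw [h1, hη]
    field_simp
  · rw [kin_congr fun k => weakPartial_ae_eq_pd hφ1, hkin j]
    exact hn.le

/-- The minimal value of the functional is at most `-m |v|² λ / 2`. -/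
theorem IsMinimizer.functional_le {ħ c m Q lam : ℝ} (hħ : 0 < ħ) (hm : 0 < m) (hlam : 0 < lam)
    {j : Model} {v : R3} {ψ : R3 → C2} {A : R3 → R3} (h : IsMinimizer ħ c m Q j lam v ψ A) :
    functional ħ c m Q j v ψ A ≤ -(m * ‖v‖ ^ 2 / 2 * lam) := by
  refine le_of_forall_pos_le_add fun ε hε => ?_
  obtain ⟨φ, hφ, hnorm, hkin⟩ := exists_trial (m := m) hħ hlam v (ε := 2 * m * ε) (by positivity)
  have hmem : (φ, (0 : R3 → R3)) ∈ constraintSet lam := ⟨hφ, memD1_zero, hnorm, div_zero_field⟩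
  have hle := isMinOn_iff.1 h.2 _ hmem
  refine hle.trans ?_
  simp only
  rw [functional_eq hm j v hφ memD1_zero]
  have h1 : gradNormSq (0 : R3 → R3) = 0 := by
    refine Finset.sum_eq_zero fun k _ => ?_
    rw [normSqL2_congr (weakPartial_zero k)]
    simp [normSqL2]
  have h2 : normSqL2 (dirDeriv (c⁻¹ • v) (0 : R3 → R3)) = 0 := by
    have : dirDeriv (c⁻¹ • v) (0 : R3 → R3) =ᵐ[volume] 0 := by
      filter_upwards [ae_all_iff.2 fun k => weakPartial_zero k] with x hx
      simp [dirDeriv, hx]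
    rw [normSqL2_congr this]
    simp [normSqL2]
  have h3 := hkin j
  have e : (fun (k : Fin 3) (x : R3) => Q / c * (0 : R3 → R3) x k + m * v k) =
      fun k _ => m * v k := by
    funext k x
    simp
  rw [h1, h2, e, hnorm]
  have h4 : 1 / (2 * m) * kin ħ j (fun k _ => m * v k) (fun k => weakPartial k φ) φ ≤ ε := by
    rw [one_div, inv_mul_le_iff₀ (by positivity)]
    exact h3
  simp
  simp at h4
  linarith

end Trial

section Main

theorem abs_normSqL2_sub_le {F : Type*} [NormedAddCommGroup F] [NormedSpace ℝ F] {p q : R3 → F}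
    (hp : MemLp p 2 volume) (hq : MemLp q 2 volume) {r : ℝ} (hr : 0 < r) :
    |normSqL2 (fun x => p x - q x) - normSqL2 q| ≤
      (1 + r⁻¹) * normSqL2 p + r * normSqL2 q := by
  have h1 : HasInt (fun x => ‖p x - q x‖ ^ 2) (normSqL2 fun x => p x - q x) :=
    ⟨integrable_norm_sq (hp.sub hq), rfl⟩
  have h2 : HasInt (fun x => ‖q x‖ ^ 2) (normSqL2 q) := ⟨integrable_norm_sq hq, rfl⟩
  have h3 : HasInt (fun x => ‖p x‖ ^ 2) (normSqL2 p) := ⟨integrable_norm_sq hp, rfl⟩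
  have h4 := h1.sub h2
  have h5 := (h3.const_mul (1 + r⁻¹)).add (h2.const_mul r)
  rw [← h4.2, ← h5.2, ← Real.norm_eq_abs]
  refine norm_integral_le_of_norm_le h5.1 (ae_of_all _ fun x => ?_)
  have t1 : ‖p x - q x‖ ≤ ‖p x‖ + ‖q x‖ := norm_sub_le _ _
  have t2 : ‖q x‖ ≤ ‖p x - q x‖ + ‖p x‖ := by
    have := norm_sub_le (p x) (p x - q x)
    simp only [sub_sub_cancel] at this
    linarith
  have hyoung : 2 * (‖p x‖ * ‖q x‖) ≤ r⁻¹ * ‖p x‖ ^ 2 + r * ‖q x‖ ^ 2 := by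
    have : 0 ≤ r⁻¹ * (‖p x‖ - r * ‖q x‖) ^ 2 := by positivity
    have e : r⁻¹ * (‖p x‖ - r * ‖q x‖) ^ 2 =
        r⁻¹ * ‖p x‖ ^ 2 + r * ‖q x‖ ^ 2 - 2 * (‖p x‖ * ‖q x‖) := by
      field_simp
      ring
    linarith
  have n1 := norm_nonneg (p x)
  have n2 := norm_nonneg (q x)
  have n3 := norm_nonneg (p x - q x)
  rw [Real.norm_eq_abs, abs_le]
  constructor
  · rcases le_total ‖q x‖ ‖p x‖ with h | h
    · nlinarith
    · have : (‖q x‖ - ‖p x‖) ^ 2 ≤ ‖p x - q x‖ ^ 2 :=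
        pow_le_pow_left₀ (by linarith) (by linarith) 2
      nlinarith
  · have : ‖p x - q x‖ ^ 2 ≤ (‖p x‖ + ‖q x‖) ^ 2 := pow_le_pow_left₀ n3 t1 2
    nlinarith

theorem normSqL2_real_smul (r : ℝ) (ψ : R3 → C2) :
    normSqL2 (fun x => (r : ℂ) • ψ x) = r ^ 2 * normSqL2 ψ := by
  simp only [normSqL2, norm_smul, mul_pow, Complex.norm_real, Real.norm_eq_abs, sq_abs]
  rw [integral_const_mul]

/-- The kinetic energy is close to that of a uniform motion if the kinetic energy relative to the
moving frame is small. -/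
theorem abs_kin_sub_le {ħ m : ℝ} (j : Model) {b : Fin 3 → R3 → ℝ} (hb : ∀ k, MemLp (b k) 6 volume)
    (v : R3) {ψ : R3 → C2} {g : Fin 3 → R3 → C2} (hψ : MemLp ψ 2 volume)
    (hg : ∀ k, HasWeakPartial k ψ (g k)) (hgL : ∀ k, MemLp (g k) 2 volume) {r : ℝ} (hr : 0 < r) :
    |kin ħ j b g ψ - m ^ 2 * ‖v‖ ^ 2 * normSqL2 ψ| ≤
      (1 + r⁻¹) * kin ħ j (fun k x => b k x + m * v k) g ψ +
        r * (m ^ 2 * ‖v‖ ^ 2 * normSqL2 ψ) := by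
  have hp := memLp_cov (ħ := ħ) hb (fun k => m * v k) hψ hg hgL
  have hq : ∀ k, MemLp (fun x => ((m * v k : ℝ) : ℂ) • ψ x) 2 volume := fun k =>
    hψ.const_smul ((m * v k : ℝ) : ℂ)
  have e : ∀ k x, cov ħ b g ψ k x = cov ħ (fun k x => b k x + m * v k) g ψ k x -
      ((m * v k : ℝ) : ℂ) • ψ x := fun k x => by
    simp only [cov, Complex.ofReal_add, add_smul]
    abel
  have hv : ‖v‖ ^ 2 = ∑ k, v k ^ 2 := by
    rw [EuclideanSpace.norm_sq_eq]
    simp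
  cases j with
  | S =>
    have hk : ∀ k, |normSqL2 (cov ħ b g ψ k) - (m * v k) ^ 2 * normSqL2 ψ| ≤
        (1 + r⁻¹) * normSqL2 (cov ħ (fun k x => b k x + m * v k) g ψ k) +
          r * ((m * v k) ^ 2 * normSqL2 ψ) := fun k => by
      have h := abs_normSqL2_sub_le (hp k) (hq k) hr
      rw [normSqL2_real_smul] at h
      have e' : cov ħ b g ψ k = fun x => cov ħ (fun k x => b k x + m * v k) g ψ k x -
        ((m * v k : ℝ) : ℂ) • ψ x := funext (e k)
      rw [e']
      exact h
    have e1 : m ^ 2 * ‖v‖ ^ 2 * normSqL2 ψ = ∑ k, (m * v k) ^ 2 * normSqL2 ψ := by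
      rw [hv, ← Finset.sum_mul, Finset.mul_sum]
      simp only [mul_pow]
    rw [e1, kin, kin, ← Finset.sum_sub_distrib, Finset.mul_sum, Finset.mul_sum,
      ← Finset.sum_add_distrib]
    exact (Finset.abs_sum_le_sum_abs _ _).trans (Finset.sum_le_sum fun k _ => hk k)
  | P =>
    have h := abs_normSqL2_sub_le (memLp_pauliSum hp) (memLp_pauliSum hq) hr
    have e1 : normSqL2 (fun x => pauliSum fun k => ((m * v k : ℝ) : ℂ) • ψ x) =
        m ^ 2 * ‖v‖ ^ 2 * normSqL2 ψ := by
      have h1 : ∀ x, ‖pauliSum fun k => ((m * v k : ℝ) : ℂ) • ψ x‖ ^ 2 =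
          m ^ 2 * ‖v‖ ^ 2 * ‖ψ x‖ ^ 2 := fun x => by
        have h2 := norm_pauliSum_smul_sq (m • v) (ψ x)
        rw [norm_smul, mul_pow, Real.norm_eq_abs, sq_abs] at h2
        exact h2
      simp only [normSqL2, h1]
      rw [integral_const_mul]
    rw [e1] at h
    have e2 : kin ħ .P b g ψ = normSqL2 fun x =>
        (pauliSum fun k => cov ħ (fun k x => b k x + m * v k) g ψ k x) -
          pauliSum fun k => ((m * v k : ℝ) : ℂ) • ψ x := by
      simp only [kin, e, pauliSum_sub]
    rw [e2]
    exact h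

theorem norm_dirDeriv_sq_le (u : R3) (A : R3 → R3) (x : R3) :
    ‖dirDeriv u A x‖ ^ 2 ≤ ‖u‖ ^ 2 * ∑ k, ‖weakPartial k A x‖ ^ 2 := by
  have h1 : ‖dirDeriv u A x‖ ≤ ∑ k, |u k| * ‖weakPartial k A x‖ := by
    refine (norm_sum_le _ _).trans_eq ?_
    simp [norm_smul]
  have h2 := Finset.sum_mul_sq_le_sq_mul_sq Finset.univ (fun k => |u k|)
    fun k => ‖weakPartial k A x‖
  have h3 : ‖u‖ ^ 2 = ∑ k, |u k| ^ 2 := by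
    rw [EuclideanSpace.norm_sq_eq]
    simp
  rw [h3]
  exact (pow_le_pow_left₀ (norm_nonneg _) h1 2).trans h2

theorem norm_curl_sq_le (A : R3 → R3) (x : R3) :
    ‖curl A x‖ ^ 2 ≤ 2 * ∑ k, ‖weakPartial k A x‖ ^ 2 := by
  simp only [EuclideanSpace.norm_sq_eq, Fin.sum_univ_three, Real.norm_eq_abs, sq_abs, curl]
  simp only [Matrix.cons_val]
  generalize weakPartial 0 A x = p, weakPartial 1 A x = q, weakPartial 2 A x = r
  nlinarith [sq_nonneg (q 2 + r 1), sq_nonneg (r 0 + p 2), sq_nonneg (p 1 + q 0),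
    sq_nonneg (p 0), sq_nonneg (q 1), sq_nonneg (r 2)]

theorem MemD1.hasInt_grad {A : R3 → R3} (hA : MemD1 A) :
    HasInt (fun x => ∑ k, ‖weakPartial k A x‖ ^ 2) (gradNormSq A) := by
  have h : ∀ k ∈ Finset.univ, Integrable (fun x => ‖weakPartial k A x‖ ^ 2) volume := fun k _ =>
    integrable_norm_sq (hasWeakPartial_and_memLp_of_exists (hA.memLp_deriv k)).2
  exact ⟨integrable_finsetSum _ h, integral_finsetSum _ h⟩

theorem MemD1.normSqL2_dirDeriv_le {A : R3 → R3} (hA : MemD1 A) (u : R3) :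
    normSqL2 (dirDeriv u A) ≤ ‖u‖ ^ 2 * gradNormSq A := by
  have h := hA.hasInt_grad.const_mul (‖u‖ ^ 2)
  rw [← h.2]
  exact integral_mono_of_nonneg (ae_of_all _ fun x => by positivity) h.1
    (ae_of_all _ fun x => norm_dirDeriv_sq_le u A x)

theorem MemD1.integral_field_le {A : R3 → R3} (hA : MemD1 A) {u : R3} (hu : ‖u‖ ≤ 1) :
    ∫ x, (‖curl A x‖ ^ 2 + ‖dirDeriv u A x‖ ^ 2) ≤ 3 * gradNormSq A := by
  have h := hA.hasInt_grad.const_mul 3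
  rw [← h.2]
  refine integral_mono_of_nonneg (ae_of_all _ fun x => by positivity) h.1
    (ae_of_all _ fun x => ?_)
  have h1 := norm_curl_sq_le A x
  have h2 := norm_dirDeriv_sq_le u A x
  have h3 : ‖u‖ ^ 2 * ∑ k, ‖weakPartial k A x‖ ^ 2 ≤ 1 * ∑ k, ‖weakPartial k A x‖ ^ 2 := by
    gcongr
    exact pow_le_one₀ (norm_nonneg _) hu
  simp only
  linarith

/-- The interaction with the field is controlled by the kinetic and the field energy. -/
theorem exists_interaction_const {ħ : ℝ} (hħ : 0 < ħ) (α : ℝ) {lam : ℝ} (hlam : 0 < lam) :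
    ∃ C : ℝ, 0 ≤ C ∧ ∀ (v : R3) (w : Fin 3 → ℝ) (ψ : R3 → C2) (A : R3 → R3), MemH1 ψ → MemD1 A →
      normSqL2 ψ = lam → ∑ k, v k * ∫ x, α * A x k * ‖ψ x‖ ^ 2 ≤
        C * ‖v‖ * gradNormSq A ^ (1 / 2 : ℝ) * kin ħ .S (fun k x => α * A x k + w k)
          (fun k => weakPartial k ψ) ψ ^ (1 / 4 : ℝ) := by
  obtain ⟨C₁, hC₁⟩ := exists_sobolev_field_const
  obtain ⟨C₂, hC₂⟩ := exists_diamagnetic_H1_const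
  set K := (C₂ : ℝ) * ((ħ⁻¹) ^ 2) ^ 3
  have hK : 0 ≤ K := by positivity
  refine ⟨3 * |α| * (C₁ : ℝ) ^ (1 / 6 : ℝ) * K ^ (1 / 12 : ℝ) * lam ^ (3 / 4 : ℝ), by positivity,
    fun v w ψ A hψ hA hnorm => ?_⟩
  have hb : ∀ k, MemLp (fun x => α * A x k) 6 volume := fun k => (hC₁ A hA k).1.const_mul _
  have h6 := hC₂ ħ hħ (fun k x => α * A x k) w ψ _ hb hψ.memLp
    (fun k => (hasWeakPartial_and_memLp_of_exists (hψ.memLp_deriv k)).1)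
    (fun k => (hasWeakPartial_and_memLp_of_exists (hψ.memLp_deriv k)).2)
  set S := kin ħ .S (fun k x => α * A x k + w k) (fun k => weakPartial k ψ) ψ
  have hS : 0 ≤ S := kin_nonneg _ _ _ _ _
  rw [mul_pow, ← mul_assoc] at h6
  have hF := gradNormSq_nonneg A
  set B := (C₁ : ℝ) ^ (1 / 6 : ℝ) * gradNormSq A ^ (1 / 2 : ℝ) *
    (K ^ (1 / 12 : ℝ) * S ^ (1 / 4 : ℝ)) * lam ^ (3 / 4 : ℝ)
  have hB : 0 ≤ B := by positivity
  have h1 : ∀ k, ∫ x, ‖A x k‖ * ‖ψ x‖ ^ 2 ≤ B := fun k => by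
    have h := integral_norm_mul_sq_le_six (hC₁ A hA k).1.1 hψ.memLp.1
      (mul_nonneg hK (pow_nonneg hS 3)) (by positivity) hlam.le (hC₁ A hA k).2 h6
      (by rw [← hnorm, ofReal_normSqL2 hψ.memLp])
    rw [rpow_const_mul_cube NNReal.zero_le_coe hF, rpow_const_mul_cube hK hS] at h
    refine h.trans_eq ?_
    norm_num [B]
  have h2 : ∀ k, v k * ∫ x, α * A x k * ‖ψ x‖ ^ 2 ≤ ‖v‖ * (|α| * B) := fun k => by
    have h3 : |∫ x, α * A x k * ‖ψ x‖ ^ 2| ≤ |α| * B := by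
      simp only [mul_assoc]
      rw [integral_const_mul, abs_mul]
      gcongr
      refine le_trans ?_ (h1 k)
      rw [← Real.norm_eq_abs]
      refine (norm_integral_le_integral_norm _).trans_eq ?_
      simp
    refine (le_abs_self _).trans ?_
    rw [abs_mul]
    gcongr
    exact PiLp.norm_apply_le v k
  refine (Finset.sum_le_sum fun k _ => h2 k).trans_eq ?_
  simp only [Finset.sum_const, Finset.card_univ, Fintype.card_fin, nsmul_eq_mul, B]
  push_cast
  ring

/-- The elementary bootstrap: a kinetic energy `P` and a field energy `y²` that are controlled by
their interaction are of order `x⁴`. -/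
theorem bootstrap {m a₁ a₂ x y s P : ℝ} (hm : 0 < m) (ha₁ : 0 ≤ a₁) (ha₂ : 0 ≤ a₂) (hx : 0 ≤ x)
    (hy : 0 ≤ y) (hs : 0 ≤ s) (hP : 0 ≤ P)
    (h₁ : 1 / (2 * m) * P + 1 / (16 * Real.pi) * y ^ 2 ≤ a₁ * x * y * s)
    (h₂ : s ^ 4 ≤ P + a₂ * y * s ^ 3) (h₃ : a₂ * (16 * Real.pi * a₁) * x ≤ 1 / 2) :
    P ≤ 2 * (2 * m * a₁ * (16 * Real.pi * a₁)) ^ 2 * x ^ 4 ∧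
      y ^ 2 ≤ 2 * (16 * Real.pi * a₁) ^ 2 * (2 * m * a₁ * (16 * Real.pi * a₁)) * x ^ 4 := by
  have hπ := Real.pi_pos
  set t := 16 * Real.pi * a₁ with ht
  have ht0 : 0 ≤ t := by positivity
  set q := 2 * m * a₁ * t with hq
  have hq0 : 0 ≤ q := by positivity
  have hy1 : y ≤ t * x * s := by
    rcases hy.eq_or_lt with h | h
    · rw [← h]
      positivity
    have h4 : 1 / (16 * Real.pi) * y ^ 2 ≤ a₁ * x * y * s :=
      le_trans (le_add_of_nonneg_left (by positivity)) h₁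
    rw [one_div, inv_mul_le_iff₀ (by positivity)] at h4
    refine le_of_mul_le_mul_right ?_ h
    calc y * y = y ^ 2 := by ring
      _ ≤ 16 * Real.pi * (a₁ * x * y * s) := h4
      _ = t * x * s * y := by rw [ht]; ring
  have hP1 : P ≤ q * x ^ 2 * s ^ 2 := by
    have h4 : 1 / (2 * m) * P ≤ a₁ * x * y * s :=
      le_trans (le_add_of_nonneg_right (by positivity)) h₁
    rw [one_div, inv_mul_le_iff₀ (by positivity)] at h4
    calc P ≤ 2 * m * (a₁ * x * y * s) := h4
      _ ≤ 2 * m * (a₁ * x * (t * x * s) * s) := by gcongr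
      _ = q * x ^ 2 * s ^ 2 := by rw [hq]; ring
  have hs2 : s ^ 2 ≤ 2 * q * x ^ 2 := by
    rcases hs.eq_or_lt with h | h
    · rw [← h, zero_pow two_ne_zero]
      positivity
    have h4 : a₂ * y * s ^ 3 ≤ 1 / 2 * s ^ 4 := by
      calc a₂ * y * s ^ 3 ≤ a₂ * (t * x * s) * s ^ 3 := by gcongr
        _ = a₂ * t * x * s ^ 4 := by ring
        _ ≤ 1 / 2 * s ^ 4 := by gcongr
    have h5 : s ^ 4 ≤ 2 * q * x ^ 2 * s ^ 2 := by linarith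
    refine le_of_mul_le_mul_right ?_ (pow_pos h 2)
    calc s ^ 2 * s ^ 2 = s ^ 4 := by ring
      _ ≤ _ := h5
  constructor
  · calc P ≤ q * x ^ 2 * s ^ 2 := hP1
      _ ≤ q * x ^ 2 * (2 * q * x ^ 2) := by gcongr
      _ = _ := by ring
  · calc y ^ 2 ≤ (t * x * s) ^ 2 := by gcongr
      _ = t ^ 2 * x ^ 2 * s ^ 2 := by ring
      _ ≤ t ^ 2 * x ^ 2 * (2 * q * x ^ 2) := by gcongr
      _ = _ := by ring

/-- The kinetic energy relative to the moving frame and the field energy of a minimizer are of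
fourth order in the velocity. -/
theorem exists_minimizer_bound {ħ c m Q : ℝ} (hħ : 0 < ħ) (hc : 0 < c) (hm : 0 < m) (j : Model)
    {lam : ℝ} (hlam : 0 < lam) : ∃ θ B₁ B₂ : ℝ, 0 < θ ∧ 0 ≤ B₁ ∧ 0 ≤ B₂ ∧
      ∀ (v : R3) (ψ : R3 → C2) (A : R3 → R3), ‖v‖ < θ → IsMinimizer ħ c m Q j lam v ψ A →
        kin ħ j (fun k x => Q / c * A x k + m * v k) (fun k => weakPartial k ψ) ψ ≤ B₁ * ‖v‖ ^ 4 ∧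
        gradNormSq A ≤ B₂ * ‖v‖ ^ 4 := by
  obtain ⟨C₀, hC₀⟩ := exists_sobolev_field_const
  obtain ⟨a₁, ha₁, hinteg⟩ := exists_interaction_const hħ (Q / c) hlam
  obtain ⟨C₂, hC₂0, hC₂⟩ := exists_kin_schroedinger_le hħ
  set a₂ := C₂ * |Q / c| * lam ^ (1 / 4 : ℝ)
  have ha₂ : 0 ≤ a₂ := by positivity
  have hπ := Real.pi_pos
  set t := 16 * Real.pi * a₁
  have ht : 0 ≤ t := by positivity
  refine ⟨min (c / 2) (1 / (2 * (a₂ * t + 1))), 2 * (2 * m * a₁ * t) ^ 2,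
    2 * t ^ 2 * (2 * m * a₁ * t), by positivity, by positivity, by positivity,
    fun v ψ A hv hmin => ?_⟩
  obtain ⟨hψ, hA, hnorm, -⟩ := hmin.1
  simp only at hψ hA hnorm
  have hvc : ‖v‖ < c / 2 := hv.trans_le (min_le_left _ _)
  have hvt : ‖v‖ < 1 / (2 * (a₂ * t + 1)) := hv.trans_le (min_le_right _ _)
  have hg := fun k => (hasWeakPartial_and_memLp_of_exists (hψ.memLp_deriv k)).1
  have hgL := fun k => (hasWeakPartial_and_memLp_of_exists (hψ.memLp_deriv k)).2
  have hb : ∀ k, MemLp (fun x => Q / c * A x k) 6 volume := fun k => (hC₀ A hA k).1.const_mul _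
  have hd : ∀ k l, HasWeakPartial k (fun x => Q / c * A x l) fun x => Q / c * weakPartial k A x l :=
    fun k l => (hasWeakPartial_and_memLp_of_exists (hA.memLp_deriv k)).1.clm_comp
      ((Q / c) • (EuclideanSpace.proj l : R3 →L[ℝ] ℝ))
  have hF := gradNormSq_nonneg A
  have hdL : ∀ k l, ∫⁻ x, ‖Q / c * weakPartial k A x l‖ₑ ^ 2 ≤
      ENNReal.ofReal ((Q / c) ^ 2 * gradNormSq A) := fun k l => by
    simp only [enorm_mul, mul_pow]
    rw [lintegral_const_mul' _ _ (by simp), ENNReal.ofReal_mul (by positivity),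
      ← sq_abs (Q / c), ENNReal.ofReal_pow (abs_nonneg _), ← Real.norm_eq_abs, ofReal_norm]
    gcongr
    exact hA.lintegral_component_le_grad k l
  have hle := hmin.functional_le hħ hm hlam
  rw [functional_eq hm j v hψ hA, hnorm] at hle
  have hI := hinteg v (fun k => m * v k) ψ A hψ hA hnorm
  have hSP := hC₂ (fun k x => Q / c * A x k) (fun k l x => Q / c * weakPartial k A x l)
    (fun k => m * v k) ψ _ _ hb hd (by positivity) hdL hψ.memLp hg hgL
  rw [hnorm] at hSP
  have hPS : kin ħ .S (fun k x => Q / c * A x k + m * v k) (fun k => weakPartial k ψ) ψ ≤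
      kin ħ j (fun k x => Q / c * A x k + m * v k) (fun k => weakPartial k ψ) ψ +
      C₂ * ((Q / c) ^ 2 * gradNormSq A) ^ (1 / 2 : ℝ) *
      kin ħ .S (fun k x => Q / c * A x k + m * v k) (fun k => weakPartial k ψ) ψ ^ (3 / 4 : ℝ) *
        lam ^ (1 / 4 : ℝ) := by
    cases j with
    | S =>
      have := kin_nonneg ħ .S (fun k x => Q / c * A x k + m * v k) (fun k => weakPartial k ψ) ψ
      exact le_add_of_nonneg_right (by positivity)
    | P => exact hSP
  set P := kin ħ j (fun k x => Q / c * A x k + m * v k) (fun k => weakPartial k ψ) ψ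
  have hP : 0 ≤ P := kin_nonneg _ _ _ _ _
  set S := kin ħ .S (fun k x => Q / c * A x k + m * v k) (fun k => weakPartial k ψ) ψ
  have hS : 0 ≤ S := kin_nonneg _ _ _ _ _
  have hG : normSqL2 (dirDeriv (c⁻¹ • v) A) ≤ 1 / 2 * gradNormSq A := by
    refine (hA.normSqL2_dirDeriv_le (c⁻¹ • v)).trans ?_
    gcongr
    have h1 : ‖c⁻¹ • v‖ ≤ 1 / 2 := by
      rw [norm_smul, norm_inv, Real.norm_of_nonneg hc.le, inv_mul_le_iff₀ hc]
      linarith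
    calc ‖c⁻¹ • v‖ ^ 2 ≤ (1 / 2 : ℝ) ^ 2 := by gcongr
      _ ≤ 1 / 2 := by norm_num
  have hy2 : (gradNormSq A ^ (1 / 2 : ℝ)) ^ 2 = gradNormSq A := by
    rw [← Real.rpow_natCast, ← Real.rpow_mul hF]
    norm_num
  have hs4 : (S ^ (1 / 4 : ℝ)) ^ 4 = S := by
    rw [← Real.rpow_natCast, ← Real.rpow_mul hS]
    norm_num
  have hs3 : (S ^ (1 / 4 : ℝ)) ^ 3 = S ^ (3 / 4 : ℝ) := by
    rw [← Real.rpow_natCast, ← Real.rpow_mul hS]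
    norm_num
  have hY : ((Q / c) ^ 2 * gradNormSq A) ^ (1 / 2 : ℝ) =
      |Q / c| * gradNormSq A ^ (1 / 2 : ℝ) := by
    rw [Real.mul_rpow (by positivity) hF, ← Real.sqrt_eq_rpow, Real.sqrt_sq_eq_abs]
  have key := bootstrap (m := m) (a₁ := a₁) (a₂ := a₂) (x := ‖v‖)
    (y := gradNormSq A ^ (1 / 2 : ℝ)) (s := S ^ (1 / 4 : ℝ)) (P := P) hm ha₁ ha₂ (norm_nonneg v)
    (by positivity) (by positivity) hP ?_ ?_ ?_
  · rw [hy2] at key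
    exact key
  · rw [hy2]
    have h8 : 1 / (16 * Real.pi) * gradNormSq A ≤
        1 / (8 * Real.pi) * (gradNormSq A - normSqL2 (dirDeriv (c⁻¹ • v) A)) := by
      calc 1 / (16 * Real.pi) * gradNormSq A
          = 1 / (8 * Real.pi) * (gradNormSq A - 1 / 2 * gradNormSq A) := by
            field_simp
            ring
        _ ≤ _ := by gcongr
    linarith
  · rw [hs4, hs3]
    refine hPS.trans_eq ?_
    rw [hY]
    ring
  · rw [lt_div_iff₀ (by positivity)] at hvt
    have : 0 ≤ ‖v‖ := norm_nonneg v
    change a₂ * t * ‖v‖ ≤ 1 / 2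
    linarith

end Main

end TravellingWave

end

theorem mainTheorem4 (ħ c m Q : ℝ) (hħ : 0 < ħ) (hc : 0 < c) (hm : 0 < m) (hQ : Q ≠ 0)
    (j : TravellingWave.Model) (lam : ℝ) (hlam : 0 < lam) :
    ∃ θ κ : ℝ, 0 < θ ∧ 0 < κ ∧
      ∀ v : TravellingWave.R3, 0 < ‖v‖ → ‖v‖ < θ →
        ∀ (ψ : TravellingWave.R3 → TravellingWave.C2)
          (A : TravellingWave.R3 → TravellingWave.R3),
          TravellingWave.IsMinimizer ħ c m Q j lam v ψ A →
            |TravellingWave.energy ħ c m Q j v ψ A - m * ‖v‖ ^ 2 / 2 * lam| ≤ κ * ‖v‖ ^ 3 := by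
  obtain ⟨θ, B₁, B₂, hθ, hB₁, hB₂, hbound⟩ :=
    TravellingWave.exists_minimizer_bound (Q := Q) hħ hc hm j hlam
  obtain ⟨C₀, hC₀⟩ := TravellingWave.exists_sobolev_field_const
  have hπ := Real.pi_pos
  refine ⟨min θ (min 1 c), 1 / (2 * m) * (2 * B₁ + m ^ 2 * lam) +
    1 / (8 * Real.pi) * (3 * B₂) * lam, by positivity, by positivity,
    fun v hv0 hv ψ A hmin => ?_⟩
  have hvθ : ‖v‖ < θ := hv.trans_le (min_le_left _ _)
  have hv1 : ‖v‖ ≤ 1 := (hv.trans_le ((min_le_right _ _).trans (min_le_left _ _))).le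
  have hvc : ‖v‖ ≤ c := (hv.trans_le ((min_le_right _ _).trans (min_le_right _ _))).le
  obtain ⟨hP, hF⟩ := hbound v ψ A hvθ hmin
  obtain ⟨hψ, hA, hnorm, -⟩ := hmin.1
  simp only at hψ hA hnorm
  have hkin := TravellingWave.abs_kin_sub_le (ħ := ħ) (m := m) j
    (fun k => (hC₀ A hA k).1.const_mul (Q / c)) v hψ.memLp
    (fun k => (TravellingWave.hasWeakPartial_and_memLp_of_exists (hψ.memLp_deriv k)).1)
    (fun k => (TravellingWave.hasWeakPartial_and_memLp_of_exists (hψ.memLp_deriv k)).2) hv0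
  have hfield := hA.integral_field_le (u := c⁻¹ • v) (by
    rw [norm_smul, norm_inv, Real.norm_of_nonneg hc.le, inv_mul_le_iff₀ hc]
    linarith)
  have hfield0 : 0 ≤ ∫ x, (‖TravellingWave.curl A x‖ ^ 2 +
      ‖TravellingWave.dirDeriv (c⁻¹ • v) A x‖ ^ 2) :=
    MeasureTheory.integral_nonneg fun x => by positivity
  rw [TravellingWave.energy, TravellingWave.kineticNormSq_eq_kin, hnorm]
  rw [hnorm] at hkin
  generalize TravellingWave.kin ħ j (fun k x => Q / c * A x k)
    (fun k => TravellingWave.weakPartial k ψ) ψ = T at hkin ⊢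
  generalize TravellingWave.kin ħ j (fun k x => Q / c * A x k + m * v k)
    (fun k => TravellingWave.weakPartial k ψ) ψ = P at hkin hP
  generalize (∫ x, (‖TravellingWave.curl A x‖ ^ 2 +
    ‖TravellingWave.dirDeriv (c⁻¹ • v) A x‖ ^ 2)) = W at hfield hfield0 ⊢
  set x := ‖v‖
  have hx43 : x ^ 4 ≤ x ^ 3 := pow_le_pow_of_le_one hv0.le hv1 (by norm_num)
  have hP' : (1 + x⁻¹) * P ≤ 2 * B₁ * x ^ 3 := by
    calc (1 + x⁻¹) * P ≤ (1 + x⁻¹) * (B₁ * x ^ 4) := by gcongr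
      _ = B₁ * x ^ 4 + B₁ * x ^ 3 := by field_simp
      _ ≤ B₁ * x ^ 3 + B₁ * x ^ 3 := by gcongr
      _ = 2 * B₁ * x ^ 3 := by ring
  have hT : |T - m ^ 2 * x ^ 2 * lam| ≤ (2 * B₁ + m ^ 2 * lam) * x ^ 3 := by
    refine hkin.trans ?_
    linarith [hP', (by ring : x * (m ^ 2 * x ^ 2 * lam) = m ^ 2 * lam * x ^ 3)]
  have hW : W ≤ 3 * B₂ * x ^ 3 := by
    calc W ≤ 3 * TravellingWave.gradNormSq A := hfield
      _ ≤ 3 * (B₂ * x ^ 4) := by gcongr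
      _ ≤ 3 * (B₂ * x ^ 3) := by gcongr
      _ = 3 * B₂ * x ^ 3 := by ring
  have e : 1 / (2 * m) * T + 1 / (8 * Real.pi) * W * lam - m * x ^ 2 / 2 * lam =
      1 / (2 * m) * (T - m ^ 2 * x ^ 2 * lam) + 1 / (8 * Real.pi) * W * lam := by
    field_simp
    ring
  rw [e]
  refine (abs_add_le _ _).trans ?_
  rw [abs_mul, abs_of_pos (by positivity : 0 < 1 / (2 * m)),
    abs_of_nonneg (by positivity : 0 ≤ 1 / (8 * Real.pi) * W * lam)]
  calc _ ≤ 1 / (2 * m) * ((2 * B₁ + m ^ 2 * lam) * x ^ 3) +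
        1 / (8 * Real.pi) * (3 * B₂ * x ^ 3) * lam := by gcongr
    _ = _ := by ring
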